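/- All matroids may be infinite (in the sense of Bruhn, Diestel, Kriesell, Pendavingh and Wollan); a matroid is *tame* if every intersection of a circuit with a cocircuit is finite. There are exactly $2^{2^{\aleph_0}}$ isomorphism classes of tame matroids on countable ground sets that have neither an $M(K_4)$-minor nor a $U_{2,4}$-minor. Moreover, that many are provided by the following construction. For a graph $G$, an *end* is an equivalence class of rays, where two rays are equivalent if no finite set of vertices separates them; $\Omega(G)$ is the set of ends. The space $|G|$ has as points the vertices, the ends and the interior points of the edges; basic open neighbourhoods of vertices and of interior points of edges are the balls of sufficiently small radius in the 1-complex $G$ with edges of length 1, and those of an end $\omega$ are the sets $\hat C(S,\omega)$, for $S\subseteq V(G)$ finite, of all vertices and interior points of edges contained in or incident with the component $C(S,\omega)$ of $G-S$ that contains a ray of $\omega$, together with all ends that have a ray in it. For $\Psi\subseteq\Omega(G)$ let $|G|_\Psi=|G|\setminus(\Omega(G)\setminus\Psi)$, and let $\tilde G_\Psi$ be the quotient of $|G|_\Psi$ that identifies two elements of $V(G)\cup\Psi$ whenever any two disjoint open sets covering $V(G)\cup\Psi$ have them on the same side. A *$\Psi$-circuit* is an edge set whose closure in $\tilde G_\Psi$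 is homeomorphic to the unit circle, and a *$\Psi^{\complement}$-bond* is a minimal nonempty cut of $G$ among those whose closure in $|G|_\Psi$ contains no end. A matroid is the *$\Psi$-matroid* of $G$ if its ground set is $E(G)$, its circuits are the $\Psi$-circuits and its cocircuits are the $\Psi^{\complement}$-bonds. There is a tree in which every vertex has finite degree at least $2$ and which has precisely one vertex of each finite degree $n\ge 2$. Let $T$ be any such tree, and let $G=T\times K_2$ be the graph obtained from two disjoint copies of $T$ by joining each vertex to its clone. Then: 1. $|\{\Psi : \Psi\subseteq\Omega(G)\}|=2^{2^{\aleph_0}}$. 2. For every $\Psi\subseteq\Omega(G)$ there is a unique $\Psi$-matroid $M(\Psi)$ of $G$. 3. Every $M(\Psi)$ is a tame matroid on a countable ground set, with no $M(K_4)$-minor and no $U_{2,4}$-minor. 4. If $M(\Psi)$ and $M(\Psi')$ are isomorphic, then $\Psi=\Psi'$. -/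

import Mathlib

open Set Cardinal

universe u v

namespace PsiMatroid

/-! ### Rays and ends -/

section Ends

variable {V : Type u}

/-- A ray of `G`: a one-way infinite path `R 0, R 1, R 2, …`. -/
structure Ray (G : SimpleGraph V) where
  toFun : ℕ → V
  injective : Function.Injective toFun
  adj : ∀ n, G.Adj (toFun n) (toFun (n + 1))

/-- `u` and `v` are vertices of `G - S` that lie in the same component of `G - S`. -/
def JoinedOff (G : SimpleGraph V) (S : Set V) (u v : V) : Prop :=
  ∃ p : G.Walk u v, ∀ w ∈ p.support, w ∉ S

theorem JoinedOff.symm {G : SimpleGraph V} {S : Set V} {u v : V} (h : JoinedOff G S u v) :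
    JoinedOff G S v u := by
  obtain ⟨p, hp⟩ := h
  exact ⟨p.reverse, by simpa using hp⟩

theorem JoinedOff.trans {G : SimpleGraph V} {S : Set V} {u v w : V}
    (h : JoinedOff G S u v) (h' : JoinedOff G S v w) : JoinedOff G S u w := by
  obtain ⟨p, hp⟩ := h
  obtain ⟨q, hq⟩ := h'
  refine ⟨p.append q, fun x hx => ?_⟩
  rcases (SimpleGraph.Walk.mem_support_append_iff p q).1 hx with hx | hx
  · exact hp x hx
  · exact hq x hx

/-- Two rays are equivalent if no finite set `S` of vertices separates them: for every finite `S`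
they have tails in the same component of `G - S`. -/
def Ray.Equivalent {G : SimpleGraph V} (R R' : Ray G) : Prop :=
  ∀ S : Set V, S.Finite → ∃ N, ∀ m ≥ N, ∀ n ≥ N, JoinedOff G S (R.toFun m) (R'.toFun n)

theorem Ray.joinedOff_tail {G : SimpleGraph V} (R : Ray G) {S : Set V} {N : ℕ}
    (hN : ∀ n ≥ N, R.toFun n ∉ S) (k : ℕ) : JoinedOff G S (R.toFun N) (R.toFun (N + k)) := by
  induction k with
  | zero => exact ⟨SimpleGraph.Walk.nil, by simpa using hN N le_rfl⟩
  | succ k ih =>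
    refine ih.trans ⟨SimpleGraph.Walk.cons (R.adj (N + k)) SimpleGraph.Walk.nil, ?_⟩
    intro w hw
    simp only [SimpleGraph.Walk.support_cons, SimpleGraph.Walk.support_nil, List.mem_cons,
      List.not_mem_nil, or_false] at hw
    rcases hw with rfl | rfl
    · exact hN _ (by omega)
    · exact hN _ (by omega)

theorem Ray.exists_tail_notMem {G : SimpleGraph V} (R : Ray G) {S : Set V} (hS : S.Finite) :
    ∃ N, ∀ n ≥ N, R.toFun n ∉ S := by
  obtain ⟨b, hb⟩ := (hS.preimage R.injective.injOn).bddAbove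
  exact ⟨b + 1, fun n hn h => by have := hb (show n ∈ R.toFun ⁻¹' S from h); omega⟩

theorem Ray.equivalent_equivalence (G : SimpleGraph V) :
    Equivalence (Ray.Equivalent (G := G)) where
  refl R S hS := by
    obtain ⟨N, hN⟩ := R.exists_tail_notMem hS
    refine ⟨N, fun m hm n hn => ?_⟩
    obtain ⟨k, rfl⟩ := Nat.exists_eq_add_of_le hm
    obtain ⟨l, rfl⟩ := Nat.exists_eq_add_of_le hn
    exact (R.joinedOff_tail hN k).symm.trans (R.joinedOff_tail hN l)
  symm h S hS := by
    obtain ⟨N, hN⟩ := h S hS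
    exact ⟨N, fun m hm n hn => (hN n hn m hm).symm⟩
  trans h h' S hS := by
    obtain ⟨N, hN⟩ := h S hS
    obtain ⟨N', hN'⟩ := h' S hS
    exact ⟨max N N', fun m hm n hn =>
      (hN m (le_trans (le_max_left _ _) hm) (max N N') (le_max_left _ _)).trans
        (hN' (max N N') (le_max_right _ _) n (le_trans (le_max_right _ _) hn))⟩

instance raySetoid (G : SimpleGraph V) : Setoid (Ray G) :=
  ⟨Ray.Equivalent, Ray.equivalent_equivalence G⟩

/-- The set `Ω(G)` of ends of `G`. -/
def Ends (G : SimpleGraph V) : Type u := Quotient (raySetoid G)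

/-- The end of `G` that contains the ray `R`. -/
def Ray.toEnd {G : SimpleGraph V} (R : Ray G) : Ends G := Quotient.mk (raySetoid G) R

/-- The vertex set of `C(S, ω)`, the component of `G - S` that contains a ray of the end `ω`. -/
def endComponent (G : SimpleGraph V) (S : Set V) (ω : Ends G) : Set V :=
  {v | ∃ R : Ray G, R.toEnd = ω ∧ ∀ n, JoinedOff G S v (R.toFun n)}

end Ends

/-! ### The topological space `|G|` -/

section Space

variable {V : Type u}

/-- The points of `|G|`: vertices, ends, and interior points of edges. Every edge is identified
with the unit interval through an arbitrary, but fixed, choice of a first endvertex. -/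
inductive GraphPoint (G : SimpleGraph V) : Type u
  | vert (v : V) : GraphPoint G
  | endPt (ω : Ends G) : GraphPoint G
  | inner (e : G.edgeSet) (x : Set.Ioo (0 : ℝ) 1) : GraphPoint G

/-- The endvertex of `e` at parameter `0`. -/
noncomputable def tail {G : SimpleGraph V} (e : G.edgeSet) : V := (Quot.out e.1).1

/-- The endvertex of `e` at parameter `1`. -/
noncomputable def head {G : SimpleGraph V} (e : G.edgeSet) : V := (Quot.out e.1).2

theorem mk_tail_head {G : SimpleGraph V} (e : G.edgeSet) : s(tail e, head e) = e.1 :=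
  Quot.out_eq e.1

/-- The set `Ĉ(S, ω)`: all vertices and all interior points of edges contained in or incident with
`C(S, ω)`, and all ends that have a ray in `C(S, ω)`. -/
def endNhd (G : SimpleGraph V) (S : Set V) (ω : Ends G) : Set (GraphPoint G) :=
  {p | match p with
    | .vert v => v ∈ endComponent G S ω
    | .endPt η => ∃ R : Ray G, R.toEnd = η ∧ ∀ n, R.toFun n ∈ endComponent G S ω
    | .inner e _ => ∃ v ∈ e.1, v ∈ endComponent G S ω}

/-- `U` is open in `|G|`: around each of its vertices it contains a ball of some radius `ε` (in the
1-complex of `G`, where all edges have length `1`), around each of its interior points of an edge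
it contains an interval of that edge, and around each of its ends `ω` it contains some `Ĉ(S, ω)`
with `S` a finite set of vertices. -/
def IsOpenSet (G : SimpleGraph V) (U : Set (GraphPoint G)) : Prop :=
  (∀ v : V, .vert v ∈ U → ∃ ε > (0 : ℝ), ∀ (e : G.edgeSet) (x : Set.Ioo (0 : ℝ) 1),
      ((tail e = v ∧ x.1 < ε) ∨ (head e = v ∧ 1 - x.1 < ε)) → .inner e x ∈ U) ∧
  (∀ (e : G.edgeSet) (x : Set.Ioo (0 : ℝ) 1), .inner e x ∈ U →
      ∃ ε > (0 : ℝ), ∀ y : Set.Ioo (0 : ℝ) 1, |x.1 - y.1| < ε → .inner e y ∈ U) ∧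
  (∀ ω : Ends G, .endPt ω ∈ U → ∃ S : Set V, S.Finite ∧ endNhd G S ω ⊆ U)

theorem JoinedOff.mono {G : SimpleGraph V} {S S' : Set V} (h : S ⊆ S') {u v : V}
    (huv : JoinedOff G S' u v) : JoinedOff G S u v := by
  obtain ⟨p, hp⟩ := huv
  exact ⟨p, fun w hw hS => hp w hw (h hS)⟩

theorem endComponent_anti (G : SimpleGraph V) {S S' : Set V} (h : S ⊆ S') (ω : Ends G) :
    endComponent G S' ω ⊆ endComponent G S ω := by
  rintro v ⟨R, hR, hv⟩
  exact ⟨R, hR, fun n => (hv n).mono h⟩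

theorem endNhd_anti (G : SimpleGraph V) {S S' : Set V} (h : S ⊆ S') (ω : Ends G) :
    endNhd G S' ω ⊆ endNhd G S ω := by
  have hc := endComponent_anti G h ω
  rintro (v | η | ⟨e, x⟩) hp
  · exact hc hp
  · obtain ⟨R, hR, hn⟩ := hp
    exact ⟨R, hR, fun n => hc (hn n)⟩
  · obtain ⟨v, hv, hvc⟩ := hp
    exact ⟨v, hv, hc hvc⟩

/-- The topology of `|G|`. -/
instance graphTopology (G : SimpleGraph V) : TopologicalSpace (GraphPoint G) where
  IsOpen := IsOpenSet G
  isOpen_univ := ⟨fun _ _ => ⟨1, one_pos, fun _ _ _ => mem_univ _⟩,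
    fun _ _ _ => ⟨1, one_pos, fun _ _ => mem_univ _⟩,
    fun _ _ => ⟨∅, finite_empty, subset_univ _⟩⟩
  isOpen_inter := by
    rintro U U' ⟨h1, h2, h3⟩ ⟨h1', h2', h3'⟩
    refine ⟨fun v hv => ?_, fun e x hx => ?_, fun ω hω => ?_⟩
    · obtain ⟨ε, hε, h⟩ := h1 v hv.1
      obtain ⟨ε', hε', h'⟩ := h1' v hv.2
      refine ⟨min ε ε', lt_min hε hε', fun e x hx => ⟨h e x ?_, h' e x ?_⟩⟩
      · exact hx.imp (fun a => ⟨a.1, a.2.trans_le (min_le_left _ _)⟩)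
          (fun a => ⟨a.1, a.2.trans_le (min_le_left _ _)⟩)
      · exact hx.imp (fun a => ⟨a.1, a.2.trans_le (min_le_right _ _)⟩)
          (fun a => ⟨a.1, a.2.trans_le (min_le_right _ _)⟩)
    · obtain ⟨ε, hε, h⟩ := h2 e x hx.1
      obtain ⟨ε', hε', h'⟩ := h2' e x hx.2
      exact ⟨min ε ε', lt_min hε hε', fun y hy =>
        ⟨h y (hy.trans_le (min_le_left _ _)), h' y (hy.trans_le (min_le_right _ _))⟩⟩
    · obtain ⟨S, hS, h⟩ := h3 ω hω.1
      obtain ⟨S', hS', h'⟩ := h3' ω hω.2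
      exact ⟨S ∪ S', hS.union hS', subset_inter
        ((endNhd_anti G subset_union_left ω).trans h)
        ((endNhd_anti G subset_union_right ω).trans h')⟩
  isOpen_sUnion := by
    intro s hs
    refine ⟨fun v hv => ?_, fun e x hx => ?_, fun ω hω => ?_⟩
    · obtain ⟨U, hU, hvU⟩ := hv
      obtain ⟨ε, hε, h⟩ := (hs U hU).1 v hvU
      exact ⟨ε, hε, fun e x hx => ⟨U, hU, h e x hx⟩⟩
    · obtain ⟨U, hU, hxU⟩ := hx
      obtain ⟨ε, hε, h⟩ := (hs U hU).2.1 e x hxU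
      exact ⟨ε, hε, fun y hy => ⟨U, hU, h y hy⟩⟩
    · obtain ⟨U, hU, hωU⟩ := hω
      obtain ⟨S, hS, h⟩ := (hs U hU).2.2 ω hωU
      exact ⟨S, hS, h.trans (subset_sUnion_of_mem hU)⟩

/-- The space `|G|_Ψ`: the subspace of `|G|` obtained by deleting all ends outside `Ψ`. -/
abbrev PsiSpace (G : SimpleGraph V) (Ψ : Set (Ends G)) : Type u :=
  {p : GraphPoint G // ∀ ω, p = .endPt ω → ω ∈ Ψ}

/-- The interior points, in `|G|_Ψ`, of the edges in `C`. -/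
def interiorPoints (G : SimpleGraph V) (Ψ : Set (Ends G)) (C : Set (Sym2 V)) :
    Set (PsiSpace G Ψ) :=
  {p | ∃ (e : G.edgeSet) (x : Set.Ioo (0 : ℝ) 1), e.1 ∈ C ∧ p.1 = .inner e x}

/-- The vertex set `V(G) ∪ Ψ` of the almost graph-like space `|G|_Ψ`. -/
def vertexPoints (G : SimpleGraph V) (Ψ : Set (Ends G)) : Set (PsiSpace G Ψ) :=
  {p | (∃ v, p.1 = .vert v) ∨ ∃ ω, p.1 = .endPt ω}

/-- Two points of `|G|_Ψ` are identified in the graph-like quotient if they are equal, or if both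
belong to the vertex set `V(G) ∪ Ψ` and any two disjoint open sets that cover `V(G) ∪ Ψ` have
them on the same side. -/
def PointEquiv (G : SimpleGraph V) (Ψ : Set (Ends G)) (p q : PsiSpace G Ψ) : Prop :=
  p = q ∨ (p ∈ vertexPoints G Ψ ∧ q ∈ vertexPoints G Ψ ∧
    ∀ U U' : Set (PsiSpace G Ψ), IsOpen U → IsOpen U' → Disjoint U U' →
      vertexPoints G Ψ ⊆ U ∪ U' → (p ∈ U ↔ q ∈ U))

/-- The equivalence relation of the graph-like quotient. -/
def pointSetoid (G : SimpleGraph V) (Ψ : Set (Ends G)) : Setoid (PsiSpace G Ψ) where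
  r := PointEquiv G Ψ
  iseqv :=
    { refl := fun p => Or.inl rfl
      symm := by
        rintro p q (rfl | ⟨hp, hq, h⟩)
        · exact Or.inl rfl
        · exact Or.inr ⟨hq, hp, fun U U' a b c d => (h U U' a b c d).symm⟩
      trans := by
        rintro p q r (rfl | ⟨hp, hq, h⟩) h'
        · exact h'
        · rcases h' with rfl | ⟨_, hr, h'⟩
          · exact Or.inr ⟨hp, hq, h⟩
          · exact Or.inr ⟨hp, hr, fun U U' a b c d =>
              (h U U' a b c d).trans (h' U U' a b c d)⟩ }

/-- The graph-like quotient of `|G|_Ψ`, with the quotient topology. -/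
abbrev GraphLikeQuotient (G : SimpleGraph V) (Ψ : Set (Ends G)) : Type u :=
  Quotient (pointSetoid G Ψ)

end Space

/-! ### `Ψ`-circuits, `Ψᶜ`-bonds and `Ψ`-matroids -/

section Systems

variable {V : Type u}

/-- `C` is a `Ψ`-circuit of `G`: an edge set whose closure in the graph-like quotient of `|G|_Ψ`
is homeomorphic to the unit circle. -/
def IsPsiCircuit (G : SimpleGraph V) (Ψ : Set (Ends G)) (C : Set (Sym2 V)) : Prop :=
  C ⊆ G.edgeSet ∧
    Nonempty (closure ((Quotient.mk (pointSetoid G Ψ) '' interiorPoints G Ψ C :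
      Set (GraphLikeQuotient G Ψ))) ≃ₜ Circle)

/-- `b` is a cut of `G`: the set of all edges between `X` and its complement, for some set `X` of
vertices. -/
def IsCut (G : SimpleGraph V) (b : Set (Sym2 V)) : Prop :=
  ∃ X : Set V, b = {e | e ∈ G.edgeSet ∧ ∃ x ∈ X, ∃ y ∉ X, e = s(x, y)}

/-- The closure of `b` in `|G|_Ψ` contains no ends. -/
def IsPsiBounded (G : SimpleGraph V) (Ψ : Set (Ends G)) (b : Set (Sym2 V)) : Prop :=
  ∀ p ∈ closure (interiorPoints G Ψ b), ∀ ω : Ends G, p.1 ≠ .endPt ω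

/-- `b` is a `Ψᶜ`-bond of `G`: a minimal nonempty `Ψ`-bounded cut. -/
def IsPsiComplBond (G : SimpleGraph V) (Ψ : Set (Ends G)) (b : Set (Sym2 V)) : Prop :=
  Minimal (fun c => c.Nonempty ∧ IsCut G c ∧ IsPsiBounded G Ψ c) b

/-- `(G, Ψ)` induces the matroid `M`, that is, `M` is the `Ψ`-matroid of `G`: the ground set is
`E(G)`, the circuits are the `Ψ`-circuits and the cocircuits are the `Ψᶜ`-bonds. -/
def Induces (G : SimpleGraph V) (Ψ : Set (Ends G)) (M : Matroid (Sym2 V)) : Prop :=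
  M.E = G.edgeSet ∧ (∀ C, M.IsCircuit C ↔ IsPsiCircuit G Ψ C) ∧
    ∀ b, M.IsCocircuit b ↔ IsPsiComplBond G Ψ b

end Systems

/-! ### Tame matroids, isomorphism, and the two excluded minors -/

section Matroids

variable {α : Type u} {β : Type v}

/-- Every intersection of a circuit with a cocircuit is finite. -/
def IsTame (M : Matroid α) : Prop :=
  ∀ C D, M.IsCircuit C → M.IsCocircuit D → (C ∩ D).Finite

/-- `M` and `N` are isomorphic: some bijection of their ground sets preserves independence in both
directions. -/
def IsIsomorphic (M : Matroid α) (N : Matroid β) : Prop :=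
  ∃ φ : M.E ≃ N.E, ∀ I : Set M.E,
    M.Indep (Subtype.val '' I) ↔ N.Indep (Subtype.val '' (φ '' I))

theorem isIsomorphic_equivalence : Equivalence (IsIsomorphic (α := α) (β := α)) where
  refl M := ⟨Equiv.refl _, fun I => by simp⟩
  symm := by
    rintro M N ⟨φ, h⟩
    refine ⟨φ.symm, fun I => ?_⟩
    have := h (φ.symm '' I)
    rw [Equiv.image_symm_image] at this
    exact this.symm
  trans := by
    rintro M N P ⟨φ, h⟩ ⟨ψ, h'⟩
    refine ⟨φ.trans ψ, fun I => ?_⟩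
    have hc : (φ.trans ψ) '' I = ψ '' (φ '' I) := by
      rw [Set.image_image]
      rfl
    rw [h I, h' (φ '' I), hc]

/-- `C` is the edge set of a (finite) cycle of the graph `H`. -/
def IsCycleEdgeSet {W : Type v} (H : SimpleGraph W) (C : Set (Sym2 W)) : Prop :=
  ∃ (w : W) (p : H.Walk w w), p.IsCycle ∧ C = {e | e ∈ p.edges}

/-- `N` is isomorphic to the cycle matroid `M(H)` of the finite graph `H`: some bijection from the
ground set of `N` to `E(H)` makes the circuits of `N` correspond to the cycles of `H`. -/
def IsIsoToCycleMatroid {W : Type v} [Finite W] (N : Matroid α) (H : SimpleGraph W) : Prop :=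
  ∃ φ : N.E ≃ H.edgeSet, ∀ C : Set N.E,
    N.IsCircuit (Subtype.val '' C) ↔ IsCycleEdgeSet H (Subtype.val '' (φ '' C))

/-- `M` has an `M(K₄)`-minor. -/
def HasMK4Minor (M : Matroid α) : Prop :=
  ∃ N : Matroid α, N.IsMinor M ∧ IsIsoToCycleMatroid N (⊤ : SimpleGraph (Fin 4))

/-- `N` is isomorphic to the uniform matroid `U_{2,4}`: it has four elements, and the independent
sets are the sets of at most two elements. -/
def IsIsoToU24 (N : Matroid α) : Prop :=
  N.E.encard = 4 ∧ ∀ I ⊆ N.E, N.Indep I ↔ I.encard ≤ 2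

/-- `M` has a `U_{2,4}`-minor. -/
def HasU24Minor (M : Matroid α) : Prop :=
  ∃ N : Matroid α, N.IsMinor M ∧ IsIsoToU24 N

/-- The tame matroids with neither an `M(K₄)`-minor nor a `U_{2,4}`-minor whose ground set is a
subset of `ℕ`. Up to isomorphism these are all such matroids on a countable ground set. -/
abbrev CountableTameClass : Type :=
  {M : Matroid ℕ // IsTame M ∧ ¬ HasMK4Minor M ∧ ¬ HasU24Minor M}

/-- Isomorphism as an equivalence relation on this class. -/
def isoSetoid : Setoid CountableTameClass where
  r M N := IsIsomorphic M.1 N.1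
  iseqv :=
    { refl := fun M => isIsomorphic_equivalence.refl M.1
      symm := fun h => isIsomorphic_equivalence.symm h
      trans := fun h h' => isIsomorphic_equivalence.trans h h' }

end Matroids

/-- `T` is a tree in which every vertex has finite degree at least `2`, and which has precisely one
vertex of each finite degree `n ≥ 2`. -/
def IsOneOfEachDegreeTree {V : Type u} (T : SimpleGraph V) : Prop :=
  T.IsTree ∧ (∀ v, (T.neighborSet v).Finite ∧ 2 ≤ (T.neighborSet v).ncard) ∧
    ∀ n : ℕ, 2 ≤ n → ∃! v, (T.neighborSet v).ncard = n

/-- The graph `T × K₂`: two disjoint copies of `T` and an edge between each vertex and its clone. -/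
abbrev timesK2 {V : Type u} (T : SimpleGraph V) : SimpleGraph (V × Fin 2) :=
  T.boxProd (⊤ : SimpleGraph (Fin 2))

end PsiMatroid

namespace PsiMatroid

/-! ### Matroids from orthogonal set systems -/

section Orthogonal

variable {α : Type u} {β : Type v}

/-! The graph is locally finite, so distinct vertices and ends are separated by finite cuts and the
graph-like quotient identifies nothing (`pointEquiv_iff_eq`). Everything else is read off the tree.
Call the vertices of `T` and the ends in `Ψ` terminals. For distinct terminals `p` and `q`, take
both copies of every edge on the way from `p` to `q` in `T`, and the rungs at those of `p`, `q` that
are vertices. This ladder closes up to a circle (`isPsiCircuit_ladder`).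

Given an edge `e` and a set `P` avoiding it, grow in `T` along the edges that have both copies in
`P`. Either terminals are reached, and there is a ladder through `e` inside `insert e P`; or there
is a `Ψ`-bounded cut through `e` that misses `P` (`exists_ladder_or_cut`). The cut is a star, made
of the rungs at a convex vertex set `S` and one copy of each edge leaving `S`, or it is the pair of
copies of one edge. A circle cannot meet a bounded cut in a single edge, and a circle inside a
circle is all of it. Hence the ladders are all the circuits (`isPsiCircuit_iff_ladder`), and every
bond is a star or a pair.

Orthogonality and this painting property give a matroid as soon as circuit-free sets extend to
maximal ones (`exists_matroid_of_orthogonal`). That is the delicate point: a union of a chain of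
circuit-free sets may contain a new ray to an end in `Ψ`. Zorn's lemma is therefore used twice. The
first time it is applied to an order that freezes whatever is already connected to a terminal, which
makes every relevant ray meet such a place (`exists_terminating_extension`). After that, plain
inclusion works (`exists_maximal_noCirc`).

A path in `T` enters a convex set at most once from either end, so circuits and cocircuits meet in
no or two elements (`Induces.meetsInPairs`). This property implies tameness, passes to minors, and
fails for `U_{2,4}` and `M(K₄)`, which have a circuit and a cocircuit meeting in three and four
elements respectively.

For rigidity, the two copies of an edge of `T` lie in the same circuits, while a rung shares its
circuits with no other element. So an isomorphism permutes the rungs; four-element circuits show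
that it preserves adjacency in `T`, and the distinct degrees make the induced automorphism the
identity. Ladders to ends are then fixed as sets, so `Ψ = Ψ'` (`eq_of_isIsomorphic`). The tree is
countable and branches at all vertices but one, so there are continuum many ends. The upper bound
counts families of subsets of `ℕ`. -/

theorem exists_matroid_of_orthogonal (E : Set α) (𝒞 𝒟 : Set α → Prop)
    (hCE : ∀ C, 𝒞 C → C ⊆ E) (hDE : ∀ D, 𝒟 D → D ⊆ E)
    (hC0 : ¬ 𝒞 ∅) (hD0 : ¬ 𝒟 ∅)
    (orth : ∀ C D, 𝒞 C → 𝒟 D → ∀ e, C ∩ D ≠ {e})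
    (paint : ∀ e ∈ E, ∀ P ⊆ E, e ∉ P →
      (∃ C, 𝒞 C ∧ e ∈ C ∧ C ⊆ insert e P) ∨ ∃ D, 𝒟 D ∧ e ∈ D ∧ Disjoint D P)
    (maxi : ∀ I X, I ⊆ X → X ⊆ E → (∀ C ⊆ I, ¬ 𝒞 C) →
      ∃ J, I ⊆ J ∧ J ⊆ X ∧ (∀ C ⊆ J, ¬ 𝒞 C) ∧ ∀ x ∈ X \ J, ∃ C, 𝒞 C ∧ C ⊆ insert x J) :
    ∃ M : Matroid α, M.E = E ∧ (∀ C, M.IsCircuit C ↔ Minimal 𝒞 C) ∧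
      ∀ D, M.IsCocircuit D ↔ Minimal 𝒟 D := by
  classical
  -- an element of a circuit in `insert x J` that is not in `J`
  have hmem : ∀ {J : Set α} {x : α} {C : Set α}, (∀ C ⊆ J, ¬ 𝒞 C) → 𝒞 C → C ⊆ insert x J →
      x ∈ C := by
    intro J x C hJ hC hCJ
    by_contra hx
    exact hJ C (fun y hy => (hCJ hy).resolve_left (by rintro rfl; exact hx hy)) hC
  have hsing : ∀ {C D : Set α} {x : α}, x ∈ C → x ∈ D → (∀ y ∈ C, y ∈ D → y = x) →
      C ∩ D = {x} := by
    intro C D x h1 h2 h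
    ext y
    exact ⟨fun hy => h y hy.1 hy.2, by rintro rfl; exact ⟨h1, h2⟩⟩
  let N : IndepMatroid α :=
    { E := E
      Indep := fun I => I ⊆ E ∧ ∀ C ⊆ I, ¬ 𝒞 C
      indep_empty := ⟨empty_subset _, fun C hC h => hC0 (by rwa [subset_empty_iff.1 hC] at h)⟩
      indep_subset := fun I J hJ hIJ => ⟨hIJ.trans hJ.1, fun C hC => hJ.2 C (hC.trans hIJ)⟩
      indep_aug := by
        intro I B hI hImax hB
        by_contra hcon
        have hcon : ∀ x ∈ B \ I, ¬ (insert x I ⊆ E ∧ ∀ C ⊆ insert x I, ¬ 𝒞 C) :=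
          fun x hx h => hcon ⟨x, hx, h⟩
        obtain ⟨y, hyI, hy⟩ : ∃ y, y ∉ I ∧ (insert y I ⊆ E ∧ ∀ C ⊆ insert y I, ¬ 𝒞 C) := by
          by_contra hno
          refine hImax ⟨hI, fun K hK hIK y hyK => ?_⟩
          by_contra hyI
          exact hno ⟨y, hyI, (insert_subset hyK hIK).trans hK.1,
            fun C hC => hK.2 C (hC.trans (insert_subset hyK hIK))⟩
        have hyE : y ∈ E := hy.1 (mem_insert _ _)
        have hyB : y ∉ B := fun hyB => hcon y ⟨hyB, hyI⟩ hy
        obtain ⟨C, hCB, hC⟩ : ∃ C ⊆ insert y B, 𝒞 C := by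
          by_contra! hno
          exact hyB (hB.2 ⟨insert_subset hyE hB.1.1, hno⟩ (subset_insert _ _) (mem_insert _ _))
        have hyC := hmem hB.1.2 hC hCB
        -- A set `D` through `y` that misses `I` must meet the fundamental circuit of `y` over `B` a
        -- second time, at some `x ∈ B \ I`. The circuit that `x` closes with `I` then meets `D`
        -- only in `x`.
        rcases paint y hyE I hI.1 hyI with ⟨C', hC', -, hC'I⟩ | ⟨D, hD, hyD, hDI⟩
        · exact hy.2 C' hC'I hC'
        · refine orth C D hC hD y (hsing hyC hyD fun x hxC hxD => ?_)
          by_contra hxy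
          have hxB : x ∈ B := (hCB hxC).resolve_left hxy
          have hxI : x ∉ I := fun h => hDI.le_bot ⟨hxD, h⟩
          have := hcon x ⟨hxB, hxI⟩
          rw [not_and] at this
          have := this (insert_subset (hB.1.1 hxB) hI.1)
          push Not at this
          obtain ⟨C', hC'I, hC'⟩ := this
          refine orth C' D hC' hD x (hsing (hmem hI.2 hC' hC'I) hxD fun z hz hzD => ?_)
          exact (hC'I hz).resolve_right fun h => hDI.le_bot ⟨hzD, h⟩
      indep_maximal := by
        intro X hX I hI hIX
        obtain ⟨J, hIJ, hJX, hJ, hJmax⟩ := maxi I X hIX hX hI.2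
        refine ⟨J, hIJ, ⟨⟨hJX.trans hX, hJ⟩, hJX⟩, fun K hK hJK x hxK => ?_⟩
        by_contra hxJ
        obtain ⟨C, hC, hCJ⟩ := hJmax x ⟨hK.2 hxK, hxJ⟩
        exact hK.1.2 C (hCJ.trans (insert_subset hxK hJK)) hC
      subset_ground := fun I hI => hI.1 }
  have hind : ∀ I, N.matroid.Indep I ↔ I ⊆ E ∧ ∀ C ⊆ I, ¬ 𝒞 C := fun I => Iff.rfl
  have hE : N.matroid.E = E := rfl
  generalize N.matroid = M at hind hE
  have hdep : ∀ X, M.Dep X ↔ (∃ C ⊆ X, 𝒞 C) ∧ X ⊆ E := by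
    intro X
    rw [Matroid.Dep, hind, hE, not_and]
    push Not
    tauto
  have hminC : ∀ (P Q : Set α → Prop), (∀ X, Q X → X ⊆ E) → (∀ X, P X ↔ (∃ C ⊆ X, Q C) ∧ X ⊆ E) →
      ∀ X, Minimal P X ↔ Minimal Q X := by
    intro P Q hQE hPQ X
    constructor
    · intro h
      obtain ⟨⟨C, hCX, hC⟩, hXE⟩ := (hPQ X).1 h.1
      have hPC : P C := (hPQ C).2 ⟨⟨C, Subset.rfl, hC⟩, hQE C hC⟩
      have : C = X := Subset.antisymm hCX (h.2 hPC hCX)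
      subst this
      exact ⟨hC, fun Y hY hYC => h.2 ((hPQ Y).2 ⟨⟨Y, Subset.rfl, hY⟩, hQE Y hY⟩) hYC⟩
    · intro h
      refine ⟨(hPQ X).2 ⟨⟨X, Subset.rfl, h.1⟩, hQE X h.1⟩, fun Y hY hYX => ?_⟩
      obtain ⟨⟨C, hCY, hC⟩, -⟩ := (hPQ Y).1 hY
      exact (h.2 hC (hCY.trans hYX)).trans hCY
  refine ⟨M, hE, fun C => hminC M.Dep 𝒞 hCE hdep C, fun D => hminC M✶.Dep 𝒟 hDE (fun D => ?_) D⟩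
  constructor
  · intro h
    have hDE' : D ⊆ E := by simpa [hE] using h.subset_ground
    refine ⟨?_, hDE'⟩
    -- If `D` is codependent, its complement does not span, so some `e` can be added to a basis `J`
    -- of the complement. Painting `e` over `J` yields the required member of `𝒟`. It lies in `D`,
    -- since any other element of it closes a circuit with `J` and would meet that circuit alone.
    obtain ⟨J, hJ⟩ := M.exists_isBasis (M.E \ D) sdiff_subset
    have hnb : ¬ M.IsBase J := fun hb => h.not_indep
      ((Matroid.coindep_iff_exists (by rwa [hE])).2 ⟨J, hb, hJ.subset⟩)
    obtain ⟨e, heJ, he⟩ : ∃ e, e ∉ J ∧ M.Indep (insert e J) := by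
      by_contra! hno
      refine hnb (Matroid.isBase_iff_maximal_indep.2 ⟨hJ.indep, fun K hK hJK y hyK => ?_⟩)
      by_contra hyJ
      exact hno y hyJ (hK.subset (insert_subset hyK hJK))
    have he' := (hind _).1 he
    have hJi := (hind _).1 hJ.indep
    rcases paint e (he'.1 (mem_insert _ _)) J hJi.1 heJ with ⟨C, hC, -, hCI⟩ | ⟨D', hD', heD, hDJ⟩
    · exact absurd hC (he'.2 C hCI)
    · refine ⟨D', fun x hx => ?_, hD'⟩
      by_contra hxD
      have hxE := hDE _ hD' hx
      have hxJ : x ∉ J := fun h => hDJ.le_bot ⟨hx, h⟩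
      have : ¬ M.Indep (insert x J) := by
        intro hi
        exact hxJ (hJ.mem_of_insert_indep ⟨by rwa [hE], hxD⟩ hi)
      rw [hind, not_and] at this
      have := this (insert_subset hxE hJi.1)
      push Not at this
      obtain ⟨C, hCJ, hC⟩ := this
      refine orth C D' hC hD' x (hsing (hmem hJi.2 hC hCJ) hx fun z hz hzD => ?_)
      exact (hCJ hz).resolve_right fun h => hDJ.le_bot ⟨hzD, h⟩
  · rintro ⟨⟨D', hD'D, hD'⟩, hDE'⟩
    refine ⟨fun hi => ?_, by simpa [hE] using hDE'⟩
    obtain ⟨B, hB, hBD⟩ := (Matroid.Coindep.exists_isBase_subset_compl hi)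
    obtain ⟨e, he⟩ : D'.Nonempty := by
      rw [nonempty_iff_ne_empty]; rintro rfl; exact hD0 hD'
    have heB : e ∉ B := fun h => (hBD h).2 (hD'D he)
    have hBi := (hind _).1 hB.indep
    have : ¬ M.Indep (insert e B) := fun hi => heB (hB.mem_of_insert_indep hi)
    rw [hind, not_and] at this
    have := this (insert_subset (hDE _ hD' he) hBi.1)
    push Not at this
    obtain ⟨C, hCJ, hC⟩ := this
    refine orth C D' hC hD' e (hsing (hmem hBi.2 hC hCJ) he fun z hz hzD => ?_)
    exact (hCJ hz).resolve_right fun h => (hBD h).2 (hD'D hzD)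

/-! ### Matroids whose circuits and cocircuits meet in no or two elements -/

/-- Every circuit and every cocircuit meet in no or in exactly two elements. -/
def MeetsInPairs (M : Matroid α) : Prop :=
  ∀ C D, M.IsCircuit C → M.IsCocircuit D → (C ∩ D).encard = 0 ∨ (C ∩ D).encard = 2

theorem MeetsInPairs.isTame {M : Matroid α} (h : MeetsInPairs M) : IsTame M := by
  intro C D hC hD
  rcases h C D hC hD with h | h
  · rw [encard_eq_zero.1 h]; exact finite_empty
  · exact finite_of_encard_eq_coe (k := 2) h

/-- After contracting `K` and deleting `L`, a circuit lifts to the original matroid by adding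
elements of `K` only, and a cocircuit by adding elements of `L` only. The lifted cocircuit avoids
`K` and the original circuit avoids `L`, so the intersection is unchanged. -/
theorem MeetsInPairs.of_isMinor {M N : Matroid α} (h : MeetsInPairs M) (hN : N.IsMinor M) :
    MeetsInPairs N := by
  obtain ⟨K, L, rfl⟩ := hN
  intro C D hC hD
  rw [Matroid.delete_isCircuit_iff] at hC
  obtain ⟨C', hC', hCC', hC'K⟩ := hC.1.exists_subset_isCircuit_of_contract
  rw [Matroid.isCocircuit_def, Matroid.dual_contract_delete] at hD
  obtain ⟨D', hD', hDD', hD'L⟩ := hD.exists_subset_isCircuit_of_contract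
  rw [Matroid.delete_isCircuit_iff] at hD'
  have : C ∩ D = C' ∩ D' := by
    refine Subset.antisymm (inter_subset_inter hCC' hDD') fun x hx => ?_
    have hxC : x ∈ C := (hC'K hx.1).resolve_right fun hk => hD'.2.le_bot ⟨hx.2, hk⟩
    exact ⟨hxC, (hD'L hx.2).resolve_right fun hl => hC.2.le_bot ⟨hxC, hl⟩⟩
  rw [this]
  exact h C' D' hC' hD'.1

theorem MeetsInPairs.not_hasU24Minor {M : Matroid α} (h : MeetsInPairs M) : ¬ HasU24Minor M := by
  rintro ⟨N, hN, hE, hI⟩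
  have h := h.of_isMinor hN
  obtain ⟨a, b, c, d, hab, hac, had, hbc, hbd, hcd, hEq⟩ := encard_eq_four.1 hE
  have hcirc : ∀ x y z, x ≠ y → x ≠ z → y ≠ z → x ∈ N.E → y ∈ N.E → z ∈ N.E →
      N.IsCircuit {x, y, z} := by
    intro x y z hxy hxz hyz hx hy hz
    have hcard : ({x, y, z} : Set α).encard = 3 := by
      rw [encard_eq_three]; exact ⟨x, y, z, hxy, hxz, hyz, rfl⟩
    have hsub : ({x, y, z} : Set α) ⊆ N.E := by
      rintro w (rfl | rfl | rfl) <;> assumption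
    rw [Matroid.isCircuit_iff_forall_ssubset]
    refine ⟨⟨fun hi => ?_, hsub⟩, fun I hI' => ?_⟩
    · have := (hI _ hsub).1 hi
      rw [hcard] at this
      exact absurd this (by decide)
    · refine (hI _ (hI'.subset.trans hsub)).2 ?_
      have hfin : ({x, y, z} : Set α).Finite := by simp
      have := (hfin.subset hI'.subset).encard_lt_encard hI'
      rw [hcard] at this
      exact Order.le_of_lt_add_one this
  have ha : a ∈ N.E := by simp [hEq]
  have hb : b ∈ N.E := by simp [hEq]
  have hc : c ∈ N.E := by simp [hEq]
  have hd : d ∈ N.E := by simp [hEq]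
  have hi : N.Indep {a, b} := by
    refine (hI _ (by rintro w (rfl | rfl) <;> assumption)).2 ?_
    exact (encard_pair hab).le
  -- A cocircuit that contains `a` but not `b` must contain the other two elements, by orthogonality
  -- with the triples through `a` and `b`. It then contains the whole circuit `{a, c, d}`.
  obtain ⟨K, hK, hKi⟩ := hi.exists_isCocircuit_inter_eq_mem (mem_insert a {b})
  have haK : a ∈ K := by
    have : a ∈ K ∩ {a, b} := by rw [hKi]; rfl
    exact this.1
  have hbK : b ∉ K := by
    intro hbK
    have : b ∈ K ∩ {a, b} := ⟨hbK, by simp⟩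
    rw [hKi] at this
    exact hab this.symm
  have key : ∀ z, z ≠ a → z ≠ b → z ∈ N.E → z ∈ K := by
    intro z hza hzb hz
    by_contra hzK
    refine (hcirc a b z hab hza.symm hzb.symm ha hb hz).inter_isCocircuit_ne_singleton hK
      (e := a) ?_
    ext w
    simp only [mem_inter_iff, mem_insert_iff, mem_singleton_iff]
    constructor
    · rintro ⟨rfl | rfl | rfl, hw⟩
      · rfl
      · exact absurd hw hbK
      · exact absurd hw hzK
    · rintro rfl; exact ⟨Or.inl rfl, haK⟩
  have h3 : ({a, c, d} : Set α) ∩ K = {a, c, d} := by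
    refine inter_eq_left.2 ?_
    rintro w (rfl | rfl | rfl)
    · exact haK
    · exact key _ hac.symm hbc.symm hc
    · exact key _ had.symm hbd.symm hd
  have hcard : ({a, c, d} : Set α).encard = 3 := by
    rw [encard_eq_three]; exact ⟨a, c, d, hac, had, hcd, rfl⟩
  have := h _ K (hcirc a c d hac had hcd ha hc hd) hK
  rw [h3, hcard] at this
  exact absurd this (by decide)

theorem exists_ne_mem_edges_of_isCycle {W : Type v} {H : SimpleGraph W} {w : W} {p : H.Walk w w}
    (hp : p.IsCycle) {x y : W} (hxy : s(x, y) ∈ p.edges) : ∃ z, z ≠ x ∧ s(y, z) ∈ p.edges := by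
  have hy : y ∈ p.support := p.snd_mem_support_of_mem_edges hxy
  have h2 := hp.ncard_neighborSet_toSubgraph_eq_two hy
  obtain ⟨a, b, hab, hn⟩ := ncard_eq_two.1 h2
  have hadj : ∀ z, z ∈ p.toSubgraph.neighborSet y ↔ s(y, z) ∈ p.edges := by
    intro z
    rw [SimpleGraph.Subgraph.mem_neighborSet, ← SimpleGraph.Subgraph.mem_edgeSet,
      SimpleGraph.Walk.mem_edges_toSubgraph]
  by_cases hax : a = x
  · exact ⟨b, fun h => hab (hax.trans h.symm), (hadj b).1 (by simp [hn])⟩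
  · exact ⟨a, hax, (hadj a).1 (by simp [hn])⟩

theorem isCycleEdgeSet_triangle {W : Type v} {x y z : W} (hxy : x ≠ y) (hxz : x ≠ z)
    (hyz : y ≠ z) : IsCycleEdgeSet (⊤ : SimpleGraph W) {s(x, y), s(y, z), s(z, x)} := by
  refine ⟨x, .cons (v := y) (by simpa) (.cons (v := z) (by simpa) (.cons (v := x)
    (by simpa using hxz.symm) .nil)), ?_, ?_⟩
  · simp [SimpleGraph.Walk.isCycle_def, SimpleGraph.Walk.isTrail_def, *, hxy.symm, hxz.symm]
  · ext; simp

theorem isCycleEdgeSet_square {W : Type v} {x y z w : W} (hxy : x ≠ y) (hxz : x ≠ z)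
    (hyz : y ≠ z) (hwx : w ≠ x) (hwy : w ≠ y) (hwz : w ≠ z) :
    IsCycleEdgeSet (⊤ : SimpleGraph W) {s(x, y), s(y, z), s(z, w), s(w, x)} := by
  refine ⟨x, .cons (v := y) (by simpa) (.cons (v := z) (by simpa) (.cons (v := w)
    (by simpa using hwz.symm) (.cons (v := x) (by simpa) .nil))), ?_, ?_⟩
  · simp [SimpleGraph.Walk.isCycle_def, SimpleGraph.Walk.isTrail_def, *, hxy.symm, hxz.symm,
      hwx.symm, hwy.symm, hwz.symm]
  · ext; simp

theorem MeetsInPairs.not_hasMK4Minor {M : Matroid α} (h : MeetsInPairs M) : ¬ HasMK4Minor M := by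
  rintro ⟨N, hN, φ, hφ⟩
  have h := h.of_isMinor hN
  have hed : ∀ x y : Fin 4, x ≠ y → s(x, y) ∈ (⊤ : SimpleGraph (Fin 4)).edgeSet := by
    intro x y hxy; simpa using hxy
  let S : Set (Sym2 (Fin 4)) → Set N.E := fun A => {e | (φ e).1 ∈ A}
  have hS : ∀ A ⊆ (⊤ : SimpleGraph (Fin 4)).edgeSet, Subtype.val '' (φ '' S A) = A := by
    intro A hA
    ext e
    constructor
    · rintro ⟨_, ⟨f, hf, rfl⟩, rfl⟩; exact hf
    · intro he
      exact ⟨⟨e, hA he⟩, ⟨φ.symm ⟨e, hA he⟩, by simpa [S] using he, by simp⟩, rfl⟩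
  have hcirc : ∀ A, IsCycleEdgeSet (⊤ : SimpleGraph (Fin 4)) A →
      N.IsCircuit (Subtype.val '' S A) := by
    intro A hA
    rw [hφ, hS A]
    · exact hA
    · obtain ⟨w, p, -, rfl⟩ := hA
      exact fun e he => p.edges_subset_edgeSet he
  have hval : ∀ {A : Set (Sym2 (Fin 4))} {e : N.E}, e.1 ∈ Subtype.val '' S A ↔ (φ e).1 ∈ A := by
    intro A e
    constructor
    · rintro ⟨f, hf, hfe⟩
      rw [← Subtype.ext hfe]; exact hf
    · intro he; exact ⟨e, he, rfl⟩
  -- These edges form the spanning path 1–0–2–3. A cycle inside it is excluded by peeling off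
  -- leaves: vertex 1 has only the edge 01 and vertex 3 only the edge 23, after which 2 has only 02.
  have hindep : N.Indep (Subtype.val '' S {s(0, 1), s(2, 3), s(0, 2)}) := by
    rw [Matroid.indep_iff_forall_subset_not_isCircuit (by rintro _ ⟨e, -, rfl⟩; exact e.2)]
    intro C hCS hC
    obtain ⟨C', rfl⟩ : ∃ C' : Set N.E, C = Subtype.val '' C' :=
      ⟨Subtype.val ⁻¹' C, by
        rw [Subtype.image_preimage_coe, inter_eq_right.2 hC.subset_ground]⟩
    obtain ⟨w, p, hp, hpC⟩ := (hφ C').1 hC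
    have hsub : ∀ e ∈ p.edges, e = s(0, 1) ∨ e = s(2, 3) ∨ e = s(0, 2) := by
      intro e he
      have he' : e ∈ Subtype.val '' (φ '' C') := by rw [hpC]; exact he
      obtain ⟨_, ⟨f, hf, rfl⟩, rfl⟩ := he'
      exact hval.1 (hCS ⟨f, hf, rfl⟩)
    have h01 : s(0, 1) ∉ p.edges := by
      intro he
      obtain ⟨z, hz, hz'⟩ := exists_ne_mem_edges_of_isCycle hp he
      have := hsub _ hz'
      revert hz this; clear hz'; revert z; decide
    have h23 : s(2, 3) ∉ p.edges := by
      intro he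
      obtain ⟨z, hz, hz'⟩ := exists_ne_mem_edges_of_isCycle hp he
      have := hsub _ hz'
      revert hz this; clear hz'; revert z; decide
    have h02 : s(0, 2) ∉ p.edges := by
      intro he
      obtain ⟨z, hz, hz'⟩ := exists_ne_mem_edges_of_isCycle hp he
      have h3 : s(2, z) = s(2, 3) := by
        have := hsub _ hz'
        revert hz this; clear hz'; revert z; decide
      exact h23 (h3 ▸ hz')
    have hne : p.edges ≠ [] := by
      intro hnil
      have := hp.three_le_length
      rw [← SimpleGraph.Walk.length_edges, hnil] at this
      simp at this
    obtain ⟨e, he⟩ := List.exists_mem_of_ne_nil _ hne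
    rcases hsub e he with rfl | rfl | rfl
    · exact h01 he
    · exact h23 he
    · exact h02 he
  let el : ∀ e ∈ (⊤ : SimpleGraph (Fin 4)).edgeSet, N.E := fun e he => φ.symm ⟨e, he⟩
  have hel : ∀ e he, (φ (el e he)).1 = e := by intro e he; simp [el]
  have h02e : s((0 : Fin 4), 2) ∈ (⊤ : SimpleGraph (Fin 4)).edgeSet := hed _ _ (by decide)
  -- The fundamental cocircuit of the middle edge 02 corresponds to the bond between `{0, 1}` and
  -- `{2, 3}`. The triangles force its remaining edges, and it then contains the square 0–2–1–3.
  obtain ⟨K, hK, hKi⟩ := hindep.exists_isCocircuit_inter_eq_mem (e := (el _ h02e).1)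
    (hval.2 (by rw [hel]; simp))
  let Q : Set (Sym2 (Fin 4)) := {e | ∃ he, (el e he).1 ∈ K}
  have hQ : ∀ f : N.E, f.1 ∈ K ↔ (φ f).1 ∈ Q := by
    intro f
    have : el (φ f).1 (φ f).2 = f := by simp [el]
    constructor
    · intro hf; exact ⟨(φ f).2, by rwa [this]⟩
    · rintro ⟨he, hf⟩; rwa [this] at hf
  have hQ02 : s((0 : Fin 4), 2) ∈ Q := by
    refine ⟨h02e, ?_⟩
    have : (el _ h02e).1 ∈ K ∩ Subtype.val '' S {s(0, 1), s(2, 3), s(0, 2)} := by rw [hKi]; rfl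
    exact this.1
  have hQno : ∀ e, e = s((0 : Fin 4), 1) ∨ e = s((2 : Fin 4), 3) → e ∉ Q := by
    rintro e he ⟨he1, he2⟩
    have : (el e he1).1 ∈ K ∩ Subtype.val '' S {s(0, 1), s(2, 3), s(0, 2)} := by
      refine ⟨he2, hval.2 ?_⟩
      rw [hel]; rcases he with rfl | rfl <;> simp
    rw [hKi] at this
    have h' : el e he1 = el _ h02e := Subtype.ext this
    have h'' : e = s((0 : Fin 4), 2) := by rw [← hel e he1, h', hel]
    subst h''
    revert he; decide
  have hQ01 := hQno _ (Or.inl rfl)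
  have hQ23 := hQno _ (Or.inr rfl)
  have horth : ∀ A, IsCycleEdgeSet (⊤ : SimpleGraph (Fin 4)) A → ∀ e, A ∩ Q ≠ {e} := by
    intro A hA e hAe
    have heA : e ∈ A ∩ Q := by rw [hAe]; rfl
    obtain ⟨he, hek⟩ := heA.2
    refine (hcirc A hA).inter_isCocircuit_ne_singleton hK (e := (el e he).1) ?_
    ext x
    constructor
    · rintro ⟨⟨f, hf, rfl⟩, hfK⟩
      have : (φ f).1 ∈ A ∩ Q := ⟨hf, (hQ f).1 hfK⟩
      rw [hAe] at this
      have h1 : f = el e he := by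
        apply φ.injective; apply Subtype.ext; rw [hel]; exact this
      rw [h1]; rfl
    · rintro rfl
      exact ⟨hval.2 (by rw [hel]; exact heA.1), hek⟩
  have htri : ∀ x y z : Fin 4, x ≠ y → x ≠ z → y ≠ z → s(x, y) ∈ Q → s(y, z) ∉ Q →
      s(z, x) ∈ Q := by
    intro x y z hxy hxz hyz h1 h2
    by_contra h3
    refine horth _ (isCycleEdgeSet_triangle hxy hxz hyz) s(x, y) ?_
    ext e
    simp only [mem_inter_iff, mem_insert_iff, mem_singleton_iff]
    constructor
    · rintro ⟨rfl | rfl | rfl, he⟩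
      · rfl
      · exact absurd he h2
      · exact absurd he h3
    · rintro rfl; exact ⟨Or.inl rfl, h1⟩
  have hQ12 : s((1 : Fin 4), 2) ∈ Q :=
    htri 2 0 1 (by decide) (by decide) (by decide) (by rwa [Sym2.eq_swap]) hQ01
  have hQ30 : s((3 : Fin 4), 0) ∈ Q := htri 0 2 3 (by decide) (by decide) (by decide) hQ02 hQ23
  have hQ31 : s((3 : Fin 4), 1) ∈ Q := htri 1 2 3 (by decide) (by decide) (by decide) hQ12 hQ23
  have hsq : IsCycleEdgeSet (⊤ : SimpleGraph (Fin 4))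
      {s(0, 2), s(2, 1), s(1, 3), s(3, 0)} :=
    isCycleEdgeSet_square (by decide) (by decide) (by decide) (by decide) (by decide) (by decide)
  have hsub : ({s(0, 2), s(2, 1), s(1, 3), s(3, 0)} : Set (Sym2 (Fin 4))) ⊆ Q := by
    rintro e (rfl | rfl | rfl | rfl)
    · exact hQ02
    · rwa [Sym2.eq_swap]
    · rwa [Sym2.eq_swap]
    · exact hQ30
  have hcard : ((Subtype.val '' S {s(0, 2), s(2, 1), s(1, 3), s(3, 0)} : Set α) ∩ K).encard
      = 4 := by
    rw [inter_eq_left.2, Subtype.val_injective.encard_image,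
      ← φ.injective.encard_image, ← Subtype.val_injective.encard_image, hS]
    · rw [encard_eq_four]
      exact ⟨_, _, _, _, by decide, by decide, by decide, by decide, by decide, by decide, rfl⟩
    · rintro e (rfl | rfl | rfl | rfl) <;> exact hed _ _ (by decide)
    · rintro _ ⟨f, hf, rfl⟩
      exact (hQ f).2 (hsub hf)
  have := h _ K (hcirc _ hsq) hK
  rw [hcard] at this
  exact absurd this (by decide)

/-! ### Transport along injections and isomorphisms -/

theorem map_image_dep_iff {M : Matroid α} {f : α → β} {hf : InjOn f M.E} {D : Set α}
    (hD : D ⊆ M.E) : (M.map f hf).Dep (f '' D) ↔ M.Dep D := by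
  rw [Matroid.Dep, Matroid.Dep, Matroid.map_image_indep_iff hD, and_iff_left hD,
    and_iff_left (by simpa using image_mono hD)]

theorem map_isCircuit_iff {M : Matroid α} {f : α → β} (hf : InjOn f M.E) {C : Set β} :
    (M.map f hf).IsCircuit C ↔ ∃ C₀, M.IsCircuit C₀ ∧ C = f '' C₀ := by
  constructor
  · intro hC
    obtain ⟨C₀, hC₀E, rfl⟩ : ∃ C₀ ⊆ M.E, C = f '' C₀ := by
      have := hC.subset_ground
      rw [Matroid.map_ground] at this
      obtain ⟨C₀, h, rfl⟩ := subset_image_iff.1 this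
      exact ⟨C₀, h, rfl⟩
    refine ⟨C₀, ?_, rfl⟩
    rw [Matroid.isCircuit_iff] at hC ⊢
    refine ⟨(map_image_dep_iff hC₀E).1 hC.1, fun D hD hDC => ?_⟩
    have := hC.2 ((map_image_dep_iff (hf := hf) (hDC.trans hC₀E)).2 hD)
      (image_mono hDC)
    exact (hf.image_eq_image_iff (hDC.trans hC₀E) hC₀E).1 this
  · rintro ⟨C₀, hC, rfl⟩
    rw [Matroid.isCircuit_iff] at hC ⊢
    have hC₀E := hC.1.subset_ground
    refine ⟨(map_image_dep_iff hC₀E).2 hC.1, fun D hD hDC => ?_⟩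
    obtain ⟨D₀, hDC₀, rfl⟩ := subset_image_iff.1 hDC
    rw [hC.2 ((map_image_dep_iff (hDC₀.trans hC₀E)).1 hD) hDC₀]

theorem MeetsInPairs.map {M : Matroid α} (h : MeetsInPairs M) {f : α → β} (hf : InjOn f M.E) :
    MeetsInPairs (M.map f hf) := by
  intro C D hC hD
  rw [Matroid.isCocircuit_def, Matroid.map_dual] at hD
  obtain ⟨C₀, hC₀, rfl⟩ := (map_isCircuit_iff hf).1 hC
  obtain ⟨D₀, hD₀, rfl⟩ := (map_isCircuit_iff (M := M✶) hf).1 hD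
  rw [← hf.image_inter hC₀.subset_ground hD₀.subset_ground,
    (hf.mono (inter_subset_left.trans hC₀.subset_ground)).encard_image]
  exact h C₀ D₀ hC₀ hD₀

theorem isIsomorphic_map (M : Matroid α) {f : α → β} (hf : InjOn f M.E) :
    IsIsomorphic M (M.map f hf) := by
  refine ⟨(Equiv.Set.imageOfInjOn f M.E hf), fun I => ?_⟩
  have hIE : (Subtype.val '' I : Set α) ⊆ M.E := by rintro _ ⟨e, -, rfl⟩; exact e.2
  have : (Subtype.val '' ((Equiv.Set.imageOfInjOn f M.E hf) '' I) : Set β)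
      = f '' (Subtype.val '' I) := by
    rw [image_image, image_image]; rfl
  rw [← Matroid.map_image_indep_iff (hf := hf) hIE]
  exact Iff.of_eq (congrArg _ this.symm)

theorem IsIsomorphic.symm {M : Matroid α} {N : Matroid β} (h : IsIsomorphic M N) :
    IsIsomorphic N M := by
  obtain ⟨φ, h⟩ := h
  refine ⟨φ.symm, fun I => ?_⟩
  have := h (φ.symm '' I)
  rw [Equiv.image_symm_image] at this
  exact this.symm

theorem IsIsomorphic.trans {γ : Type*} {M : Matroid α} {N : Matroid β} {P : Matroid γ}
    (h : IsIsomorphic M N) (h' : IsIsomorphic N P) : IsIsomorphic M P := by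
  obtain ⟨φ, h⟩ := h
  obtain ⟨ψ, h'⟩ := h'
  refine ⟨φ.trans ψ, fun I => ?_⟩
  have hc : (φ.trans ψ) '' I = ψ '' (φ '' I) := by
    rw [Set.image_image]
    rfl
  rw [h I, h' (φ '' I), hc]

theorem isCircuit_coe_iff (L : Matroid α) (C : Set L.E) : L.IsCircuit (Subtype.val '' C) ↔
    ¬ L.Indep (Subtype.val '' C) ∧ ∀ D ⊂ C, L.Indep (Subtype.val '' D) := by
  rw [Matroid.isCircuit_iff_forall_ssubset, Matroid.Dep,
    and_iff_left (a := ¬ L.Indep _) (by rintro _ ⟨e, -, rfl⟩; exact e.2)]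
  refine and_congr_right fun _ => ⟨fun h D hD => h ?_, fun h I hI => ?_⟩
  · exact Subtype.val_injective.image_strictMono hD
  · obtain ⟨D, hD, rfl⟩ := subset_image_iff.1 hI.subset
    exact h D ⟨hD, fun hCD => hI.2 (image_mono hCD)⟩

/-- An isomorphism of matroids preserves circuits. -/
theorem isCircuit_image_iff {M : Matroid α} {N : Matroid β} (φ : M.E ≃ N.E)
    (h : ∀ I : Set M.E, M.Indep (Subtype.val '' I) ↔ N.Indep (Subtype.val '' (φ '' I)))
    (C : Set M.E) :
    M.IsCircuit (Subtype.val '' C) ↔ N.IsCircuit (Subtype.val '' (φ '' C)) := by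
  rw [isCircuit_coe_iff, isCircuit_coe_iff, h]
  refine and_congr_right fun _ => ⟨fun h' D hD => ?_, fun h' D hD => ?_⟩
  · obtain ⟨D₀, hD₀, rfl⟩ := subset_image_iff.1 hD.subset
    exact (h _).1 (h' D₀ ⟨hD₀, fun hc => hD.2 (image_mono hc)⟩)
  · exact (h _).2 (h' _ (φ.injective.image_strictMono hD))

end Orthogonal


/-! ### The unit circle -/

section CircleLemmas

open Topology unitInterval

/-- Rotating to `p`, the punctured circle is the image of the open interval from 0 to 2π under the
exponential. -/
theorem isPreconnected_compl_singleton_circle (p : Circle) : IsPreconnected ({p}ᶜ : Set Circle) := by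
  have h : ({p}ᶜ : Set Circle) = (fun t : ℝ => p * Circle.exp t) '' Ioo 0 (2 * Real.pi) := by
    ext z
    simp only [mem_compl_iff, mem_singleton_iff, mem_image, mem_Ioo]
    constructor
    · intro hz
      set w := p⁻¹ * z with hw
      have hw1 : w ≠ 1 := by
        rw [hw, Ne, inv_mul_eq_one]; exact fun h => hz h.symm
      have hexp : Circle.exp (Complex.arg w) = w := Circle.exp_arg w
      have hpz : p * w = z := by rw [hw, mul_inv_cancel_left]
      have harg0 : Complex.arg w ≠ 0 := by
        intro h0; rw [h0, Circle.exp_zero] at hexp; exact hw1 hexp.symm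
      rcases lt_or_gt_of_ne harg0 with hlt | hgt
      · refine ⟨Complex.arg w + 2 * Real.pi, ⟨?_, ?_⟩, ?_⟩
        · linarith [Complex.neg_pi_lt_arg (w : ℂ), Real.pi_pos]
        · linarith
        · rw [Circle.periodic_exp, hexp, hpz]
      · exact ⟨Complex.arg w, ⟨hgt, by linarith [Complex.arg_le_pi (w : ℂ), Real.pi_pos]⟩,
          by rw [hexp, hpz]⟩
    · rintro ⟨t, ⟨h0, h1⟩, rfl⟩ h
      replace h := mul_eq_left.1 h
      rw [Circle.exp_eq_one] at h
      obtain ⟨n, hn⟩ := h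
      have hpi := Real.pi_pos
      have h2 : (0 : ℝ) < n := by
        by_contra hcon
        push Not at hcon
        nlinarith
      have h3 : (n : ℝ) < 1 := by
        by_contra hcon
        push Not at hcon
        nlinarith
      have h2' : (0 : ℤ) < n := by exact_mod_cast h2
      have h3' : n < (1 : ℤ) := by exact_mod_cast h3
      omega
  rw [h]
  refine isPreconnected_Ioo.image _ (Continuous.continuousOn ?_)
  fun_prop

/-- One-dimensional Borsuk–Ulam: the difference of the values at antipodal points changes sign
between `1` and `-1`, so it vanishes somewhere. -/
theorem not_injective_of_continuous_circle_real {f : Circle → ℝ} (hf : Continuous f) :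
    ¬ Function.Injective f := by
  intro hinj
  have hconn : IsPreconnected (univ : Set Circle) := by
    have : (univ : Set Circle) = Circle.exp '' univ := by
      rw [image_univ, eq_comm, range_eq_univ]
      exact fun z => ⟨Complex.arg z, Circle.exp_arg z⟩
    rw [this]
    exact isPreconnected_univ.image _ (by fun_prop)
  let m : Circle := Circle.exp Real.pi
  have hm : m * m = 1 := by
    rw [← Circle.exp_add, ← two_mul, Circle.exp_two_pi]
  have hm1 : m ≠ 1 := by
    intro h
    have := congrArg (fun z : Circle => (z : ℂ)) h
    simp [m, Circle.coe_exp, Complex.exp_pi_mul_I] at this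
    norm_num [Complex.ext_iff] at this
  have hg : Continuous fun z : Circle => f z - f (z * m) := by fun_prop
  obtain ⟨z, -, hz⟩ : ∃ z ∈ (univ : Set Circle), f z - f (z * m) = 0 := by
    rcases le_total (f 1 - f (1 * m)) 0 with h | h
    · refine hconn.intermediate_value₂ (a := 1) (b := m) trivial trivial hg.continuousOn
        continuousOn_const h ?_
      rw [one_mul] at h
      change 0 ≤ f m - f (m * m)
      rw [hm]; linarith
    · refine hconn.intermediate_value₂ (a := m) (b := 1) trivial trivial hg.continuousOn
        continuousOn_const ?_ h
      rw [one_mul] at h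
      change f m - f (m * m) ≤ 0
      rw [hm]; linarith
  have := hinj (sub_eq_zero.1 hz)
  exact hm1 (mul_eq_left.1 this.symm)

/-- If a point were missed, rotating it to `-1` would make the argument continuous along `f`.
Composing would then inject the circle continuously into the line. -/
theorem surjective_of_continuous_injective_circle {f : Circle → Circle} (hf : Continuous f)
    (hinj : Function.Injective f) : Function.Surjective f := by
  by_contra hsurj
  simp only [Function.Surjective, not_forall, not_exists] at hsurj
  obtain ⟨p, hp⟩ := hsurj
  let m : Circle := Circle.exp Real.pi
  have hmC : (m : ℂ) = -1 := by simp [m, Circle.coe_exp]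
  have hne : ∀ z, f z * p⁻¹ * m ≠ m := by
    intro z h
    exact hp z (mul_inv_eq_one.1 (mul_eq_right.1 h))
  refine not_injective_of_continuous_circle_real
    (f := fun z => Complex.arg ((f z * p⁻¹ * m : Circle) : ℂ)) ?_ ?_
  · rw [continuous_iff_continuousAt]
    intro z
    have hs : ((f z * p⁻¹ * m : Circle) : ℂ) ∈ Complex.slitPlane := by
      rw [Complex.mem_slitPlane_iff_arg]
      refine ⟨fun h => hne z ?_, Circle.coe_ne_zero _⟩
      rw [← Circle.exp_arg (f z * p⁻¹ * m), h]
    have h1 : ContinuousAt (fun z => ((f z * p⁻¹ * m : Circle) : ℂ)) z := by fun_prop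
    exact ContinuousAt.comp (g := Complex.arg) (Complex.continuousAt_arg hs) h1
  · intro z w h
    have h2 : f z * p⁻¹ * m = f w * p⁻¹ * m := by
      rw [← Circle.exp_arg (f z * p⁻¹ * m), ← Circle.exp_arg (f w * p⁻¹ * m)]
      exact congrArg _ h
    exact hinj (mul_right_cancel (mul_right_cancel h2))

/-- A circle contained in a circle is all of it. -/
theorem eq_of_subset_of_homeomorph_circle {Z : Type u} [TopologicalSpace Z] {A B : Set Z}
    (hAB : A ⊆ B) (hA : Nonempty (A ≃ₜ Circle)) (hB : Nonempty (B ≃ₜ Circle)) : A = B := by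
  obtain ⟨a⟩ := hA
  obtain ⟨b⟩ := hB
  refine Subset.antisymm hAB fun x hx => ?_
  have hsurj := surjective_of_continuous_injective_circle
    (f := fun z => b (inclusion hAB (a.symm z)))
    (b.continuous.comp ((continuous_inclusion hAB).comp a.symm.continuous))
    (b.injective.comp ((inclusion_injective hAB).comp a.symm.injective))
  obtain ⟨z, hz⟩ := hsurj (b ⟨x, hx⟩)
  have := b.injective hz
  have h2 : (a.symm z).1 = x := congrArg Subtype.val this
  rw [← h2]
  exact (a.symm z).2

variable {Z : Type u} [TopologicalSpace Z]

theorem Path.trans_injective {a b c : Z} {γ : Path a b} {δ : Path b c}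
    (hγ : Function.Injective γ) (hδ : Function.Injective δ)
    (h : ∀ z ∈ range γ, z ∈ range δ → z = b) : Function.Injective (γ.trans δ) := by
  have key : ∀ s t : I, (s : ℝ) ≤ 1 / 2 → ¬ (t : ℝ) ≤ 1 / 2 →
      (γ.trans δ) s ≠ (γ.trans δ) t := by
    intro s t hs ht hst
    rw [Path.trans_apply, Path.trans_apply, dif_pos hs, dif_neg ht] at hst
    have hb := h _ ⟨_, rfl⟩ ⟨_, hst.symm⟩
    rw [hst] at hb
    have h0 : (⟨2 * t - 1, _⟩ : I) = 0 := hδ (hb.trans δ.source.symm)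
    have := congrArg Subtype.val h0
    simp at this
    exact ht (by linarith)
  intro s t hst
  by_cases hs : (s : ℝ) ≤ 1 / 2 <;> by_cases ht : (t : ℝ) ≤ 1 / 2
  · rw [Path.trans_apply, Path.trans_apply, dif_pos hs, dif_pos ht] at hst
    have := congrArg Subtype.val (hγ hst)
    simp at this
    exact Subtype.ext this
  · exact absurd hst (key s t hs ht)
  · exact absurd hst.symm (key t s ht hs)
  · rw [Path.trans_apply, Path.trans_apply, dif_neg hs, dif_neg ht] at hst
    have := congrArg Subtype.val (hδ hst)
    simp at this
    exact Subtype.ext this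

/-- Two arcs that meet exactly in their endpoints form a circle. -/
theorem nonempty_homeomorph_circle_of_arcs [T2Space Z] {a b : Z} {γ : Path a b}
    {δ : Path b a} (hγ : Function.Injective γ) (hδ : Function.Injective δ)
    (h : ∀ z ∈ range γ, z ∈ range δ → z = a ∨ z = b) :
    Nonempty ((range γ ∪ range δ : Set Z) ≃ₜ Circle) := by
  have hfact : Fact ((0 : ℝ) < 1) := ⟨one_pos⟩
  let L := γ.trans δ
  have hinj : ∀ s t : I, (s : ℝ) < 1 → (t : ℝ) < 1 → L s = L t → s = t := by
    have key : ∀ s t : I, (s : ℝ) ≤ 1 / 2 → ¬ (t : ℝ) ≤ 1 / 2 → (t : ℝ) < 1 →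
        L s ≠ L t := by
      intro s t hs ht ht1 hst
      rw [Path.trans_apply, Path.trans_apply, dif_pos hs, dif_neg ht] at hst
      rcases h _ ⟨_, rfl⟩ ⟨_, hst.symm⟩ with hb | hb <;> rw [hst] at hb
      · have h0 : (⟨2 * t - 1, _⟩ : I) = 1 := hδ (hb.trans δ.target.symm)
        have := congrArg Subtype.val h0
        simp at this
        linarith
      · have h0 : (⟨2 * t - 1, _⟩ : I) = 0 := hδ (hb.trans δ.source.symm)
        have := congrArg Subtype.val h0
        simp at this
        exact ht (by linarith)
    intro s t hs1 ht1 hst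
    by_cases hs : (s : ℝ) ≤ 1 / 2 <;> by_cases ht : (t : ℝ) ≤ 1 / 2
    · simp only [L] at hst
      rw [Path.trans_apply, Path.trans_apply, dif_pos hs, dif_pos ht] at hst
      have := congrArg Subtype.val (hγ hst)
      simp at this
      exact Subtype.ext this
    · exact absurd hst (key s t hs ht ht1)
    · exact absurd hst.symm (key t s ht hs hs1)
    · simp only [L] at hst
      rw [Path.trans_apply, Path.trans_apply, dif_neg hs, dif_neg ht] at hst
      have := congrArg Subtype.val (hδ hst)
      simp at this
      exact Subtype.ext this
  -- The closed loop descends to `ℝ/ℤ`, where it becomes injective. As the source is compact and the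
  -- target Hausdorff, this is an embedding.
  let F : AddCircle (1 : ℝ) → Z := AddCircle.liftIco 1 0 L.extend
  have hFc : Continuous F := by
    refine AddCircle.liftIco_continuous ?_ L.continuous_extend.continuousOn
    simp
  have hIco : ∀ z : AddCircle (1 : ℝ), ∃ t : I, (t : ℝ) < 1 ∧ ((t : ℝ) : AddCircle (1 : ℝ)) = z ∧
      F z = L t := by
    intro z
    obtain ⟨t, ht, rfl⟩ : z ∈ ((↑) : ℝ → AddCircle (1 : ℝ)) '' Ico 0 (0 + 1) := by
      rw [AddCircle.coe_image_Ico_eq]; trivial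
    have ht' : t ∈ I := ⟨ht.1, by linarith [ht.2]⟩
    refine ⟨⟨t, ht'⟩, by simpa using ht.2, rfl, ?_⟩
    simp only [F]
    rw [AddCircle.liftIco_coe_apply ht, Path.extend_apply _ ht']
  have hFinj : Function.Injective F := by
    intro z w hzw
    obtain ⟨s, hs, rfl, hsF⟩ := hIco z
    obtain ⟨t, ht, rfl, htF⟩ := hIco w
    rw [hinj s t hs ht (by rw [← hsF, ← htF, hzw])]
  have hFrange : range F = range γ ∪ range δ := by
    rw [← Path.trans_range]
    ext x
    constructor
    · rintro ⟨z, rfl⟩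
      obtain ⟨t, -, -, h⟩ := hIco z
      exact ⟨t, h.symm⟩
    · rintro ⟨t, rfl⟩
      rcases t.2.2.lt_or_eq with ht | ht
      · refine ⟨((t : ℝ) : AddCircle (1 : ℝ)), ?_⟩
        simp only [F]
        rw [AddCircle.liftIco_coe_apply ⟨t.2.1, by simpa using ht⟩, Path.extend_apply _ t.2]
      · refine ⟨((0 : ℝ) : AddCircle (1 : ℝ)), ?_⟩
        simp only [F]
        rw [AddCircle.liftIco_coe_apply ⟨le_rfl, by simp⟩]
        have : t = 1 := Subtype.ext ht
        rw [this, Path.target]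
        simp
  have hemb : IsEmbedding F := (hFc.isClosedEmbedding hFinj).isEmbedding
  exact ⟨((Homeomorph.setCongr hFrange.symm).trans hemb.toHomeomorph.symm).trans
    (AddCircle.homeomorphCircle one_ne_zero)⟩

end CircleLemmas


section Topology

open Topology

variable {V : Type u} {G : SimpleGraph V} {Ψ : Set (Ends G)}

/-! ### Rays and the components `C(S, ω)` -/

/-- The ray obtained by deleting the first `k` vertices. -/
def Ray.drop (R : Ray G) (k : ℕ) : Ray G where
  toFun n := R.toFun (k + n)
  injective a b h := by have := R.injective h; omega
  adj n := R.adj (k + n)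

theorem Ray.toEnd_eq_iff {R R' : Ray G} : R.toEnd = R'.toEnd ↔ R.Equivalent R' :=
  Quotient.eq (r := raySetoid G)

theorem Ray.toEnd_drop (R : Ray G) (k : ℕ) : (R.drop k).toEnd = R.toEnd := by
  rw [Ray.toEnd_eq_iff]
  intro S hS
  obtain ⟨N, hN⟩ := (Ray.equivalent_equivalence G).refl R S hS
  exact ⟨N, fun m hm n hn => hN (k + m) (by omega) n hn⟩

theorem Ends.exists_ray (ω : Ends G) : ∃ R : Ray G, R.toEnd = ω := Quotient.exists_rep ω

/-- Equivalent rays have tails in the same component off a finite set, so membership can be tested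
on whichever representative ray is at hand. -/
theorem mem_endComponent_iff {S : Set V} (hS : S.Finite) {R : Ray G} {v : V} :
    v ∈ endComponent G S R.toEnd ↔ ∃ N, ∀ n ≥ N, JoinedOff G S v (R.toFun n) := by
  constructor
  · rintro ⟨R', hR', hv⟩
    obtain ⟨N, hN⟩ := Ray.toEnd_eq_iff.1 hR' S hS
    exact ⟨N, fun n hn => (hv N).trans (hN N le_rfl n hn)⟩
  · rintro ⟨N, hN⟩
    exact ⟨R.drop N, R.toEnd_drop N, fun n => hN (N + n) (by omega)⟩

theorem endComponent_nonempty {S : Set V} (hS : S.Finite) (ω : Ends G) :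
    (endComponent G S ω).Nonempty := by
  obtain ⟨R, rfl⟩ := ω.exists_ray
  obtain ⟨N, hN⟩ := (Ray.equivalent_equivalence G).refl R S hS
  exact ⟨R.toFun N, (mem_endComponent_iff hS).2 ⟨N, fun n hn => hN N le_rfl n hn⟩⟩

theorem JoinedOff.left_notMem {S : Set V} {u v : V} (h : JoinedOff G S u v) : u ∉ S := by
  obtain ⟨p, hp⟩ := h
  exact hp u p.start_mem_support

theorem JoinedOff.of_adj {S : Set V} {u v : V} (h : G.Adj u v) (hu : u ∉ S) (hv : v ∉ S) :
    JoinedOff G S u v :=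
  ⟨.cons h .nil, by simp [hu, hv]⟩

theorem notMem_of_mem_endComponent {S : Set V} {ω : Ends G} {v : V}
    (hv : v ∈ endComponent G S ω) : v ∉ S := by
  obtain ⟨R, -, h⟩ := hv
  exact (h 0).left_notMem

theorem mem_endComponent_of_joinedOff {S : Set V} {ω : Ends G} {v w : V}
    (hv : v ∈ endComponent G S ω) (h : JoinedOff G S w v) : w ∈ endComponent G S ω := by
  obtain ⟨R, hR, hn⟩ := hv
  exact ⟨R, hR, fun n => h.trans (hn n)⟩

theorem joinedOff_of_mem_endComponent {S : Set V} (hS : S.Finite) {ω : Ends G} {v w : V}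
    (hv : v ∈ endComponent G S ω) (hw : w ∈ endComponent G S ω) : JoinedOff G S v w := by
  obtain ⟨R, rfl⟩ := ω.exists_ray
  obtain ⟨N, hN⟩ := (mem_endComponent_iff hS).1 hv
  obtain ⟨N', hN'⟩ := (mem_endComponent_iff hS).1 hw
  exact (hN (max N N') (le_max_left _ _)).trans (hN' (max N N') (le_max_right _ _)).symm

/-- Every set of vertices that is closed under adjacency within `G - S` is entered by no
path of `G - S`. -/
theorem JoinedOff.mem_of_closed {S W : Set V} {u v : V} (h : JoinedOff G S u v) (hu : u ∈ W)
    (hW : ∀ x y, x ∉ S → y ∉ S → G.Adj x y → x ∈ W → y ∈ W) : v ∈ W := by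
  obtain ⟨p, hp⟩ := h
  by_contra hv
  obtain ⟨d, hd, h1, h2⟩ := p.exists_boundary_dart W hu hv
  exact h2 (hW _ _ (hp _ (p.dart_fst_mem_support_of_mem_darts hd))
    (hp _ (p.dart_snd_mem_support_of_mem_darts hd)) d.adj h1)

/-! ### Cuts and the sides of a cut -/

/-- The cut of all edges between `X` and its complement. -/
def cutOf (G : SimpleGraph V) (X : Set V) : Set (Sym2 V) :=
  {e | e ∈ G.edgeSet ∧ ∃ x ∈ X, ∃ y ∉ X, e = s(x, y)}

theorem mem_cutOf {X : Set V} {x y : V} :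
    s(x, y) ∈ cutOf G X ↔ G.Adj x y ∧ (x ∈ X ∧ y ∉ X ∨ y ∈ X ∧ x ∉ X) := by
  simp only [cutOf, mem_ofPred_eq, SimpleGraph.mem_edgeSet]
  refine and_congr_right fun _ => ⟨?_, ?_⟩
  · rintro ⟨a, ha, b, hb, h⟩
    rcases Sym2.eq_iff.1 h with ⟨rfl, rfl⟩ | ⟨rfl, rfl⟩
    · exact Or.inl ⟨ha, hb⟩
    · exact Or.inr ⟨ha, hb⟩
  · rintro (⟨h1, h2⟩ | ⟨h1, h2⟩)
    · exact ⟨x, h1, y, h2, rfl⟩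
    · exact ⟨y, h1, x, h2, Sym2.eq_swap⟩

theorem isCut_cutOf (X : Set V) : IsCut G (cutOf G X) := ⟨X, rfl⟩

/-- Some finite set of vertices separates the end `ω` from the edge set `D`. -/
def AvoidsEnd (G : SimpleGraph V) (D : Set (Sym2 V)) (ω : Ends G) : Prop :=
  ∃ S : Set V, S.Finite ∧ ∀ e ∈ D, ∀ v ∈ e, v ∉ endComponent G S ω

theorem avoidsEnd_of_finite {D : Set (Sym2 V)} (hD : D.Finite) (ω : Ends G) :
    AvoidsEnd G D ω := by
  refine ⟨⋃ e ∈ D, {v | v ∈ e}, hD.biUnion fun e _ => ?_, fun e he v hv hvC => ?_⟩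
  · induction e with | _ x y => exact (toFinite {x, y}).subset fun v hv => by simpa using hv
  · exact notMem_of_mem_endComponent hvC (mem_biUnion he hv)

theorem endComponent_subset_of_mem_endNhd {S : Set V} (hS : S.Finite) {ω η : Ends G}
    (h : .endPt η ∈ endNhd G S ω) : endComponent G S η ⊆ endComponent G S ω := by
  obtain ⟨R, rfl, hR⟩ := h
  intro v hv
  obtain ⟨N, hN⟩ := (mem_endComponent_iff hS).1 hv
  exact mem_endComponent_of_joinedOff (hR N) (hN N le_rfl)

theorem isOpen_endNhd {S : Set V} (hS : S.Finite) (ω : Ends G) : IsOpen (endNhd G S ω) := by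
  refine ⟨fun v hv => ⟨1, one_pos, fun e x h => ?_⟩, fun e x hx => ⟨1, one_pos, fun y _ => hx⟩,
    fun η hη => ⟨S, hS, ?_⟩⟩
  · refine ⟨v, ?_, hv⟩
    rw [← mk_tail_head]
    rcases h with ⟨rfl, -⟩ | ⟨rfl, -⟩ <;> simp
  · have hsub := endComponent_subset_of_mem_endNhd hS hη
    rintro (v | θ | ⟨e, x⟩) hp
    · exact hsub hp
    · obtain ⟨R, hR, hn⟩ := hp
      exact ⟨R, hR, fun n => hsub (hn n)⟩
    · obtain ⟨v, hv, hvc⟩ := hp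
      exact ⟨v, hv, hsub hvc⟩

theorem endPt_mem_endNhd {S : Set V} (hS : S.Finite) (ω : Ends G) :
    .endPt ω ∈ endNhd G S ω := by
  obtain ⟨R, rfl⟩ := ω.exists_ray
  obtain ⟨N, hN⟩ := (Ray.equivalent_equivalence G).refl R S hS
  exact ⟨R.drop N, R.toEnd_drop N, fun n => (mem_endComponent_iff hS).2
    ⟨N, fun m hm => hN (N + n) (by omega) m hm⟩⟩

/-- The open set of points of `|G|` on the `W`-side of the cut of `W`. -/
def sideSet (G : SimpleGraph V) (W : Set V) : Set (GraphPoint G) :=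
  {p | match p with
    | .vert v => v ∈ W
    | .endPt ω => ∃ S : Set V, S.Finite ∧ ∀ v ∈ endComponent G S ω,
        v ∈ W ∧ ∀ v', G.Adj v v' → v' ∈ W
    | .inner e x => (x.1 < 1 / 2 ∧ tail e ∈ W) ∨ (1 / 2 < x.1 ∧ head e ∈ W) ∨
        (tail e ∈ W ∧ head e ∈ W)}

/-- Edges are split at their midpoints. For an end, requiring the neighbours of `C(S, ω)` to be in
`W` too puts all edges incident with that component on the same side, hence all of `Ĉ(S, ω)`. -/
theorem isOpen_sideSet (W : Set V) : IsOpen (sideSet G W) := by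
  refine ⟨fun v hv => ⟨1 / 2, by norm_num, fun e x h => ?_⟩, fun e x hx => ?_, fun ω hω => ?_⟩
  · rcases h with ⟨rfl, h⟩ | ⟨rfl, h⟩
    · exact Or.inl ⟨h, hv⟩
    · exact Or.inr (Or.inl ⟨by linarith, hv⟩)
  · rcases hx with ⟨h, hW⟩ | ⟨h, hW⟩ | h
    · exact ⟨1 / 2 - x.1, by linarith, fun y hy => Or.inl ⟨by linarith [(abs_lt.1 hy).1], hW⟩⟩
    · exact ⟨x.1 - 1 / 2, by linarith,
        fun y hy => Or.inr (Or.inl ⟨by linarith [(abs_lt.1 hy).2], hW⟩)⟩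
    · exact ⟨1, one_pos, fun y _ => Or.inr (Or.inr h)⟩
  · obtain ⟨S, hS, h⟩ := hω
    refine ⟨S, hS, ?_⟩
    rintro (v | η | ⟨e, x⟩) hp
    · exact (h v hp).1
    · exact ⟨S, hS, fun v hv => h v (endComponent_subset_of_mem_endNhd hS hp hv)⟩
    · obtain ⟨v, hv, hvc⟩ := hp
      have hadj : G.Adj (tail e) (head e) := by
        rw [← SimpleGraph.mem_edgeSet, mk_tail_head]; exact e.2
      rw [← mk_tail_head, Sym2.mem_iff] at hv
      rcases hv with rfl | rfl
      · exact Or.inr (Or.inr ⟨(h _ hvc).1, (h _ hvc).2 _ hadj⟩)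
      · exact Or.inr (Or.inr ⟨(h _ hvc).2 _ hadj.symm, (h _ hvc).1⟩)

theorem disjoint_sideSet_compl (W : Set V) : Disjoint (sideSet G W) (sideSet G Wᶜ) := by
  rw [disjoint_left]
  rintro (v | ω | ⟨e, x⟩) hp hq
  · exact hq hp
  · obtain ⟨S, hS, h⟩ := hp
    obtain ⟨S', hS', h'⟩ := hq
    obtain ⟨v, hv⟩ := endComponent_nonempty (hS.union hS') ω
    exact (h' v (endComponent_anti G subset_union_right ω hv)).1
      (h v (endComponent_anti G subset_union_left ω hv)).1
  · rcases hp with ⟨h1, h2⟩ | ⟨h1, h2⟩ | ⟨h1, h2⟩ <;>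
    rcases hq with ⟨h3, h4⟩ | ⟨h3, h4⟩ | ⟨h3, h4⟩ <;>
    first
      | exact h4 h2
      | exact h4 h1
      | exact h3 h2
      | exact h3 h1
      | linarith

/-- The component `C(S, ω)` is connected and no edge at it belongs to the cut. So it lies, with all
its neighbours, on the side of any one of its vertices. -/
theorem endPt_mem_sideSet_union {W : Set V} {ω : Ends G} (h : AvoidsEnd G (cutOf G W) ω) :
    .endPt ω ∈ sideSet G W ∪ sideSet G Wᶜ := by
  obtain ⟨S, hS, h⟩ := h
  obtain ⟨v₀, hv₀⟩ := endComponent_nonempty hS ω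
  have key : ∀ U : Set V, (∀ x y, s(x, y) ∉ cutOf G W → G.Adj x y → x ∈ U → y ∈ U) → v₀ ∈ U →
      .endPt ω ∈ sideSet G U := by
    intro U hU hv
    have hC : ∀ v ∈ endComponent G S ω, v ∈ U := by
      intro v hvC
      have := joinedOff_of_mem_endComponent hS hv₀ hvC
      have hmem := this.mem_of_closed (W := U ∩ endComponent G S ω) ⟨hv, hv₀⟩ ?_
      · exact hmem.1
      · intro x y hx hy hxy hxU
        refine ⟨hU x y (fun hc => h _ hc x (by simp) hxU.2) hxy hxU.1, ?_⟩
        exact mem_endComponent_of_joinedOff hxU.2 (JoinedOff.of_adj hxy hx hy).symm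
    exact ⟨S, hS, fun v hv => ⟨hC v hv, fun v' hv' =>
      hU v v' (fun hc => h _ hc v (by simp) hv) hv' (hC v hv)⟩⟩
  by_cases hv : v₀ ∈ W
  · refine Or.inl (key W (fun x y hc hxy hx => ?_) hv)
    by_contra hy
    exact hc (mem_cutOf.2 ⟨hxy, Or.inl ⟨hx, hy⟩⟩)
  · refine Or.inr (key Wᶜ (fun x y hc hxy hx => ?_) hv)
    by_contra hy
    exact hc (mem_cutOf.2 ⟨hxy, Or.inr ⟨not_not.1 hy, hx⟩⟩)

theorem inner_mem_sideSet_union {W : Set V} {e : G.edgeSet} {x : Ioo (0 : ℝ) 1}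
    (h : x.1 ≠ 1 / 2 ∨ e.1 ∉ cutOf G W) : .inner e x ∈ sideSet G W ∪ sideSet G Wᶜ := by
  have hadj : G.Adj (tail e) (head e) := by
    rw [← SimpleGraph.mem_edgeSet, mk_tail_head]; exact e.2
  by_cases h1 : tail e ∈ W <;> by_cases h2 : head e ∈ W
  · exact Or.inl (Or.inr (Or.inr ⟨h1, h2⟩))
  · rcases h with h | h
    · rcases lt_or_gt_of_ne h with h | h
      · exact Or.inl (Or.inl ⟨h, h1⟩)
      · exact Or.inr (Or.inr (Or.inl ⟨h, h2⟩))
    · rw [← mk_tail_head, mem_cutOf] at h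
      exact absurd ⟨hadj, Or.inl ⟨h1, h2⟩⟩ h
  · rcases h with h | h
    · rcases lt_or_gt_of_ne h with h | h
      · exact Or.inr (Or.inl ⟨h, h1⟩)
      · exact Or.inl (Or.inr (Or.inl ⟨h, h2⟩))
    · rw [← mk_tail_head, mem_cutOf] at h
      exact absurd ⟨hadj, Or.inr ⟨h2, h1⟩⟩ h
  · exact Or.inr (Or.inr (Or.inr ⟨h1, h2⟩))

/-! ### The closure of an edge set -/

theorem PsiSpace.isOpen_inner (e : G.edgeSet) (s : Set (Ioo (0 : ℝ) 1)) (hs : IsOpen s) :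
    IsOpen {p : GraphPoint G | ∃ x ∈ s, p = .inner e x} := by
  refine ⟨?_, ?_, ?_⟩
  · rintro v ⟨x, -, h⟩; cases h
  · rintro f x ⟨y, hy, h⟩
    obtain ⟨rfl, rfl⟩ := GraphPoint.inner.inj h
    obtain ⟨ε, hε, hball⟩ := Metric.isOpen_iff.1 hs x hy
    refine ⟨ε, hε, fun z hz => ⟨z, hball ?_, rfl⟩⟩
    rw [Metric.mem_ball, dist_comm]
    exact hz
  · rintro ω ⟨x, -, h⟩; cases h

/-- The midpoint of the unit interval. -/
noncomputable def midParam : Ioo (0 : ℝ) 1 := ⟨1 / 2, by norm_num, by norm_num⟩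

/-- The point of `|G|_Ψ` on the edge `e` at parameter `x`. -/
def psiInner (Ψ : Set (Ends G)) (e : G.edgeSet) (x : Ioo (0 : ℝ) 1) : PsiSpace G Ψ :=
  ⟨.inner e x, fun _ h => by cases h⟩

theorem psiInner_mem_closure_iff {C : Set (Sym2 V)} {e : G.edgeSet} {x : Ioo (0 : ℝ) 1} :
    psiInner Ψ e x ∈ closure (interiorPoints G Ψ C) ↔ e.1 ∈ C := by
  constructor
  · intro h
    have hopen : IsOpen {p : PsiSpace G Ψ | ∃ y ∈ Set.univ, p.1 = .inner e y} :=
      (PsiSpace.isOpen_inner e Set.univ isOpen_univ).preimage continuous_subtype_val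
    obtain ⟨p, ⟨y, -, hy⟩, ⟨f, z, hf, hz⟩⟩ := mem_closure_iff.1 h _ hopen ⟨x, trivial, rfl⟩
    rw [hy] at hz
    rw [(GraphPoint.inner.inj hz).1]
    exact hf
  · intro h
    exact subset_closure ⟨e, x, h, rfl⟩

/-- The neighbourhood `Ĉ(S, ω)` contains an interior point of an edge exactly when the edge has an
endvertex in `C(S, ω)`. This turns the closure condition into a combinatorial one. -/
theorem isPsiBounded_iff {D : Set (Sym2 V)} (hD : D ⊆ G.edgeSet) :
    IsPsiBounded G Ψ D ↔ ∀ ω ∈ Ψ, AvoidsEnd G D ω := by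
  constructor
  · intro h ω hω
    by_contra hno
    refine h ⟨.endPt ω, fun η hη => ?_⟩ ?_ ω rfl
    · cases hη; exact hω
    · rw [mem_closure_iff]
      intro U hU hωU
      obtain ⟨U', hU', rfl⟩ := isOpen_induced_iff.1 hU
      obtain ⟨S, hS, hSU⟩ := hU'.2.2 ω hωU
      rw [AvoidsEnd] at hno
      push Not at hno
      obtain ⟨e, heD, v, hv, hvC⟩ := hno S hS
      exact ⟨psiInner Ψ ⟨e, hD heD⟩ midParam, hSU ⟨v, hv, hvC⟩, _, _, heD, rfl⟩
  · rintro h ⟨p, hp⟩ hpc ω rfl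
    obtain ⟨S, hS, hno⟩ := h ω (hp ω rfl)
    obtain ⟨q, hq, e, x, he, hqe⟩ := mem_closure_iff.1 hpc _
      ((isOpen_endNhd hS ω).preimage continuous_subtype_val) (endPt_mem_endNhd hS ω)
    rw [mem_preimage, hqe] at hq
    obtain ⟨v, hv, hvC⟩ := hq
    exact hno _ he v hv hvC

theorem sideSet_cover {W : Set V} (hW : ∀ ω ∈ Ψ, AvoidsEnd G (cutOf G W) ω) :
    vertexPoints G Ψ ⊆ {p | p.1 ∈ sideSet G W} ∪ {p | p.1 ∈ sideSet G Wᶜ} := by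
  rintro ⟨p, hp⟩ (⟨v, rfl⟩ | ⟨ω, rfl⟩)
  · exact em (v ∈ W)
  · exact endPt_mem_sideSet_union (hW ω (hp ω rfl))

/-! ### The graph-like quotient of a locally finite graph is trivial -/

/-- Here local finiteness enters: deleting `v` with its finitely many neighbours leaves no component
vertex adjacent to `v`. -/
theorem endPt_mem_sideSet_compl_singleton (hG : ∀ v, (G.neighborSet v).Finite) (v : V)
    (ω : Ends G) : .endPt ω ∈ sideSet G {v}ᶜ := by
  refine ⟨insert v (G.neighborSet v), (hG v).insert v, fun w hw => ?_⟩
  have := notMem_of_mem_endComponent hw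
  rw [mem_insert_iff, not_or] at this
  refine ⟨this.1, fun w' hw' h => this.2 ?_⟩
  rw [mem_singleton_iff.1 h] at hw'
  exact hw'.symm

theorem cutOf_subset_of_boundary {W S : Set V} (h : ∀ x ∈ W, ∀ y ∉ W, G.Adj x y → y ∈ S) :
    cutOf G W ⊆ ⋃ v ∈ S, (fun w => s(v, w)) '' G.neighborSet v := by
  rintro e ⟨he, x, hx, y, hy, rfl⟩
  exact mem_biUnion (h x hx y hy he) ⟨x, he.symm, Sym2.eq_swap⟩

theorem cutOf_compl (W : Set V) : cutOf G Wᶜ = cutOf G W := by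
  ext e
  induction e with | _ x y =>
  rw [mem_cutOf, mem_cutOf]
  simp only [mem_compl_iff, not_not]
  tauto

theorem finite_cutOf_singleton (hG : ∀ v, (G.neighborSet v).Finite) (v : V) :
    (cutOf G {v}).Finite := by
  rw [← cutOf_compl]
  refine Finite.subset ?_ (cutOf_subset_of_boundary (S := {v}) ?_)
  · simpa using (hG v).image _
  · intro x _ y hy _; simpa using hy

/-- A vertex is cut off by the edges at it. Two ends are separated by the boundary of a component
off a finite set `S`, whose edges are all incident with `S`; this boundary is finite by local
finiteness. -/
theorem exists_finite_cut_of_ne (hG : ∀ v, (G.neighborSet v).Finite) {p q : GraphPoint G}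
    (hp : ∀ e x, p ≠ .inner e x) (hq : ∀ e x, q ≠ .inner e x) (hpq : p ≠ q) :
    ∃ W, (cutOf G W).Finite ∧ p ∈ sideSet G W ∧ q ∈ sideSet G Wᶜ := by
  rcases p with v | ω | ⟨e, x⟩
  · refine ⟨{v}, finite_cutOf_singleton hG v, rfl, ?_⟩
    rcases q with w | η | ⟨e, x⟩
    · rintro rfl; exact hpq rfl
    · exact endPt_mem_sideSet_compl_singleton hG v η
    · exact absurd rfl (hq e x)
  · rcases q with w | η | ⟨e, x⟩
    · refine ⟨{w}ᶜ, ?_, endPt_mem_sideSet_compl_singleton hG w ω, ?_⟩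
      · rw [cutOf_compl]; exact finite_cutOf_singleton hG w
      · rw [compl_compl]; rfl
    · obtain ⟨R, rfl⟩ := ω.exists_ray
      obtain ⟨R', rfl⟩ := η.exists_ray
      have hne : ¬ R.Equivalent R' := fun h => hpq (by rw [Ray.toEnd_eq_iff.2 h])
      rw [Ray.Equivalent] at hne
      push Not at hne
      obtain ⟨S, hS, hN⟩ := hne
      -- Deleting the neighbours of `S` as well ensures that neighbours of the remaining component
      -- avoid `S`, as membership in `sideSet` demands.
      have hS' : (S ∪ ⋃ v ∈ S, G.neighborSet v).Finite := hS.union (hS.biUnion fun v _ => hG v)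
      have hstep : ∀ {U : Set V}, (∀ x y, x ∉ S → y ∉ S → G.Adj x y → x ∈ U → y ∈ U) →
          ∀ θ : Ends G, (∀ v ∈ endComponent G (S ∪ ⋃ v ∈ S, G.neighborSet v) θ, v ∈ U) →
          .endPt θ ∈ sideSet G U := by
        intro U hU θ hθ
        refine ⟨_, hS', fun v hv => ⟨hθ v hv, fun w hw => hU v w ?_ ?_ hw (hθ v hv)⟩⟩
        · exact fun h => notMem_of_mem_endComponent hv (Or.inl h)
        · exact fun h => notMem_of_mem_endComponent hv (Or.inr (mem_biUnion h hw.symm))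
      refine ⟨endComponent G S R.toEnd, ?_, ?_, ?_⟩
      · refine (hS.biUnion fun v _ => (hG v).image _).subset
          (cutOf_subset_of_boundary (S := S) fun x hx y hy hxy => ?_)
        by_contra hyS
        exact hy (mem_endComponent_of_joinedOff hx
          (JoinedOff.of_adj hxy.symm hyS (notMem_of_mem_endComponent hx)))
      · refine hstep (fun x y hxS hyS hxy hx => ?_) _
          fun v hv => endComponent_anti G subset_union_left _ hv
        exact mem_endComponent_of_joinedOff hx (JoinedOff.of_adj hxy.symm hyS hxS)
      · refine hstep (U := (endComponent G S R.toEnd)ᶜ) (fun x y hxS hyS hxy hx hy => hx ?_) _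
          fun v hv hv' => ?_
        · exact mem_endComponent_of_joinedOff hy (JoinedOff.of_adj hxy hxS hyS)
        · obtain ⟨N, hN1⟩ := (mem_endComponent_iff hS).1 hv'
          obtain ⟨N', hN2⟩ := (mem_endComponent_iff hS).1
            (endComponent_anti G subset_union_left _ hv)
          obtain ⟨m, hm, n, hn, h⟩ := hN (max N N')
          exact h ((hN1 m (le_of_max_le_left hm)).symm.trans (hN2 n (le_of_max_le_right hn)))
    · exact absurd rfl (hq e x)
  · exact absurd rfl (hp e x)

theorem pointEquiv_iff_eq (hG : ∀ v, (G.neighborSet v).Finite) {p q : PsiSpace G Ψ} :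
    PointEquiv G Ψ p q ↔ p = q := by
  refine ⟨?_, Or.inl⟩
  rintro (h | ⟨hp, hq, h⟩)
  · exact h
  by_contra hpq
  have hv : ∀ r ∈ vertexPoints G Ψ, ∀ e x, r.1 ≠ .inner e x := by
    rintro r (⟨v, hr⟩ | ⟨ω, hr⟩) e x h <;> rw [hr] at h <;> cases h
  obtain ⟨W, hW, hpW, hqW⟩ := exists_finite_cut_of_ne hG (hv p hp) (hv q hq)
    (fun h => hpq (Subtype.ext h))
  have := h {p | p.1 ∈ sideSet G W} {p | p.1 ∈ sideSet G Wᶜ}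
    ((isOpen_sideSet W).preimage continuous_subtype_val)
    ((isOpen_sideSet Wᶜ).preimage continuous_subtype_val)
    (disjoint_left.2 fun r h1 h2 => (disjoint_left.1 (disjoint_sideSet_compl W)) h1 h2)
    (sideSet_cover fun ω _ => avoidsEnd_of_finite hW ω)
  exact (disjoint_left.1 (disjoint_sideSet_compl W)) (this.1 hpW) hqW

/-- For a locally finite graph, the quotient map is a homeomorphism. -/
def quotientHomeomorph (hG : ∀ v, (G.neighborSet v).Finite) (Ψ : Set (Ends G)) :
    PsiSpace G Ψ ≃ₜ GraphLikeQuotient G Ψ where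
  toFun := Quotient.mk (pointSetoid G Ψ)
  invFun := Quotient.lift id fun _ _ h => (pointEquiv_iff_eq hG).1 h
  left_inv _ := rfl
  right_inv q := by induction q using Quotient.inductionOn with | _ p => rfl
  continuous_toFun := continuous_quotient_mk'
  continuous_invFun := continuous_id.quotient_lift _

theorem isPsiCircuit_iff (hG : ∀ v, (G.neighborSet v).Finite) {C : Set (Sym2 V)} :
    IsPsiCircuit G Ψ C ↔
      C ⊆ G.edgeSet ∧ Nonempty (closure (interiorPoints G Ψ C) ≃ₜ Circle) := by
  refine and_congr_right fun _ => ?_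
  have h : closure (Quotient.mk (pointSetoid G Ψ) '' interiorPoints G Ψ C :
      Set (GraphLikeQuotient G Ψ)) =
      quotientHomeomorph hG Ψ '' closure (interiorPoints G Ψ C) :=
    ((quotientHomeomorph hG Ψ).image_closure _).symm
  rw [h]
  let φ := (quotientHomeomorph hG Ψ).image (closure (interiorPoints G Ψ C))
  exact ⟨fun ⟨f⟩ => ⟨φ.trans f⟩, fun ⟨f⟩ => ⟨φ.symm.trans f⟩⟩

theorem isClosed_inner (e : G.edgeSet) {a b : ℝ} (ha : 0 < a) (hb : b < 1) :
    IsClosed {p : GraphPoint G | ∃ x : Ioo (0 : ℝ) 1, a ≤ x.1 ∧ x.1 ≤ b ∧ p = .inner e x} := by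
  rw [← isOpen_compl_iff]
  refine ⟨fun v _ => ⟨min a (1 - b), lt_min ha (by linarith), ?_⟩, ?_, ?_⟩
  · rintro f x h ⟨y, h1, h2, h3⟩
    obtain ⟨rfl, rfl⟩ := GraphPoint.inner.inj h3
    rcases h with ⟨-, h⟩ | ⟨-, h⟩
    · linarith [lt_min_iff.1 h]
    · linarith [lt_min_iff.1 h]
  · rintro f x hx
    by_cases hfe : f = e
    · subst hfe
      have hx' : x.1 < a ∨ b < x.1 := by
        by_contra! hcon
        exact hx ⟨x, hcon.1, hcon.2, rfl⟩
      rcases hx' with h | h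
      · refine ⟨a - x.1, by linarith, ?_⟩
        rintro y hy ⟨z, h1, h2, h3⟩
        obtain ⟨-, rfl⟩ := GraphPoint.inner.inj h3
        linarith [(abs_lt.1 hy).1]
      · refine ⟨x.1 - b, by linarith, ?_⟩
        rintro y hy ⟨z, h1, h2, h3⟩
        obtain ⟨-, rfl⟩ := GraphPoint.inner.inj h3
        linarith [(abs_lt.1 hy).2]
    · refine ⟨1, one_pos, ?_⟩
      rintro y - ⟨z, -, -, h3⟩
      exact hfe (GraphPoint.inner.inj h3).1
  · intro ω _
    refine ⟨{tail e, head e}, by simp, ?_⟩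
    rintro p hp ⟨x, -, -, rfl⟩
    obtain ⟨v, hv, hvC⟩ := hp
    rw [← mk_tail_head, Sym2.mem_iff] at hv
    exact notMem_of_mem_endComponent hvC hv

theorem t2Space_psiSpace (hG : ∀ v, (G.neighborSet v).Finite) : T2Space (PsiSpace G Ψ) := by
  have key : ∀ (e : G.edgeSet) (x : Ioo (0 : ℝ) 1) (q : GraphPoint G), q ≠ .inner e x →
      ∃ U U' : Set (GraphPoint G), IsOpen U ∧ IsOpen U' ∧ .inner e x ∈ U ∧ q ∈ U' ∧
        Disjoint U U' := by
    intro e x q hq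
    obtain ⟨δ, hδ, hqδ⟩ : ∃ δ > (0 : ℝ), ∀ y : Ioo (0 : ℝ) 1, |y.1 - x.1| < δ →
        q ≠ .inner e y := by
      by_cases h : ∃ y, q = .inner e y
      · obtain ⟨y, rfl⟩ := h
        have hyx : y.1 - x.1 ≠ 0 := fun h => hq (by rw [Subtype.ext (sub_eq_zero.1 h)])
        refine ⟨|y.1 - x.1|, abs_pos.2 hyx, fun z hz h => ?_⟩
        obtain ⟨-, rfl⟩ := GraphPoint.inner.inj h
        exact lt_irrefl _ hz
      · push Not at h
        exact ⟨1, one_pos, fun y _ => h y⟩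
    have hx0 := x.2.1
    have hx1 := x.2.2
    set ε := min δ (min x.1 (1 - x.1)) / 2 with hε
    have hm : 0 < min δ (min x.1 (1 - x.1)) := lt_min hδ (lt_min hx0 (by linarith))
    have hε0 : 0 < ε := by positivity
    have hεδ : ε < δ := (half_lt_self hm).trans_le (min_le_left _ _)
    have hεx : ε < x.1 :=
      (half_lt_self hm).trans_le ((min_le_right _ _).trans (min_le_left _ _))
    have hεx1 : ε < 1 - x.1 :=
      (half_lt_self hm).trans_le ((min_le_right _ _).trans (min_le_right _ _))
    refine ⟨_, _, PsiSpace.isOpen_inner e {y | y.1 ∈ Ioo (x.1 - ε) (x.1 + ε)}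
      (isOpen_Ioo.preimage continuous_subtype_val),
      (isClosed_inner e (a := x.1 - ε) (b := x.1 + ε) (by linarith) (by linarith)).isOpen_compl,
      ⟨x, ⟨by linarith, by linarith⟩, rfl⟩, ?_, ?_⟩
    · rintro ⟨y, h1, h2, rfl⟩
      exact hqδ y (by rw [abs_lt]; constructor <;> linarith) rfl
    · rw [disjoint_left]
      rintro p ⟨y, hy, rfl⟩ h
      exact h ⟨y, hy.1.le, hy.2.le, rfl⟩
  refine ⟨fun p q hpq => ?_⟩
  have pull : ∀ U U' : Set (GraphPoint G), IsOpen U → IsOpen U' → p.1 ∈ U → q.1 ∈ U' →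
      Disjoint U U' → ∃ u v : Set (PsiSpace G Ψ), IsOpen u ∧ IsOpen v ∧ p ∈ u ∧ q ∈ v ∧
        Disjoint u v := fun U U' h1 h2 h3 h4 h5 =>
    ⟨_, _, h1.preimage continuous_subtype_val, h2.preimage continuous_subtype_val, h3, h4,
      h5.preimage _⟩
  have hpq' : p.1 ≠ q.1 := fun h => hpq (Subtype.ext h)
  by_cases hp : ∃ e x, p.1 = .inner e x
  · obtain ⟨e, x, hp⟩ := hp
    obtain ⟨U, U', h1, h2, h3, h4, h5⟩ := key e x q.1 (by rw [← hp]; exact hpq'.symm)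
    exact pull U U' h1 h2 (by rwa [hp]) h4 h5
  by_cases hq : ∃ e x, q.1 = .inner e x
  · obtain ⟨e, x, hq⟩ := hq
    obtain ⟨U, U', h1, h2, h3, h4, h5⟩ := key e x p.1 (by rw [← hq]; exact hpq')
    exact pull U' U h2 h1 h4 (by rwa [hq]) h5.symm
  push Not at hp hq
  obtain ⟨W, -, hpW, hqW⟩ := exists_finite_cut_of_ne hG hp hq hpq'
  exact pull _ _ (isOpen_sideSet W) (isOpen_sideSet Wᶜ) hpW hqW (disjoint_sideSet_compl W)

/-! ### Circuits and bounded cuts -/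

theorem IsPsiCircuit.nonempty (hG : ∀ v, (G.neighborSet v).Finite) {C : Set (Sym2 V)}
    (hC : IsPsiCircuit G Ψ C) : C.Nonempty := by
  obtain ⟨-, ⟨f⟩⟩ := (isPsiCircuit_iff hG).1 hC
  by_contra hne
  rw [not_nonempty_iff_eq_empty] at hne
  have hem : interiorPoints G Ψ C = ∅ := by
    rw [eq_empty_iff_forall_notMem]
    rintro p ⟨e, x, he, -⟩
    rw [hne] at he
    exact he
  have hcl : closure (interiorPoints G Ψ C) = ∅ := by rw [hem, closure_empty]
  exact (hcl ▸ (f.symm 1).2 : (f.symm 1).1 ∈ (∅ : Set (PsiSpace G Ψ)))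

/-- No circle properly contains another, and the closure of an edge set determines the set because
no further interior points of edges are added by closing. -/
theorem IsPsiCircuit.eq_of_subset (hG : ∀ v, (G.neighborSet v).Finite) {C C' : Set (Sym2 V)}
    (hC : IsPsiCircuit G Ψ C) (hC' : IsPsiCircuit G Ψ C') (h : C ⊆ C') : C = C' := by
  obtain ⟨-, hf⟩ := (isPsiCircuit_iff hG).1 hC
  obtain ⟨hE, hf'⟩ := (isPsiCircuit_iff hG).1 hC'
  have hsub : interiorPoints G Ψ C ⊆ interiorPoints G Ψ C' := by
    rintro p ⟨e, x, he, hp⟩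
    exact ⟨e, x, h he, hp⟩
  have heq := eq_of_subset_of_homeomorph_circle (closure_mono hsub) hf hf'
  refine Subset.antisymm h fun e he => ?_
  have := (psiInner_mem_closure_iff (Ψ := Ψ) (e := ⟨e, hE he⟩) (x := midParam)).2 he
  rw [← heq] at this
  exact psiInner_mem_closure_iff.1 this

/-- A `Ψ`-circuit does not meet a `Ψ`-bounded cut in exactly one edge. -/
theorem IsPsiCircuit.inter_cut_ne_singleton (hG : ∀ v, (G.neighborSet v).Finite)
    {C : Set (Sym2 V)} (hC : IsPsiCircuit G Ψ C) {W : Set V}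
    (hW : ∀ ω ∈ Ψ, AvoidsEnd G (cutOf G W) ω) (e : Sym2 V) : C ∩ cutOf G W ≠ {e} := by
  intro hCe
  obtain ⟨hE, ⟨f⟩⟩ := (isPsiCircuit_iff hG).1 hC
  have heC : e ∈ C ∩ cutOf G W := by rw [hCe]; rfl
  let e' : G.edgeSet := ⟨e, hE heC.1⟩
  set X := closure (interiorPoints G Ψ C) with hX
  have hmem : ∀ x, psiInner Ψ e' x ∈ X := fun x => psiInner_mem_closure_iff.2 heC.1
  -- A circle minus the midpoint of the unique common edge is connected. Yet the two sides of the
  -- cut cover it, and the quarter points of that edge lie on different sides.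
  have hpre : IsPreconnected (X \ {psiInner Ψ e' midParam}) := by
    have h1 := (isPreconnected_compl_singleton_circle (f ⟨_, hmem midParam⟩)).image
      (fun z => (f.symm z).1) (by fun_prop)
    convert h1 using 1
    ext p
    simp only [mem_sdiff, mem_singleton_iff, mem_image, mem_compl_iff]
    constructor
    · rintro ⟨hp, hpe⟩
      exact ⟨f ⟨p, hp⟩, fun h => hpe (congrArg Subtype.val (f.injective h)), by simp⟩
    · rintro ⟨z, hz, rfl⟩
      refine ⟨(f.symm z).2, fun h => hz ?_⟩
      rw [← f.apply_symm_apply z]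
      exact congrArg f (Subtype.ext h)
  have hcov : X \ {psiInner Ψ e' midParam} ⊆
      {p | p.1 ∈ sideSet G W} ∪ {p | p.1 ∈ sideSet G Wᶜ} := by
    rintro ⟨p, hp⟩ ⟨hpX, hpe⟩
    rcases p with v | ω | ⟨f, x⟩
    · exact em (v ∈ W)
    · exact endPt_mem_sideSet_union (hW ω (hp ω rfl))
    · refine inner_mem_sideSet_union ?_
      by_contra! hcon
      have hfC : f.1 ∈ C := (psiInner_mem_closure_iff (Ψ := Ψ) (x := x)).1 hpX
      have : f.1 ∈ C ∩ cutOf G W := ⟨hfC, hcon.2⟩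
      rw [hCe] at this
      refine hpe ?_
      have hfe : f = e' := Subtype.ext this
      have hx : x = midParam := Subtype.ext hcon.1
      subst hfe; subst hx; rfl
  have hadj : s(tail e', head e') ∈ cutOf G W := by rw [mk_tail_head]; exact heC.2
  let q : Ioo (0 : ℝ) 1 := ⟨1 / 4, by norm_num, by norm_num⟩
  let q' : Ioo (0 : ℝ) 1 := ⟨3 / 4, by norm_num, by norm_num⟩
  have hq : psiInner Ψ e' q ∈ X \ {psiInner Ψ e' midParam} := by
    refine ⟨hmem q, fun h => ?_⟩
    have := congrArg Subtype.val (GraphPoint.inner.inj (congrArg Subtype.val h)).2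
    norm_num [q, midParam] at this
  have hq' : psiInner Ψ e' q' ∈ X \ {psiInner Ψ e' midParam} := by
    refine ⟨hmem q', fun h => ?_⟩
    have := congrArg Subtype.val (GraphPoint.inner.inj (congrArg Subtype.val h)).2
    norm_num [q', midParam] at this
  have hne : (X \ {psiInner Ψ e' midParam} ∩ {p | p.1 ∈ sideSet G W}).Nonempty ∧
      (X \ {psiInner Ψ e' midParam} ∩ {p | p.1 ∈ sideSet G Wᶜ}).Nonempty := by
    rcases (mem_cutOf.1 hadj).2 with ⟨h1, h2⟩ | ⟨h1, h2⟩
    · exact ⟨⟨_, hq, Or.inl ⟨by norm_num [q], h1⟩⟩,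
        ⟨_, hq', Or.inr (Or.inl ⟨by norm_num [q'], h2⟩)⟩⟩
    · exact ⟨⟨_, hq', Or.inr (Or.inl ⟨by norm_num [q'], h1⟩)⟩,
        ⟨_, hq, Or.inl ⟨by norm_num [q], h2⟩⟩⟩
  obtain ⟨r, -, hr1, hr2⟩ := hpre _ _ ((isOpen_sideSet W).preimage continuous_subtype_val)
    ((isOpen_sideSet Wᶜ).preimage continuous_subtype_val) hcov hne.1 hne.2
  exact disjoint_left.1 (disjoint_sideSet_compl W) hr1 hr2

end Topology

section Tree

variable {V : Type u} {T : SimpleGraph V}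

/-! ### Branches of a tree -/

/-- The vertices on the `w`-side of the edge `xw`. -/
def branch (T : SimpleGraph V) (x w : V) : Set V := {y | (T.deleteEdges {s(x, w)}).Reachable w y}

theorem mem_branch_self (x w : V) : w ∈ branch T x w := SimpleGraph.Reachable.refl w

theorem mem_branch_of_adj {x w y y' : V} (hy : y ∈ branch T x w) (h : T.Adj y y')
    (hne : s(y, y') ≠ s(x, w)) : y' ∈ branch T x w :=
  SimpleGraph.Reachable.trans hy
    (SimpleGraph.Adj.reachable (SimpleGraph.deleteEdges_adj.2 ⟨h, hne⟩))

theorem notMem_branch (hT : T.IsTree) {x w : V} (h : T.Adj x w) : x ∉ branch T x w := by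
  intro hx
  have hb : T.IsBridge s(x, w) := SimpleGraph.isAcyclic_iff_forall_isBridge.1 hT.isAcyclic h
  exact SimpleGraph.isBridge_iff.1 hb (SimpleGraph.Reachable.symm hx)

/-- The edge defining a branch is the only edge of the tree that leaves it. Most separation
arguments below reduce to this. -/
theorem branch_cross (hT : T.IsTree) {x w y y' : V} (h : T.Adj x w) (hy : y ∈ branch T x w)
    (hyy : T.Adj y y') (hy' : y' ∉ branch T x w) : y = w ∧ y' = x := by
  by_contra hcon
  refine hy' (mem_branch_of_adj hy hyy fun heq => ?_)
  rcases Sym2.eq_iff.1 heq with ⟨rfl, rfl⟩ | ⟨rfl, rfl⟩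
  · exact notMem_branch hT h hy
  · exact hcon ⟨rfl, rfl⟩

theorem mem_of_closed_of_isTree (hT : T.IsTree) {U : Set V} {x : V} (hx : x ∈ U)
    (hU : ∀ y y', T.Adj y y' → y ∈ U → y' ∈ U) (y : V) : y ∈ U := by
  obtain ⟨p⟩ := hT.connected.preconnected x y
  by_contra hy
  obtain ⟨d, -, h1, h2⟩ := p.exists_boundary_dart U hx hy
  exact h2 (hU _ _ d.adj h1)

theorem mem_branch_swap (hT : T.IsTree) {x w : V} (h : T.Adj x w) (y : V) :
    y ∈ branch T w x ↔ y ∉ branch T x w := by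
  constructor
  · intro h1 h2
    have hb : T.IsBridge s(x, w) := SimpleGraph.isAcyclic_iff_forall_isBridge.1 hT.isAcyclic h
    rw [branch, Sym2.eq_swap] at h1
    exact SimpleGraph.isBridge_iff.1 hb (SimpleGraph.Reachable.trans h1 (SimpleGraph.Reachable.symm h2))
  · intro hy
    have : y ∈ branch T x w ∪ branch T w x := by
      refine mem_of_closed_of_isTree hT (Or.inl (mem_branch_self x w)) ?_ y
      rintro a b hab (ha | ha)
      · by_cases hb : b ∈ branch T x w
        · exact Or.inl hb
        · rw [(branch_cross hT h ha hab hb).2]; exact Or.inr (mem_branch_self w x)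
      · by_cases hb : b ∈ branch T w x
        · exact Or.inr hb
        · rw [(branch_cross hT h.symm ha hab hb).2]; exact Or.inl (mem_branch_self x w)
    exact this.resolve_left hy

theorem exists_mem_branch (hT : T.IsTree) {x y : V} (hxy : y ≠ x) :
    ∃ w, T.Adj x w ∧ y ∈ branch T x w := by
  have : y ∈ {x} ∪ {y | ∃ w, T.Adj x w ∧ y ∈ branch T x w} := by
    refine mem_of_closed_of_isTree hT (Or.inl rfl) ?_ y
    rintro a b hab (rfl | ⟨w, hw, ha⟩)
    · exact Or.inr ⟨b, hab, mem_branch_self a b⟩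
    · by_cases hb : b ∈ branch T x w
      · exact Or.inr ⟨w, hw, hb⟩
      · exact Or.inl (branch_cross hT hw ha hab hb).2
  exact this.resolve_left hxy

/-- A walk from `w` that avoids the edge `xw` could leave the larger branch only through its root
edge, and so would have to visit `x'`. -/
theorem branch_subset (hT : T.IsTree) {x w x' w' : V} (h' : T.Adj x' w')
    (hw : w ∈ branch T x' w') (hx' : x' ∉ branch T x w) : branch T x w ⊆ branch T x' w' := by
  rintro y ⟨p⟩
  by_contra hy
  obtain ⟨d, hd, h1, h2⟩ := p.exists_boundary_dart (branch T x' w') hw hy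
  have hadj := (SimpleGraph.deleteEdges_adj.1 d.adj).1
  have hd2 : d.snd ∈ branch T x w := by
    classical
    exact (p.takeUntil _ (p.dart_snd_mem_support_of_mem_darts hd)).reachable
  rw [(branch_cross hT h' h1 hadj h2).2] at hd2
  exact hx' hd2

theorem branch_unique (hT : T.IsTree) {x w w' y : V} (h : T.Adj x w) (h' : T.Adj x w')
    (hy : y ∈ branch T x w) (hy' : y ∈ branch T x w') : w = w' := by
  by_contra hne
  have h1 : w ∉ branch T x w' := fun hw =>
    hne (branch_cross hT h' hw h.symm (notMem_branch hT h')).1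
  have h2 : w' ∉ branch T x w := fun hw =>
    hne (branch_cross hT h hw h'.symm (notMem_branch hT h)).1.symm
  have := branch_subset hT h'.symm ((mem_branch_swap hT h' w).2 h1) h2 hy
  exact (mem_branch_swap hT h' y).1 this hy'

theorem mem_edges_of_separates (hT : T.IsTree) {x w u v : V} (h : T.Adj x w) (p : T.Walk u v)
    (hu : u ∉ branch T x w) (hv : v ∈ branch T x w) : s(x, w) ∈ p.edges := by
  obtain ⟨d, hd, h1, h2⟩ := p.exists_boundary_dart (branch T x w)ᶜ hu (by simpa using hv)
  have := branch_cross hT h (not_not.1 h2) d.adj.symm h1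
  rw [← this.1, ← this.2]
  exact List.mem_map_of_mem hd

/-! ### The graph `T × K₂` -/

theorem timesK2_adj {a b : V × Fin 2} :
    (timesK2 T).Adj a b ↔ T.Adj a.1 b.1 ∧ a.2 = b.2 ∨ a.2 ≠ b.2 ∧ a.1 = b.1 := by
  rw [SimpleGraph.boxProd_adj, SimpleGraph.top_adj]

theorem timesK2_adj_horizontal {x w : V} {i : Fin 2} (h : T.Adj x w) :
    (timesK2 T).Adj (x, i) (w, i) := timesK2_adj.2 (Or.inl ⟨h, rfl⟩)

theorem timesK2_adj_rung (x : V) {i j : Fin 2} (h : i ≠ j) :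
    (timesK2 T).Adj (x, i) (x, j) := timesK2_adj.2 (Or.inr ⟨h, rfl⟩)

theorem branch_cross_timesK2 (hT : T.IsTree) {x w : V} {a b : V × Fin 2} (h : T.Adj x w)
    (ha : a.1 ∈ branch T x w) (hab : (timesK2 T).Adj a b) (hb : b.1 ∉ branch T x w) :
    a.1 = w ∧ b.1 = x := by
  rcases timesK2_adj.1 hab with ⟨h1, -⟩ | ⟨-, h1⟩
  · exact branch_cross hT h ha h1 hb
  · rw [h1] at ha; exact absurd ha hb

/-- The two copies of a branch are each connected and are joined by rungs. A walk follows one level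
and changes level, if necessary, at its last vertex. -/
theorem joinedOff_of_mem_branch {x w u v : V} {S : Set (V × Fin 2)}
    (hS : ∀ s ∈ S, s.1 ∉ branch T x w) (hu : u ∈ branch T x w) (hv : v ∈ branch T x w)
    (i j : Fin 2) : JoinedOff (timesK2 T) S (u, i) (v, j) := by
  have hmem : ∀ {y : V} {k : Fin 2}, y ∈ branch T x w → (y, k) ∉ S := fun hy h => hS _ h hy
  have h1 : ∀ {a b : V} (p : (T.deleteEdges {s(x, w)}).Walk a b), a ∈ branch T x w →
      JoinedOff (timesK2 T) S (a, i) (b, i) := by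
    intro a b p
    induction p with
    | nil => exact fun ha => ⟨.nil, by simpa using hmem ha⟩
    | cons h p ih =>
      intro ha
      have hb := SimpleGraph.Reachable.trans ha h.reachable
      exact (JoinedOff.of_adj (timesK2_adj_horizontal (SimpleGraph.deleteEdges_adj.1 h).1)
        (hmem ha) (hmem hb)).trans (ih hb)
  obtain ⟨p⟩ := SimpleGraph.Reachable.trans (SimpleGraph.Reachable.symm hu) hv
  refine (h1 p hu).trans ?_
  by_cases hij : i = j
  · subst hij
    exact ⟨.nil, by simpa using hmem hv⟩
  · exact JoinedOff.of_adj (timesK2_adj_rung v hij) (hmem hv) (hmem hv)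

/-! ### Vertices and ends as points of the tree -/

/-- The vertices of `T` and the ends of `T × K₂`. -/
abbrev Pt (T : SimpleGraph V) : Type u := V ⊕ Ends (timesK2 T)

/-- The point `p` lies on the `w`-side of the edge `xw`. -/
def Beyond (T : SimpleGraph V) (x w : V) : Pt T → Prop
  | .inl v => v ∈ branch T x w
  | .inr ω => ∃ R : Ray (timesK2 T), R.toEnd = ω ∧ ∃ N, ∀ n ≥ N, (R.toFun n).1 ∈ branch T x w

theorem Beyond.mono {x w x' w' : V} (h : branch T x w ⊆ branch T x' w') {p : Pt T}
    (hp : Beyond T x w p) : Beyond T x' w' p := by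
  rcases p with v | ω
  · exact h hp
  · obtain ⟨R, hR, N, hN⟩ := hp
    exact ⟨R, hR, N, fun n hn => h (hN n hn)⟩

theorem Ray.exists_avoid (R : Ray (timesK2 T)) (x : V) : ∃ N, ∀ n ≥ N, (R.toFun n).1 ≠ x := by
  obtain ⟨N, hN⟩ := R.exists_tail_notMem (S := {x} ×ˢ Set.univ) (toFinite _)
  exact ⟨N, fun n hn h => hN n hn ⟨h, trivial⟩⟩

theorem Ray.mem_branch_of_mem (hT : T.IsTree) (R : Ray (timesK2 T)) {x w : V} (h : T.Adj x w)
    {N : ℕ} (hN : ∀ n ≥ N, (R.toFun n).1 ≠ x) (h0 : (R.toFun N).1 ∈ branch T x w) :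
    ∀ n ≥ N, (R.toFun n).1 ∈ branch T x w := by
  intro n hn
  induction n, hn using Nat.le_induction with
  | base => exact h0
  | succ n hn ih =>
    by_contra hcon
    exact hN (n + 1) (by omega) (branch_cross_timesK2 hT h ih (R.adj n) hcon).2

/-- The two copies of `x` separate the branch from the rest of the graph. Equivalent rays therefore
end up on the same side, and the representative does not matter. -/
theorem beyond_toEnd_iff (hT : T.IsTree) {x w : V} (h : T.Adj x w) (R : Ray (timesK2 T)) :
    Beyond T x w (.inr R.toEnd) ↔ ∃ N, ∀ n ≥ N, (R.toFun n).1 ∈ branch T x w := by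
  refine ⟨?_, fun hN => ⟨R, rfl, hN⟩⟩
  rintro ⟨R', hR', N', hN'⟩
  obtain ⟨N, hN⟩ := Ray.toEnd_eq_iff.1 hR' ({x} ×ˢ Set.univ) (toFinite _)
  refine ⟨N, fun n hn => ?_⟩
  have hj := hN (max N N') (le_max_left _ _) n hn
  refine hj.mem_of_closed (W := {a : V × Fin 2 | a.1 ∈ branch T x w}) (hN' (max N N') (le_max_right _ _)) ?_
  intro a b ha hb hab haB
  by_contra hcon
  exact hb ⟨(branch_cross_timesK2 hT h haB hab hcon).2, trivial⟩

theorem exists_beyond (hT : T.IsTree) {p : Pt T} {x : V} (hp : p ≠ .inl x) :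
    ∃ w, T.Adj x w ∧ Beyond T x w p := by
  rcases p with v | ω
  · exact exists_mem_branch hT (fun h => hp (by rw [h]))
  · obtain ⟨R, rfl⟩ := ω.exists_ray
    obtain ⟨N, hN⟩ := R.exists_avoid x
    obtain ⟨w, hw, hRw⟩ := exists_mem_branch hT (hN N le_rfl)
    exact ⟨w, hw, R, rfl, N, R.mem_branch_of_mem hT hw hN hRw⟩

theorem beyond_unique (hT : T.IsTree) {p : Pt T} {x w w' : V} (h : T.Adj x w) (h' : T.Adj x w')
    (hp : Beyond T x w p) (hp' : Beyond T x w' p) : w = w' := by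
  rcases p with v | ω
  · exact branch_unique hT h h' hp hp'
  · obtain ⟨R, rfl⟩ := ω.exists_ray
    obtain ⟨N, hN⟩ := (beyond_toEnd_iff hT h R).1 hp
    obtain ⟨N', hN'⟩ := (beyond_toEnd_iff hT h' R).1 hp'
    exact branch_unique hT h h' (hN _ (le_max_left N N')) (hN' _ (le_max_right N N'))

theorem beyond_swap (hT : T.IsTree) {x w : V} (h : T.Adj x w) (p : Pt T) :
    Beyond T w x p ↔ ¬ Beyond T x w p := by
  rcases p with v | ω
  · exact mem_branch_swap hT h v
  · obtain ⟨R, rfl⟩ := ω.exists_ray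
    constructor
    · intro h1 h2
      obtain ⟨N, hN⟩ := (beyond_toEnd_iff hT h.symm R).1 h1
      obtain ⟨N', hN'⟩ := (beyond_toEnd_iff hT h R).1 h2
      exact (mem_branch_swap hT h _).1 (hN _ (le_max_left N N')) (hN' _ (le_max_right N N'))
    · intro h1
      obtain ⟨N, hN⟩ := R.exists_avoid x
      obtain ⟨N', hN'⟩ := R.exists_avoid w
      have key : (R.toFun (max N N')).1 ∉ branch T x w := fun hm =>
        h1 ⟨R, rfl, _, R.mem_branch_of_mem hT h
          (fun n hn => hN n (le_of_max_le_left hn)) hm⟩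
      exact ⟨R, rfl, _, R.mem_branch_of_mem hT h.symm
        (fun n hn => hN' n (le_of_max_le_right hn)) ((mem_branch_swap hT h _).2 key)⟩

/-! ### Walking towards a vertex or an end -/

open Classical in
/-- The neighbour of `x` in the direction of `p`; `x` itself if `p = x`. -/
noncomputable def next (p : Pt T) (x : V) : V :=
  if h : ∃ w, T.Adj x w ∧ Beyond T x w p then h.choose else x

theorem next_spec (hT : T.IsTree) {p : Pt T} {x : V} (hp : p ≠ .inl x) :
    T.Adj x (next p x) ∧ Beyond T x (next p x) p := by
  have h := exists_beyond hT hp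
  rw [next, dif_pos h]
  exact h.choose_spec

theorem next_self (hT : T.IsTree) (x : V) : next (.inl x : Pt T) x = x := by
  rw [next, dif_neg]
  rintro ⟨w, hw, hb⟩
  exact notMem_branch hT hw hb

theorem ne_inl_of_beyond (hT : T.IsTree) {p : Pt T} {x w : V} (h : T.Adj x w)
    (hp : Beyond T x w p) : p ≠ .inl x := by
  rintro rfl; exact notMem_branch hT h hp

theorem next_eq (hT : T.IsTree) {p : Pt T} {x w : V} (h : T.Adj x w) (hp : Beyond T x w p) :
    next p x = w := by
  obtain ⟨h1, h2⟩ := next_spec hT (ne_inl_of_beyond hT h hp)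
  exact beyond_unique hT h1 h h2 hp

/-- The vertices on the way from `x` to `p`. -/
noncomputable def toward (p : Pt T) (x : V) (n : ℕ) : V := (next p)^[n] x

@[simp] theorem toward_zero (p : Pt T) (x : V) : toward p x 0 = x := rfl

theorem toward_succ (p : Pt T) (x : V) (n : ℕ) : toward p x (n + 1) = next p (toward p x n) :=
  Function.iterate_succ_apply' _ _ _

theorem toward_add (p : Pt T) (x : V) (m n : ℕ) :
    toward p x (m + n) = toward p (toward p x m) n := by
  rw [toward, add_comm, Function.iterate_add_apply]; rfl

theorem toward_adj (hT : T.IsTree) {p : Pt T} {x : V} {n : ℕ} (h : p ≠ .inl (toward p x n)) :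
    T.Adj (toward p x n) (toward p x (n + 1)) := by
  rw [toward_succ]; exact (next_spec hT h).1

theorem toward_beyond (hT : T.IsTree) {p : Pt T} {x : V} {n : ℕ} (h : p ≠ .inl (toward p x n)) :
    Beyond T (toward p x n) (toward p x (n + 1)) p := by
  rw [toward_succ]; exact (next_spec hT h).2

theorem toward_of_eq (hT : T.IsTree) {v : V} {x : V} {n : ℕ}
    (h : toward (.inl v : Pt T) x n = v) : toward (.inl v : Pt T) x (n + 1) = v := by
  rw [toward_succ, h, next_self hT]

/-- Walking towards `p` never turns back: `p` lies beyond each edge just traversed, whereas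
backtracking would put it on the other side. So the branches containing `p` are nested. -/
theorem branch_next_subset (hT : T.IsTree) {p : Pt T} {x : V} (hx : p ≠ .inl x)
    (hx' : p ≠ .inl (next p x)) :
    branch T (next p x) (next p (next p x)) ⊆ branch T x (next p x) ∧
      x ∉ branch T (next p x) (next p (next p x)) := by
  obtain ⟨h1, h2⟩ := next_spec hT hx
  obtain ⟨h3, h4⟩ := next_spec hT hx'
  have hne : next p (next p x) ≠ x := by
    intro h
    rw [h] at h4
    exact (beyond_swap hT h1 p).1 h4 h2
  have h5 : x ∉ branch T (next p x) (next p (next p x)) := by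
    intro hx
    exact hne (branch_cross hT h3 hx h1 (notMem_branch hT h3)).1.symm
  refine ⟨branch_subset hT h1 ?_ h5, h5⟩
  by_contra h
  exact hne (branch_cross hT h1 (mem_branch_self _ _) h3 h).2

theorem branch_toward_subset (hT : T.IsTree) {p : Pt T} {x : V} {m n : ℕ} (hmn : m ≤ n)
    (h : ∀ k ≤ n, p ≠ .inl (toward p x k)) :
    branch T (toward p x n) (toward p x (n + 1)) ⊆
      branch T (toward p x m) (toward p x (m + 1)) := by
  induction n, hmn using Nat.le_induction with
  | base => exact Subset.rfl
  | succ n hn ih =>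
    refine Subset.trans ?_ (ih fun k hk => h k (by omega))
    have := (branch_next_subset hT (h n (by omega)) (by rw [← toward_succ]; exact h _ le_rfl)).1
    simpa only [← toward_succ] using this

theorem toward_mem_branch (hT : T.IsTree) {p : Pt T} {x : V} {m n : ℕ} (hmn : m < n)
    (h : ∀ k < n, p ≠ .inl (toward p x k)) :
    toward p x n ∈ branch T (toward p x m) (toward p x (m + 1)) := by
  obtain ⟨k, rfl⟩ : ∃ k, n = k + 1 := ⟨n - 1, by omega⟩
  exact branch_toward_subset hT (by omega) (fun j hj => h j (by omega)) (mem_branch_self _ _)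

theorem toward_notMem_branch (hT : T.IsTree) {p : Pt T} {x : V} {m n : ℕ} (hmn : m ≤ n)
    (h : ∀ k ≤ n, p ≠ .inl (toward p x k)) :
    toward p x m ∉ branch T (toward p x n) (toward p x (n + 1)) := by
  intro hm
  exact notMem_branch hT (toward_adj hT (h m hmn)) (branch_toward_subset hT hmn h hm)

theorem toward_injOn (hT : T.IsTree) {p : Pt T} {x : V} {N : ℕ}
    (h : ∀ k < N, p ≠ .inl (toward p x k)) {m n : ℕ} (hmn : m < n) (hn : n ≤ N) :
    toward p x m ≠ toward p x n := by
  intro heq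
  have := toward_mem_branch hT hmn (fun k hk => h k (by omega))
  rw [← heq] at this
  exact notMem_branch hT (toward_adj hT (h m (by omega))) this

/-- If `s` stayed ahead forever, a fixed walk from `x` to `s` would have to traverse all of the
infinitely many distinct edges on the way. -/
theorem exists_notMem_branch (hT : T.IsTree) {p : Pt T} {x : V}
    (h : ∀ k, p ≠ .inl (toward p x k)) (s : V) :
    ∃ n, s ∉ branch T (toward p x n) (toward p x (n + 1)) := by
  by_contra! hcon
  obtain ⟨w⟩ := hT.connected.preconnected x s
  have hmem : ∀ n, s(toward p x n, toward p x (n + 1)) ∈ w.edges := fun n =>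
    mem_edges_of_separates hT (toward_adj hT (h n)) w
      (toward_notMem_branch hT (Nat.zero_le n) fun k _ => h k) (hcon n)
  have hinj : Function.Injective fun n => s(toward p x n, toward p x (n + 1)) := by
    intro m n hmn
    have hv : Function.Injective (toward p x) := by
      intro a b hab
      by_contra hne
      rcases lt_or_gt_of_ne hne with hlt | hlt
      · exact toward_injOn hT (fun k _ => h k) hlt le_rfl hab
      · exact toward_injOn hT (fun k _ => h k) hlt le_rfl hab.symm
    rcases Sym2.eq_iff.1 hmn with ⟨h1, -⟩ | ⟨h1, h2⟩
    · exact hv h1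
    · have := hv h1; have := hv h2; omega
  exact infinite_univ ((w.edges.finite_toSet.preimage hinj.injOn).subset fun n _ => hmem n)

theorem exists_disjoint_branch (hT : T.IsTree) {p : Pt T} {x : V}
    (h : ∀ k, p ≠ .inl (toward p x k)) {S : Set V} (hS : S.Finite) :
    ∃ n, ∀ s ∈ S, s ∉ branch T (toward p x n) (toward p x (n + 1)) := by
  induction S, hS using Set.Finite.induction_on with
  | empty => exact ⟨0, by simp⟩
  | @insert a S _ _ ih =>
    obtain ⟨n, hn⟩ := ih
    obtain ⟨m, hm⟩ := exists_notMem_branch hT h a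
    refine ⟨max m n, ?_⟩
    rintro s (rfl | hs) hmem
    · exact hm (branch_toward_subset hT (le_max_left m n) (fun k _ => h k) hmem)
    · exact hn s hs (branch_toward_subset hT (le_max_right m n) (fun k _ => h k) hmem)

theorem exists_toward_eq (hT : T.IsTree) (v x : V) : ∃ n, toward (.inl v : Pt T) x n = v := by
  by_contra! hcon
  have h : ∀ k, (.inl v : Pt T) ≠ .inl (toward (.inl v : Pt T) x k) := fun k hk =>
    hcon k (Sum.inl.inj hk).symm
  obtain ⟨n, hn⟩ := exists_notMem_branch hT h v
  exact hn (toward_beyond hT (h n))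

theorem end_ne_inl {ω : Ends (timesK2 T)} {v : V} : (.inr ω : Pt T) ≠ .inl v := by simp

/-- The ray from `(x, i)` to the end `ω`. -/
noncomputable def towardRay (hT : T.IsTree) (ω : Ends (timesK2 T)) (x : V) (i : Fin 2) :
    Ray (timesK2 T) where
  toFun n := (toward (.inr ω) x n, i)
  injective a b hab := by
    have hab := congrArg Prod.fst hab
    by_contra hne
    rcases lt_or_gt_of_ne hne with hlt | hlt
    · exact toward_injOn hT (fun k _ => end_ne_inl) hlt le_rfl hab
    · exact toward_injOn hT (fun k _ => end_ne_inl) hlt le_rfl hab.symm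
  adj n := timesK2_adj_horizontal (toward_adj hT end_ne_inl)

/-- For any finite `S`, some branch along the way avoids `S` and is connected in `G - S`. It
contains tails of both this ray and any given ray of `ω`, so ends of `T × K₂` are determined by
directions in the tree. -/
theorem toEnd_towardRay (hT : T.IsTree) (ω : Ends (timesK2 T)) (x : V) (i : Fin 2) :
    (towardRay hT ω x i).toEnd = ω := by
  obtain ⟨R, hR⟩ := ω.exists_ray
  have h : ∀ k, (.inr ω : Pt T) ≠ .inl (toward (.inr ω) x k) := fun k => end_ne_inl
  refine Eq.trans (Ray.toEnd_eq_iff.2 ?_) hR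
  intro S hS
  obtain ⟨n, hn⟩ := exists_disjoint_branch hT h (hS.image Prod.fst)
  have hb := toward_beyond hT (h n)
  nth_rw 3 [← hR] at hb
  rw [beyond_toEnd_iff hT (toward_adj hT (h n))] at hb
  obtain ⟨N, hN⟩ := hb
  refine ⟨max N (n + 1), fun a ha b hb => ?_⟩
  exact joinedOff_of_mem_branch (fun s hs => hn _ (mem_image_of_mem _ hs))
    (toward_mem_branch hT (le_of_max_le_right ha) fun k _ => h k)
    (hN b (le_of_max_le_left hb)) i (R.toFun b).2

/-- For two ends: if no edge separated them, the direction of both would be the same at every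
vertex. The rays towards them from a common start would then coincide. -/
theorem exists_separating (hT : T.IsTree) {p q : Pt T} (hpq : p ≠ q) :
    ∃ x w, T.Adj x w ∧ ¬ Beyond T x w p ∧ Beyond T x w q := by
  rcases p with x | ω
  · obtain ⟨h1, h2⟩ := next_spec hT hpq.symm
    exact ⟨x, _, h1, notMem_branch hT h1, h2⟩
  rcases q with w | η
  · obtain ⟨h1, h2⟩ := next_spec hT hpq
    exact ⟨_, w, h1.symm, (beyond_swap hT h1.symm _).1 h2, mem_branch_self _ _⟩
  by_contra! hcon
  have hnext : ∀ x, next (.inr η : Pt T) x = next (.inr ω) x := by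
    intro x
    obtain ⟨h1, h2⟩ := next_spec hT (p := (.inr η : Pt T)) (x := x) end_ne_inl
    refine (next_eq hT h1 ?_).symm
    by_contra hno
    exact hcon _ _ h1 hno h2
  obtain ⟨x⟩ := hT.connected.nonempty
  have htow : ∀ n, toward (.inr η : Pt T) x n = toward (.inr ω) x n := by
    intro n
    induction n with
    | zero => rfl
    | succ n ih => rw [toward_succ, toward_succ, ih, hnext]
  apply hpq
  rw [← toEnd_towardRay hT ω x 0, ← toEnd_towardRay hT η x 0]
  congr 2
  simp only [towardRay, htow]

/-- An edge that separates `x` from `p` lies on the way from `x` to `p`. -/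
theorem exists_toward_step (hT : T.IsTree) {p : Pt T} {x z z' : V} (h : T.Adj z z')
    (hx : x ∉ branch T z z') (hp : Beyond T z z' p) :
    ∃ k, toward p x k = z ∧ toward p x (k + 1) = z' := by
  obtain ⟨n, hn⟩ : ∃ n, toward p x n ∈ branch T z z' := by
    rcases p with v | ω
    · obtain ⟨n, hn⟩ := exists_toward_eq hT v x
      exact ⟨n, by rw [hn]; exact hp⟩
    · rw [← toEnd_towardRay hT ω x 0, beyond_toEnd_iff hT h] at hp
      obtain ⟨N, hN⟩ := hp
      exact ⟨N, hN N le_rfl⟩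
  classical
  have hex : ∃ n, toward p x n ∈ branch T z z' := ⟨n, hn⟩
  have h0 : Nat.find hex ≠ 0 := by
    intro h0
    have := Nat.find_spec hex
    rw [h0] at this
    exact hx this
  obtain ⟨k, hk⟩ := Nat.exists_eq_succ_of_ne_zero h0
  have hk1 : toward p x (k + 1) ∈ branch T z z' := by
    have := Nat.find_spec hex
    rwa [hk] at this
  have hk0 : toward p x k ∉ branch T z z' := Nat.find_min hex (by omega)
  have hne : p ≠ .inl (toward p x k) := by
    rintro hpe
    rw [hpe] at hp
    exact hk0 hp
  obtain ⟨h1, h2⟩ := branch_cross hT h hk1 (toward_adj hT hne).symm hk0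
  exact ⟨k, h2, h1⟩

/-- Conversely, the edges on the way from `x` to `p` separate `x` from `p`. -/
theorem toward_step_separates (hT : T.IsTree) {p : Pt T} {x : V} {k : ℕ}
    (h : ∀ j ≤ k, p ≠ .inl (toward p x j)) :
    x ∉ branch T (toward p x k) (toward p x (k + 1)) ∧
      Beyond T (toward p x k) (toward p x (k + 1)) p :=
  ⟨toward_notMem_branch hT (Nat.zero_le k) h, toward_beyond hT (h k le_rfl)⟩

end Tree

section Ladder

variable {V : Type u} {T : SimpleGraph V}

/-! ### The edges of `T × K₂` -/

/-- The copy of the edge `xw` of `T` in the `i`-th copy of `T`. -/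
def hor (x w : V) (i : Fin 2) : Sym2 (V × Fin 2) := s((x, i), (w, i))

/-- The edge that joins `v` to its clone. -/
def rung (v : V) : Sym2 (V × Fin 2) := s((v, 0), (v, 1))

theorem hor_comm (x w : V) (i : Fin 2) : hor x w i = hor w x i := Sym2.eq_swap

theorem hor_inj {x w x' w' : V} {i j : Fin 2} :
    hor x w i = hor x' w' j ↔ i = j ∧ s(x, w) = s(x', w') := by
  simp only [hor, Sym2.eq_iff, Prod.mk.injEq]
  constructor
  · rintro (⟨⟨h1, h2⟩, h3, -⟩ | ⟨⟨h1, h2⟩, h3, -⟩)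
    · exact ⟨h2, Or.inl ⟨h1, h3⟩⟩
    · exact ⟨h2, Or.inr ⟨h1, h3⟩⟩
  · rintro ⟨h, ⟨h1, h2⟩ | ⟨h1, h2⟩⟩
    · exact Or.inl ⟨⟨h1, h⟩, h2, h⟩
    · exact Or.inr ⟨⟨h1, h⟩, h2, h⟩

theorem rung_inj {v w : V} : rung v = rung w ↔ v = w := by
  simp [rung]

theorem rung_ne_hor {v x w : V} {i : Fin 2} : rung v ≠ hor x w i := by
  simp only [rung, hor, Ne, Sym2.eq_iff, Prod.mk.injEq]
  rintro (⟨⟨-, h⟩, -, h'⟩ | ⟨⟨-, h⟩, -, h'⟩) <;> exact absurd (h.trans h'.symm) (by decide)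

theorem hor_mem_edgeSet {x w : V} {i : Fin 2} :
    hor x w i ∈ (timesK2 T).edgeSet ↔ T.Adj x w := by
  simp [hor]

theorem rung_mem_edgeSet (v : V) : rung v ∈ (timesK2 T).edgeSet := by
  simp [rung]

theorem edge_cases {e : Sym2 (V × Fin 2)} (he : e ∈ (timesK2 T).edgeSet) :
    (∃ x w i, T.Adj x w ∧ e = hor x w i) ∨ ∃ v, e = rung v := by
  induction e with | _ a b =>
  obtain ⟨x, i⟩ := a
  obtain ⟨w, j⟩ := b
  rw [SimpleGraph.mem_edgeSet, timesK2_adj] at he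
  rcases he with ⟨h1, rfl⟩ | ⟨h1, rfl⟩
  · exact Or.inl ⟨x, w, i, h1, rfl⟩
  · refine Or.inr ⟨x, ?_⟩
    have : (i = 0 ∧ j = 1) ∨ (i = 1 ∧ j = 0) := by
      simp only at h1; omega
    rcases this with ⟨rfl, rfl⟩ | ⟨rfl, rfl⟩
    · rfl
    · exact Sym2.eq_swap

/-! ### Ladders, terminals and connections in the tree -/

/-- The edge set of the ladder over the path in `T` that joins the vertices or ends `p` and `q`,
without the rungs at inner vertices. -/
def ladder (p q : Pt T) : Set (Sym2 (V × Fin 2)) :=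
  {e | (∃ x w i, T.Adj x w ∧ ¬ Beyond T x w p ∧ Beyond T x w q ∧ e = hor x w i) ∨
    ∃ v, e = rung v ∧ (p = .inl v ∨ q = .inl v)}

theorem hor_mem_ladder (hT : T.IsTree) {p q : Pt T} {x w : V} {i : Fin 2} (h : T.Adj x w) :
    hor x w i ∈ ladder p q ↔ ¬ (Beyond T x w p ↔ Beyond T x w q) := by
  constructor
  · rintro (⟨x', w', j, h', hp, hq, he⟩ | ⟨v, he, -⟩)
    · rcases Sym2.eq_iff.1 (hor_inj.1 he).2 with ⟨rfl, rfl⟩ | ⟨rfl, rfl⟩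
      · tauto
      · rw [beyond_swap hT h', beyond_swap hT h']; tauto
    · exact absurd he.symm rung_ne_hor
  · intro hne
    by_cases hp : Beyond T x w p
    · refine Or.inl ⟨w, x, i, h.symm, ?_, ?_, hor_comm x w i⟩
      · rw [beyond_swap hT h]; tauto
      · rw [beyond_swap hT h]; tauto
    · exact Or.inl ⟨x, w, i, h, hp, by tauto, rfl⟩

theorem rung_mem_ladder {p q : Pt T} {v : V} :
    rung v ∈ ladder p q ↔ p = .inl v ∨ q = .inl v := by
  constructor
  · rintro (⟨x, w, i, -, -, -, he⟩ | ⟨w, he, h⟩)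
    · exact absurd he rung_ne_hor
    · rwa [rung_inj.1 he]
  · exact fun h => Or.inr ⟨v, rfl, h⟩

theorem ladder_subset_edgeSet (p q : Pt T) : ladder p q ⊆ (timesK2 T).edgeSet := by
  rintro e (⟨x, w, i, h, -, -, rfl⟩ | ⟨v, rfl, -⟩)
  · exact hor_mem_edgeSet.2 h
  · exact rung_mem_edgeSet v

theorem ladder_comm (hT : T.IsTree) (p q : Pt T) : ladder p q = ladder q p := by
  ext e
  constructor <;> intro he <;> rcases edge_cases (ladder_subset_edgeSet _ _ he) with
    ⟨x, w, i, h, rfl⟩ | ⟨v, rfl⟩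
  · rw [hor_mem_ladder hT h] at he ⊢; tauto
  · rw [rung_mem_ladder] at he ⊢; tauto
  · rw [hor_mem_ladder hT h] at he ⊢; tauto
  · rw [rung_mem_ladder] at he ⊢; tauto

/-- `p` is a vertex in `R` or an end in `Ψ`. -/
def IsTerm (R : Set V) (Ψ : Set (Ends (timesK2 T))) (p : Pt T) : Prop :=
  Sum.elim (· ∈ R) (· ∈ Ψ) p

theorem IsTerm.mono {R R' : Set V} (h : R ⊆ R') {Ψ : Set (Ends (timesK2 T))} {p : Pt T}
    (hp : IsTerm R Ψ p) : IsTerm R' Ψ p := by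
  rcases p with v | ω
  · exact h hp
  · exact hp

/-- No edge outside `F` separates `p` from `q`. -/
def Conn (F : Set (Sym2 V)) (p q : Pt T) : Prop :=
  ∀ x w, T.Adj x w → s(x, w) ∉ F → (Beyond T x w p ↔ Beyond T x w q)

theorem Conn.refl (F : Set (Sym2 V)) (p : Pt T) : Conn F p p := fun _ _ _ _ => Iff.rfl

theorem Conn.symm {F : Set (Sym2 V)} {p q : Pt T} (h : Conn F p q) : Conn F q p :=
  fun x w hxw hF => (h x w hxw hF).symm

theorem Conn.trans {F : Set (Sym2 V)} {p q r : Pt T} (h : Conn F p q) (h' : Conn F q r) :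
    Conn F p r := fun x w hxw hF => (h x w hxw hF).trans (h' x w hxw hF)

theorem Conn.mono {F F' : Set (Sym2 V)} (hF : F ⊆ F') {p q : Pt T} (h : Conn F p q) :
    Conn F' p q := fun x w hxw hn => h x w hxw fun hm => hn (hF hm)

theorem Conn.of_mem {F : Set (Sym2 V)} {x w : V} (h : T.Adj x w) (hF : s(x, w) ∈ F) :
    Conn F (.inl x : Pt T) (.inl w) := by
  intro y z hyz hn
  have hne : s(x, w) ≠ s(y, z) := fun heq => hn (heq ▸ hF)
  exact ⟨fun hx => mem_branch_of_adj hx h hne,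
    fun hw => mem_branch_of_adj hw h.symm (by rwa [Sym2.eq_swap])⟩

theorem Conn.mem_of_adj (hT : T.IsTree) {F : Set (Sym2 V)} {x w : V} (h : T.Adj x w)
    (hc : Conn F (.inl x : Pt T) (.inl w)) : s(x, w) ∈ F := by
  by_contra hF
  exact notMem_branch hT h ((hc x w h hF).2 (mem_branch_self x w))

/-! ### Star cuts -/

/-- `b` consists of the rungs at `S` and of one copy of each edge of `T` that leaves the convex
set `S`. -/
def IsStar (T : SimpleGraph V) (S : Set V) (b : Set (Sym2 (V × Fin 2))) : Prop :=
  (∀ v, rung v ∈ b ↔ v ∈ S) ∧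
  (∀ x w i, T.Adj x w → (x ∈ S ↔ w ∈ S) → hor x w i ∉ b) ∧
  ∀ x w, T.Adj x w → x ∈ S → w ∉ S →
    (∃ i, ∀ j, hor x w j ∈ b ↔ j = i) ∧ ∀ s ∈ S, s ∉ branch T x w

/-- One side of a star cut. -/
def starSide (T : SimpleGraph V) (S : Set V) (c : V → V → Fin 2) : Set (V × Fin 2) :=
  {a | (a.1 ∈ S ∧ a.2 = 0) ∨
    (a.1 ∉ S ∧ ∃ x ∈ S, ∃ w ∉ S, T.Adj x w ∧ a.1 ∈ branch T x w ∧ c x w = 1)}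

section

variable (hT : T.IsTree) {S : Set V} (c : V → V → Fin 2)
  (hS : ∀ x w, T.Adj x w → x ∈ S → w ∉ S → ∀ s ∈ S, s ∉ branch T x w)

theorem mem_starSide_of_mem {v : V} {i : Fin 2} (hv : v ∈ S) :
    (v, i) ∈ starSide T S c ↔ i = 0 := by
  simp [starSide, hv]

include hT hS in
-- By convexity a vertex outside `S` lies beyond exactly one edge that leaves `S`, so the choice
-- attached to that edge alone decides its side.
theorem mem_starSide_of_notMem {v : V} {i : Fin 2} {x w : V} (hx : x ∈ S) (hw : w ∉ S)
    (h : T.Adj x w) (hv : v ∈ branch T x w) : (v, i) ∈ starSide T S c ↔ c x w = 1 := by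
  have hvS : v ∉ S := fun hvS => hS x w h hx hw v hvS hv
  simp only [starSide, mem_ofPred_eq, hvS, false_and, not_false_eq_true, true_and, false_or]
  constructor
  · rintro ⟨x', hx', w', hw', h', hv', hc⟩
    have h1 := hS x w h hx hw x' hx'
    have h2 : w ∈ branch T x' w' := by
      by_contra hcon
      have := branch_subset hT h'.symm ((mem_branch_swap hT h' w).2 hcon)
        (x := x) (w := w) (x' := w') (w' := x') ?_ hv
      · exact (mem_branch_swap hT h' v).1 this hv'
      · intro hw'B
        -- otherwise `x'` would lie on the far side of the edge `xw`
        exact h1 (by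
          by_contra hcon2
          exact hcon (by
            have := branch_cross hT h hw'B h'.symm hcon2
            rw [← this.1]; exact mem_branch_self _ _))
    have h3 := branch_cross hT h' h2 h.symm (hS x' w' h' hx' hw' x hx)
    rw [h3.1, h3.2]; exact hc
  · intro hc
    exact ⟨x, hx, w, hw, h, hv, hc⟩

include hT hS in
-- The side consists of level 0 over `S` and, for each leaving edge with choice 1, both levels of
-- the branch beyond. Such an edge is then cut at level 1; with choice 0 the branch is on the other
-- side and the cut copy is at level 0.
theorem isStar_cutOf : IsStar T S (cutOf (timesK2 T) (starSide T S c)) ∧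
    ∀ x w, T.Adj x w → x ∈ S → w ∉ S →
      ∀ i, hor x w i ∈ cutOf (timesK2 T) (starSide T S c) ↔ i = c x w := by
  have hlev : ∀ x w, T.Adj x w → x ∈ S → w ∉ S →
      ∀ i, hor x w i ∈ cutOf (timesK2 T) (starSide T S c) ↔ i = c x w := by
    intro x w h hx hw i
    rw [hor, mem_cutOf, mem_starSide_of_mem c hx,
      mem_starSide_of_notMem hT c hS hx hw h (mem_branch_self x w)]
    have : (timesK2 T).Adj (x, i) (w, i) := timesK2_adj_horizontal h
    simp only [this, true_and]
    generalize c x w = k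
    clear this
    revert i k; decide
  have hout : ∀ v ∉ S, ∀ i j, (v, i) ∈ starSide T S c ↔ (v, j) ∈ starSide T S c := by
    intro v hv i j
    simp [starSide, hv]
  refine ⟨⟨fun v => ?_, fun x w i h hxw => ?_, fun x w h hx hw =>
    ⟨⟨_, hlev x w h hx hw⟩, hS x w h hx hw⟩⟩, hlev⟩
  · rw [rung, mem_cutOf]
    by_cases hv : v ∈ S
    · simp [mem_starSide_of_mem c hv, hv]
    · have := hout v hv 0 1
      simp only [hv, iff_false]; tauto
  · rw [hor, mem_cutOf]
    by_cases hx : x ∈ S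
    · simp [mem_starSide_of_mem c hx, mem_starSide_of_mem c (hxw.1 hx)]
    · have hw : w ∉ S := fun hw => hx (hxw.2 hw)
      have : (x, i) ∈ starSide T S c ↔ (w, i) ∈ starSide T S c := by
        simp only [starSide, mem_ofPred_eq, hx, hw, false_and, not_false_eq_true, true_and,
          false_or]
        have key : ∀ a b, T.Adj a b → a ∉ S → b ∉ S →
            (∃ x ∈ S, ∃ w ∉ S, T.Adj x w ∧ a ∈ branch T x w ∧ c x w = 1) →
            ∃ x ∈ S, ∃ w ∉ S, T.Adj x w ∧ b ∈ branch T x w ∧ c x w = 1 := by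
          rintro a b hab ha hb ⟨y, hy, z, hz, hyz, hB, hc⟩
          refine ⟨y, hy, z, hz, hyz, ?_, hc⟩
          by_contra hbB
          rw [(branch_cross hT hyz hB hab hbB).2] at hb
          exact hb hy
        exact ⟨key x w h hx hw, key w x h.symm hw hx⟩
      tauto

end

/-- Where the way from `u` to `ω` leaves `S`, convexity keeps all of `S` behind. The two clones of
the first vertex outside `S` then separate `ω` from the cut. -/
theorem IsStar.avoidsEnd (hT : T.IsTree) {S : Set V} {b : Set (Sym2 (V × Fin 2))}
    (hb : IsStar T S b) (hbE : b ⊆ (timesK2 T).edgeSet) {ω : Ends (timesK2 T)} {u : V}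
    (hu : u ∈ S) (hω : ∃ n, toward (.inr ω : Pt T) u n ∉ S) : AvoidsEnd (timesK2 T) b ω := by
  classical
  obtain ⟨n, hn⟩ : ∃ n, Nat.find hω = n + 1 := by
    refine Nat.exists_eq_succ_of_ne_zero fun h0 => ?_
    have := Nat.find_spec hω
    rw [h0] at this
    exact this hu
  set a := toward (.inr ω : Pt T) u with ha
  have h1 : a n ∈ S := by
    have := Nat.find_min hω (m := n) (by omega)
    exact not_not.1 this
  have h2 : a (n + 1) ∉ S := by rw [← hn]; exact Nat.find_spec hω
  have hadj : ∀ k, T.Adj (a k) (a (k + 1)) := fun k => toward_adj hT end_ne_inl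
  have hdisj := (hb.2.2 _ _ (hadj n) h1 h2).2
  have hsub : branch T (a (n + 1)) (a (n + 2)) ⊆ branch T (a n) (a (n + 1)) :=
    branch_toward_subset hT (Nat.le_succ n) fun k _ => end_ne_inl
  -- The vertex `a (n + 1)` itself may be incident with the cut, so it is deleted and the component
  -- of `ω` lies in the next branch.
  refine ⟨{a (n + 1)} ×ˢ Set.univ, toFinite _, fun e he v hv hvC => ?_⟩
  have hvB : v.1 ∈ branch T (a (n + 1)) (a (n + 2)) := by
    rw [← toEnd_towardRay hT ω u 0, mem_endComponent_iff (toFinite _)] at hvC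
    obtain ⟨N, hN⟩ := hvC
    refine (hN (max N (n + 2)) (le_max_left _ _)).symm.mem_of_closed
      (W := {z : V × Fin 2 | z.1 ∈ branch T (a (n + 1)) (a (n + 2))}) ?_ ?_
    · exact toward_mem_branch hT (m := n + 1)
        (lt_of_lt_of_le (by omega) (le_max_right N (n + 2))) fun k _ => end_ne_inl
    · intro y z _ hz hyz hy
      by_contra hzB
      exact hz ⟨(branch_cross_timesK2 hT (hadj _) hy hyz hzB).2, trivial⟩
  have hnotS : ∀ s ∈ S, s ∉ branch T (a (n + 1)) (a (n + 2)) := fun s hs h => hdisj s hs (hsub h)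
  have hstep : ∀ x w, T.Adj x w → x ∈ S → w ∉ branch T (a (n + 1)) (a (n + 2)) := by
    intro x w hxw hx hw
    have := branch_cross hT (hadj (n + 1)) hw hxw.symm (hnotS x hx)
    rw [this.2] at hx
    exact h2 hx
  rcases edge_cases (hbE he) with ⟨x, w, i, hxw, rfl⟩ | ⟨y, rfl⟩
  · have hxwS : ¬ (x ∈ S ↔ w ∈ S) := fun h => hb.2.1 x w i hxw h he
    rw [hor, Sym2.mem_iff] at hv
    by_cases hx : x ∈ S
    · rcases hv with rfl | rfl
      · exact hnotS _ hx hvB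
      · exact hstep _ _ hxw hx hvB
    · have hw : w ∈ S := by
          by_contra hw; exact hxwS ⟨fun h' => absurd h' hx, fun h' => absurd h' hw⟩
      rcases hv with rfl | rfl
      · exact hstep _ _ hxw.symm hw hvB
      · exact hnotS _ hw hvB
  · have hy := (hb.1 y).1 he
    rw [rung, Sym2.mem_iff] at hv
    rcases hv with rfl | rfl <;> exact hnotS _ hy hvB

/-- If the way to `ω` stayed in `S`, the rungs along it would all be in the cut and would accumulate
at `ω`. -/
theorem IsStar.exists_toward_notMem (hT : T.IsTree) {S : Set V} {b : Set (Sym2 (V × Fin 2))}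
    (hb : IsStar T S b) {ω : Ends (timesK2 T)} (hω : AvoidsEnd (timesK2 T) b ω) (u : V) :
    ∃ n, toward (.inr ω : Pt T) u n ∉ S := by
  by_contra! hcon
  obtain ⟨S', hS', h⟩ := hω
  have hfin : ∀ i, ∃ N, ∀ n ≥ N, ((toward (.inr ω : Pt T) u n, i) : V × Fin 2) ∈
      endComponent (timesK2 T) S' ω := by
    intro i
    obtain ⟨N, hN⟩ := (Ray.equivalent_equivalence (timesK2 T)).refl (towardRay hT ω u i) S' hS'
    refine ⟨N, fun n hn => ?_⟩
    rw [← toEnd_towardRay hT ω u i, mem_endComponent_iff hS', toEnd_towardRay hT ω u i]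
    exact ⟨N, fun m hm => hN n hn m hm⟩
  obtain ⟨N, hN⟩ := hfin 0
  exact h _ ((hb.1 _).2 (hcon N)) _ (by simp [rung]) (hN N le_rfl)

/-! ### The painting property -/

variable {Ψ : Set (Ends (timesK2 T))}

/-- The edges of `T` with both copies in `P`. -/
def bothIn (P : Set (Sym2 (V × Fin 2))) : Set (Sym2 V) :=
  {t | ∀ x w, t = s(x, w) → ∀ i, hor x w i ∈ P}

theorem mem_bothIn {P : Set (Sym2 (V × Fin 2))} {x w : V} :
    s(x, w) ∈ bothIn P ↔ ∀ i, hor x w i ∈ P := by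
  constructor
  · intro h; exact h x w rfl
  · intro h y z heq i
    rw [show hor y z i = hor x w i from hor_inj.2 ⟨rfl, heq.symm⟩]
    exact h i

/-- Let `S` be what `u` reaches through edges with both copies in `P`. If no terminal is reached, no
rung at `S` is in `P` and every edge leaving `S` has a copy outside `P`; choosing one copy for each
gives the star. A ray of `S` towards an end in `Ψ` would connect `u` to that end, so the star is
bounded. -/
theorem exists_terminal_or_star (hT : T.IsTree) (Ψ : Set (Ends (timesK2 T)))
    (P : Set (Sym2 (V × Fin 2))) (u : V) :
    (∃ p, IsTerm {v | rung v ∈ P} Ψ p ∧ Conn (bothIn P) (.inl u) p) ∨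
    ∃ W, IsStar T {v | Conn (bothIn P) (.inl u : Pt T) (.inl v)} (cutOf (timesK2 T) W) ∧
      Disjoint (cutOf (timesK2 T) W) P ∧ ∀ ω ∈ Ψ, AvoidsEnd (timesK2 T) (cutOf (timesK2 T) W) ω := by
  classical
  by_cases hterm : ∃ p, IsTerm {v | rung v ∈ P} Ψ p ∧ Conn (bothIn P) (.inl u) p
  · exact Or.inl hterm
  refine Or.inr ?_
  push Not at hterm
  set S : Set V := {v | Conn (bothIn P) (.inl u : Pt T) (.inl v)} with hSdef
  have hbd : ∀ x w, T.Adj x w → x ∈ S → w ∉ S → s(x, w) ∉ bothIn P := by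
    intro x w h hx hw hF
    exact hw (Conn.trans hx (Conn.of_mem h hF))
  have hconv : ∀ x w, T.Adj x w → x ∈ S → w ∉ S → ∀ s ∈ S, s ∉ branch T x w := by
    intro x w h hx hw s hs hsB
    have := (Conn.trans (Conn.symm hx) hs) x w h (hbd x w h hx hw)
    exact notMem_branch hT h (this.2 hsB)
  have hlevel : ∀ x w, ∃ i : Fin 2, T.Adj x w → x ∈ S → w ∉ S → hor x w i ∉ P := by
    intro x w
    by_cases h : T.Adj x w ∧ x ∈ S ∧ w ∉ S
    · have := hbd x w h.1 h.2.1 h.2.2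
      rw [mem_bothIn] at this
      push Not at this
      obtain ⟨i, hi⟩ := this
      exact ⟨i, fun _ _ _ => hi⟩
    · exact ⟨0, fun h1 h2 h3 => absurd ⟨h1, h2, h3⟩ h⟩
  choose c hc using hlevel
  obtain ⟨hstar, hlev⟩ := isStar_cutOf hT c hconv
  refine ⟨starSide T S c, hstar, ?_, fun ω hω => ?_⟩
  · rw [disjoint_left]
    intro e he heP
    rcases edge_cases he.1 with ⟨x, w, i, h, rfl⟩ | ⟨v, rfl⟩
    · have hne : ¬ (x ∈ S ↔ w ∈ S) := fun hS => hstar.2.1 x w i h hS he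
      by_cases hx : x ∈ S
      · have hw : w ∉ S := fun h' => hne ⟨fun _ => h', fun _ => hx⟩
        rw [hlev x w h hx hw] at he
        rw [he] at heP
        exact hc x w h hx hw heP
      · have hw : w ∈ S := by
          by_contra hw; exact hne ⟨fun h' => absurd h' hx, fun h' => absurd h' hw⟩
        rw [hor_comm] at he heP
        rw [hlev w x h.symm hw hx] at he
        rw [he] at heP
        exact hc w x h.symm hw hx heP
    · exact hterm (.inl v) heP ((hstar.1 v).1 he)
  · refine hstar.avoidsEnd hT (fun e he => he.1) (u := u) (Conn.refl _ _) ?_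
    by_contra! hcon
    refine hterm (.inr ω) hω fun x w h hF => ?_
    have hu : ∀ n, (toward (.inr ω : Pt T) u n ∈ branch T x w ↔ u ∈ branch T x w) :=
      fun n => (hcon n x w h hF).symm
    change u ∈ branch T x w ↔ _
    constructor
    · intro hux
      rw [← toEnd_towardRay hT ω u 0]
      exact ⟨_, rfl, 0, fun n _ => (hu n).2 hux⟩
    · intro hω'
      rw [← toEnd_towardRay hT ω u 0, beyond_toEnd_iff hT h] at hω'
      obtain ⟨N, hN⟩ := hω'
      exact (hu N).1 (hN N le_rfl)

theorem cutOf_branch (hT : T.IsTree) {x w : V} (h : T.Adj x w) :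
    cutOf (timesK2 T) {a | a.1 ∈ branch T x w} = {hor x w 0, hor x w 1} := by
  ext e
  constructor
  · rintro ⟨he, a, ha, b, hb, rfl⟩
    obtain ⟨h1, h2⟩ := branch_cross_timesK2 hT h ha he hb
    have hne : a.1 ≠ b.1 := by rw [h1, h2]; exact h.symm.ne
    have h3 : a.2 = b.2 := by
      rcases timesK2_adj.1 he with ⟨-, h3⟩ | ⟨-, h3⟩
      · exact h3
      · exact absurd h3 hne
    obtain ⟨a1, a2⟩ := a
    obtain ⟨b1, b2⟩ := b
    simp only at h1 h2 h3
    subst h1; subst h2; subst h3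
    have : s((a1, a2), (b1, a2)) = hor b1 a1 a2 := Sym2.eq_swap
    rw [this]
    have : a2 = 0 ∨ a2 = 1 := by omega
    rcases this with rfl | rfl <;> simp
  · have hmem : ∀ i, hor x w i ∈ cutOf (timesK2 T) {a | a.1 ∈ branch T x w} := fun i =>
      mem_cutOf.2 ⟨timesK2_adj_horizontal h, Or.inr ⟨mem_branch_self x w, notMem_branch hT h⟩⟩
    rintro (rfl | rfl)
    · exact hmem 0
    · exact hmem 1

/-- For a horizontal edge whose other copy is outside `P`, the pair of copies is a cut. Otherwise
grow from both ends of the edge: two terminals give a ladder, one failure gives a star. For a rung,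
its own vertex is one terminal and growing from it supplies the other. The shape of the cut is
recorded for later use with bonds. -/
theorem exists_ladder_or_cut (hT : T.IsTree) (Ψ : Set (Ends (timesK2 T)))
    {e : Sym2 (V × Fin 2)} (he : e ∈ (timesK2 T).edgeSet) {P : Set (Sym2 (V × Fin 2))}
    (heP : e ∉ P) :
    (∃ p q, p ≠ q ∧ IsTerm Set.univ Ψ p ∧ IsTerm Set.univ Ψ q ∧ e ∈ ladder p q ∧
      ladder p q ⊆ insert e P) ∨
    ∃ W, e ∈ cutOf (timesK2 T) W ∧ Disjoint (cutOf (timesK2 T) W) P ∧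
      (∀ ω ∈ Ψ, AvoidsEnd (timesK2 T) (cutOf (timesK2 T) W) ω) ∧
      ((∃ S, IsStar T S (cutOf (timesK2 T) W)) ∨
        ∃ x w, T.Adj x w ∧ cutOf (timesK2 T) W = {hor x w 0, hor x w 1}) := by
  rcases edge_cases he with ⟨x, w, i, h, rfl⟩ | ⟨v, rfl⟩
  · by_cases hother : ∃ j, j ≠ i ∧ hor x w j ∉ P
    · obtain ⟨j, hji, hj⟩ := hother
      refine Or.inr ⟨{a | a.1 ∈ branch T x w}, ?_, ?_, ?_, Or.inr ⟨x, w, h, cutOf_branch hT h⟩⟩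
      · rw [cutOf_branch hT h]
        have : i = 0 ∨ i = 1 := by omega
        rcases this with rfl | rfl <;> simp
      · rw [cutOf_branch hT h, disjoint_left]
        have hall : ∀ k, hor x w k ∉ P := by
          intro k
          have : k = i ∨ k = j := by omega
          rcases this with rfl | rfl
          · exact heP
          · exact hj
        rintro f (rfl | rfl)
        · exact hall 0
        · exact hall 1
      · intro ω _
        rw [cutOf_branch hT h]
        exact avoidsEnd_of_finite (by simp) ω
    push Not at hother
    have hF : s(x, w) ∉ bothIn P := fun hF => heP (mem_bothIn.1 hF i)
    -- The growth stops at the edge `xw`, so the star uses one of its copies, and `e` is the only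
    -- copy outside `P`.
    have hcut : ∀ y z, s(x, w) = s(y, z) → T.Adj y z →
        ∀ W, IsStar T {v | Conn (bothIn P) (.inl y : Pt T) (.inl v)} (cutOf (timesK2 T) W) →
        Disjoint (cutOf (timesK2 T) W) P → hor x w i ∈ cutOf (timesK2 T) W := by
      intro y z heq hyz W hW hdisj
      have hz : ¬ Conn (bothIn P) (.inl y : Pt T) (.inl z) := fun hc =>
        hF (heq ▸ Conn.mem_of_adj hT hyz hc)
      obtain ⟨⟨k, hk⟩, -⟩ := hW.2.2 y z hyz (Conn.refl _ _) hz
      have hkm := (hk k).2 rfl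
      have hhor : ∀ j, hor x w j = hor y z j := fun j => hor_inj.2 ⟨rfl, heq⟩
      have hki : k = i := by
        by_contra hne
        exact disjoint_left.1 hdisj hkm (hhor k ▸ hother k hne)
      rw [hhor i, ← hki]
      exact hkm
    rcases exists_terminal_or_star hT Ψ P x with ⟨p, hp, hxp⟩ | ⟨W, hW, hdisj, hav⟩
    · rcases exists_terminal_or_star hT Ψ P w with ⟨q, hq, hwq⟩ | ⟨W, hW, hdisj, hav⟩
      · have hbp : ¬ Beyond T x w p := fun hb => notMem_branch hT h ((hxp x w h hF).2 hb)
        have hbq : Beyond T x w q := (hwq x w h hF).1 (mem_branch_self x w)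
        refine Or.inl ⟨p, q, fun hpq => hbp (hpq ▸ hbq), hp.mono (subset_univ _),
          hq.mono (subset_univ _), (hor_mem_ladder hT h).2 (by tauto), ?_⟩
        intro f hf
        rcases edge_cases (ladder_subset_edgeSet _ _ hf) with ⟨y, z, j, hyz, rfl⟩ | ⟨v, rfl⟩
        · by_cases heq : s(x, w) = s(y, z)
          · rw [show hor y z j = hor x w j from hor_inj.2 ⟨rfl, heq.symm⟩]
            by_cases hji : j = i
            · rw [hji]; exact mem_insert _ _
            · exact Or.inr (hother j hji)
          · by_cases hyF : s(y, z) ∈ bothIn P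
            · exact Or.inr (mem_bothIn.1 hyF j)
            · exfalso
              rw [hor_mem_ladder hT hyz] at hf
              have hxw := Conn.of_mem (F := {s(x, w)}) h rfl y z hyz (fun h => heq h.symm)
              exact hf ((hxp y z hyz hyF).symm.trans (hxw.trans (hwq y z hyz hyF)))
        · rcases rung_mem_ladder.1 hf with rfl | rfl
          · exact Or.inr hp
          · exact Or.inr hq
      · exact Or.inr ⟨W, hcut w x Sym2.eq_swap h.symm W hW hdisj, hdisj, hav, Or.inl ⟨_, hW⟩⟩
    · exact Or.inr ⟨W, hcut x w rfl h W hW hdisj, hdisj, hav, Or.inl ⟨_, hW⟩⟩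
  · rcases exists_terminal_or_star hT Ψ P v with ⟨p, hp, hvp⟩ | ⟨W, hW, hdisj, hav⟩
    · refine Or.inl ⟨.inl v, p, ?_, trivial, hp.mono (subset_univ _),
        rung_mem_ladder.2 (Or.inl rfl), ?_⟩
      · rintro rfl; exact heP hp
      · intro f hf
        rcases edge_cases (ladder_subset_edgeSet _ _ hf) with ⟨y, z, j, hyz, rfl⟩ | ⟨w, rfl⟩
        · rw [hor_mem_ladder hT hyz] at hf
          by_cases hyF : s(y, z) ∈ bothIn P
          · exact Or.inr (mem_bothIn.1 hyF j)
          · exact absurd (hvp y z hyz hyF) hf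
        · rcases rung_mem_ladder.1 hf with h | rfl
          · rw [Sum.inl.inj h]; exact mem_insert _ _
          · exact Or.inr hp
    · exact Or.inr ⟨W, (hW.1 v).2 (Conn.refl _ _), hdisj, hav, Or.inl ⟨_, hW⟩⟩

/-! ### Ladders meet star cuts in no or two edges -/

/-- The edges of the star cut `b` at which the ladder, traversed from `p` to `q`, enters `S`. -/
def entering (S : Set V) (b : Set (Sym2 (V × Fin 2))) (p q : Pt T) : Set (Sym2 (V × Fin 2)) :=
  {e | e ∈ b ∧ ((∃ v, p = .inl v ∧ e = rung v) ∨ ∃ x w i, T.Adj x w ∧ ¬ Beyond T x w p ∧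
    Beyond T x w q ∧ x ∉ S ∧ w ∈ S ∧ e = hor x w i)}

/-- Where the path enters `S`, convexity puts all of `S` ahead and `p` behind. So two entries must
use the same edge of `T`, and a star contains only one copy of it; a rung at `p` counts as an entry
and excludes any other. -/
theorem entering_subsingleton (hT : T.IsTree) {S : Set V} {b : Set (Sym2 (V × Fin 2))}
    (hb : IsStar T S b) (p q : Pt T) : (entering S b p q).Subsingleton := by
  have hout : ∀ x w, T.Adj x w → x ∉ S → w ∈ S → ∀ s ∈ S, s ∉ branch T w x :=
    fun x w h hx hw => (hb.2.2 w x h.symm hw hx).2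
  rintro e ⟨heb, h⟩ e' ⟨heb', h'⟩
  rcases h with ⟨v, rfl, rfl⟩ | ⟨x, w, i, h, hp, hq, hx, hw, rfl⟩
  · rcases h' with ⟨v', hv', rfl⟩ | ⟨x, w, i, h, hp, hq, hx, hw, rfl⟩
    · rw [Sum.inl.inj hv']
    · exact absurd ((beyond_swap hT h _).2 hp) (hout x w h hx hw v ((hb.1 v).1 heb))
  · rcases h' with ⟨v', rfl, rfl⟩ | ⟨x', w', i', h', hp', hq', hx', hw', rfl⟩
    · exact absurd ((beyond_swap hT h _).2 hp) (hout x w h hx hw v' ((hb.1 v').1 heb'))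
    · have h1 : w ∈ branch T x' w' := by
        by_contra hcon
        exact hout x' w' h' hx' hw' w hw ((mem_branch_swap hT h' w).2 hcon)
      have h2 : w' ∈ branch T x w := by
        by_contra hcon
        exact hout x w h hx hw w' hw' ((mem_branch_swap hT h w').2 hcon)
      have h3 : w = w' ∧ x = x' := by
        by_cases h4 : x ∈ branch T x' w'
        · by_cases h5 : x' ∈ branch T x w
          · have := branch_subset hT h' (x := w) (w := x) h4
              (fun h6 => (mem_branch_swap hT h x').1 h6 h5)
            exact absurd (Beyond.mono this ((beyond_swap hT h p).2 hp)) hp'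
          · obtain ⟨h6, h7⟩ := branch_cross hT h h2 h'.symm h5
            exact ⟨h6.symm, h7.symm⟩
        · exact branch_cross hT h' h1 h.symm h4
      obtain ⟨rfl, rfl⟩ := h3
      obtain ⟨⟨k, hk⟩, -⟩ := hb.2.2 w x h.symm hw hx
      rw [hor_comm] at heb heb'
      rw [(hk i).1 heb, (hk i').1 heb']

/-- The hypothesis `hpath` says that `s` lies on the path from `p` to `q`. Walking back from `s` to
`p`, either `p` is a vertex of `S` and contributes its rung, or the walk leaves `S`; for an end this
uses that the star is bounded. -/
theorem entering_nonempty (hT : T.IsTree) {S : Set V} {b : Set (Sym2 (V × Fin 2))}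
    (hb : IsStar T S b) (hΨ : ∀ ω ∈ Ψ, AvoidsEnd (timesK2 T) b ω) {p q : Pt T}
    (hp : IsTerm Set.univ Ψ p) {s : V} (hs : s ∈ S)
    (hpath : ∀ x w, T.Adj x w → Beyond T x w p → Beyond T x w q → s ∈ branch T x w) :
    (entering S b p q).Nonempty := by
  classical
  by_cases hpS : ∃ v ∈ S, p = .inl v
  · obtain ⟨v, hv, rfl⟩ := hpS
    exact ⟨rung v, (hb.1 v).2 hv, Or.inl ⟨v, rfl, rfl⟩⟩
  push Not at hpS
  have hex : ∃ n, toward p s n ∉ S := by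
    rcases p with v | ω
    · obtain ⟨n, hn⟩ := exists_toward_eq hT v s
      exact ⟨n, by rw [hn]; exact fun hv => hpS v hv rfl⟩
    · exact hb.exists_toward_notMem hT (hΨ ω hp) s
  obtain ⟨n, hn⟩ : ∃ n, Nat.find hex = n + 1 := by
    refine Nat.exists_eq_succ_of_ne_zero fun h0 => ?_
    have := Nat.find_spec hex
    rw [h0] at this
    exact this hs
  have hmin : ∀ k ≤ n, toward p s k ∈ S := fun k hk =>
    not_not.1 (Nat.find_min hex (m := k) (by omega))
  have hne : ∀ k ≤ n, p ≠ .inl (toward p s k) := fun k hk => hpS _ (hmin k hk)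
  have h2 : toward p s (n + 1) ∉ S := by rw [← hn]; exact Nat.find_spec hex
  have hadj := toward_adj hT (hne n le_rfl)
  obtain ⟨h3, h4⟩ := toward_step_separates hT hne
  obtain ⟨⟨i, hi⟩, -⟩ := hb.2.2 _ _ hadj (hmin n le_rfl) h2
  refine ⟨hor (toward p s n) (toward p s (n + 1)) i, (hi i).2 rfl, Or.inr ⟨_, _, i, hadj.symm,
    (beyond_swap hT hadj.symm p).1 h4, ?_, h2, hmin n le_rfl, hor_comm _ _ _⟩⟩
  rw [beyond_swap hT hadj]
  exact fun hq => h3 (hpath _ _ hadj h4 hq)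

theorem encard_ladder_inter_star (hT : T.IsTree) {S : Set V} {b : Set (Sym2 (V × Fin 2))}
    (hb : IsStar T S b)
    (hΨ : ∀ ω ∈ Ψ, AvoidsEnd (timesK2 T) b ω) {p q : Pt T} (hpq : p ≠ q)
    (hp : IsTerm Set.univ Ψ p) (hq : IsTerm Set.univ Ψ q) :
    (ladder p q ∩ b).encard = 0 ∨ (ladder p q ∩ b).encard = 2 := by
  rcases (ladder p q ∩ b).eq_empty_or_nonempty with hem | ⟨e, heL, heb⟩
  · exact Or.inl (by rw [hem, encard_empty])
  refine Or.inr ?_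
  -- Both endvertices of an edge that separates `p` from `q` lie on the path between them: no other
  -- edge has them on one side and both `p` and `q` on the other.
  have hon : ∀ {x w y z : V}, T.Adj x w → ¬ Beyond T x w p → Beyond T x w q → T.Adj y z →
      Beyond T y z p → Beyond T y z q → x ∈ branch T y z ∧ w ∈ branch T y z := by
    intro x w y z h h1 h2 h' h3 h4
    have hsame : x ∈ branch T y z ↔ w ∈ branch T y z := by
      refine Conn.of_mem (F := {s(x, w)}) h rfl y z h' fun heq => ?_
      rcases Sym2.eq_iff.1 heq with ⟨rfl, rfl⟩ | ⟨rfl, rfl⟩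
      · exact h1 h3
      · exact (beyond_swap hT h q).1 h4 h2
    by_contra hcon
    have hx : x ∉ branch T y z := by tauto
    have hw : w ∉ branch T y z := by tauto
    by_cases hz : z ∈ branch T x w
    · exact h1 (Beyond.mono (branch_subset hT h hz hx) h3)
    · refine (beyond_swap hT h q).1 (Beyond.mono (branch_subset hT h.symm ?_ hw) h4) h2
      exact (mem_branch_swap hT h z).2 hz
  obtain ⟨s, hs, hpath⟩ : ∃ s ∈ S, ∀ x w, T.Adj x w → Beyond T x w p → Beyond T x w q →
      s ∈ branch T x w := by
    rcases heL with ⟨x, w, i, h, h1, h2, rfl⟩ | ⟨v, rfl, hv⟩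
    · have hne : ¬ (x ∈ S ↔ w ∈ S) := fun hS => hb.2.1 x w i h hS heb
      by_cases hx : x ∈ S
      · exact ⟨x, hx, fun y z h' h3 h4 => (hon h h1 h2 h' h3 h4).1⟩
      · exact ⟨w, by tauto, fun y z h' h3 h4 => (hon h h1 h2 h' h3 h4).2⟩
    · refine ⟨v, (hb.1 v).1 heb, fun x w _ h3 h4 => ?_⟩
      rcases hv with rfl | rfl
      · exact h3
      · exact h4
  obtain ⟨a, ha⟩ := entering_nonempty hT hb hΨ hp hs hpath
  obtain ⟨a', ha'⟩ := entering_nonempty hT hb hΨ hq hs (q := p)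
    fun x w h h1 h2 => hpath x w h h2 h1
  have hset : ladder p q ∩ b = {a, a'} := by
    have h1 := (entering_subsingleton hT hb p q).eq_singleton_of_mem ha
    have h2 := (entering_subsingleton hT hb q p).eq_singleton_of_mem ha'
    rw [← singleton_union, ← h1, ← h2]
    ext f
    constructor
    · rintro ⟨hfL, hfb⟩
      rcases hfL with ⟨x, w, i, h, h1, h2, rfl⟩ | ⟨v, rfl, rfl | rfl⟩
      · have hne : ¬ (x ∈ S ↔ w ∈ S) := fun hS => hb.2.1 x w i h hS hfb
        by_cases hx : x ∈ S
        · refine Or.inr ⟨hfb, Or.inr ⟨w, x, i, h.symm, ?_, ?_, by tauto, hx, hor_comm _ _ _⟩⟩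
          · exact fun hc => (beyond_swap hT h q).1 hc h2
          · exact (beyond_swap hT h p).2 h1
        · exact Or.inl ⟨hfb, Or.inr ⟨x, w, i, h, h1, h2, hx, by tauto, rfl⟩⟩
      · exact Or.inl ⟨hfb, Or.inl ⟨v, rfl, rfl⟩⟩
      · exact Or.inr ⟨hfb, Or.inl ⟨v, rfl, rfl⟩⟩
    · rintro (⟨hfb, h⟩ | ⟨hfb, h⟩)
      · refine ⟨?_, hfb⟩
        rcases h with ⟨v, rfl, rfl⟩ | ⟨x, w, i, h, h1, h2, -, -, rfl⟩
        · exact rung_mem_ladder.2 (Or.inl rfl)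
        · exact Or.inl ⟨x, w, i, h, h1, h2, rfl⟩
      · refine ⟨?_, hfb⟩
        rcases h with ⟨v, rfl, rfl⟩ | ⟨x, w, i, h, h1, h2, -, -, rfl⟩
        · exact rung_mem_ladder.2 (Or.inr rfl)
        · rw [ladder_comm hT]
          exact Or.inl ⟨x, w, i, h, h1, h2, rfl⟩
  rw [hset]
  refine encard_pair ?_
  rintro rfl
  rcases ha.2 with ⟨v, rfl, rfl⟩ | ⟨x, w, i, h, h1, h2, hx, hw, rfl⟩
  · rcases ha'.2 with ⟨v', rfl, hv⟩ | ⟨x, w, i, h, h1, h2, -, -, he⟩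
    · exact hpq (by rw [rung_inj.1 hv])
    · exact rung_ne_hor he
  · rcases ha'.2 with ⟨v', rfl, hv⟩ | ⟨x', w', i', h', h1', h2', hx', hw', he⟩
    · exact rung_ne_hor hv.symm
    · rcases Sym2.eq_iff.1 (hor_inj.1 he).2 with ⟨rfl, rfl⟩ | ⟨rfl, rfl⟩
      · exact h1' h2
      · exact hx hw'

theorem encard_ladder_inter_pair (hT : T.IsTree) (p q : Pt T) {x w : V} (h : T.Adj x w) :
    (ladder p q ∩ {hor x w 0, hor x w 1}).encard = 0 ∨
      (ladder p q ∩ {hor x w 0, hor x w 1}).encard = 2 := by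
  by_cases hs : Beyond T x w p ↔ Beyond T x w q
  · left
    rw [encard_eq_zero, eq_empty_iff_forall_notMem]
    rintro e ⟨he, rfl | rfl⟩ <;> exact (hor_mem_ladder hT h).1 he hs
  · right
    rw [inter_eq_right.2]
    · refine encard_pair fun heq => ?_
      exact absurd (hor_inj.1 heq).1 (by decide)
    · rintro e (rfl | rfl) <;> exact (hor_mem_ladder hT h).2 hs

end Ladder

section Arcs

variable {V : Type u} {G : SimpleGraph V} {Ψ : Set (Ends G)}

/-! ### Walks as topological paths -/

/-- The point at distance `t` from `u` on the edge `uv`; points with `t ∉ [0, 1]` are sent to the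
nearest endvertex. -/
noncomputable def seg {u v : V} (h : G.Adj u v) (t : ℝ) : GraphPoint G :=
  open Classical in
  if h0 : t ≤ 0 then .vert u else if h1 : 1 ≤ t then .vert v else
    .inner ⟨s(u, v), h⟩ (if tail (G := G) ⟨s(u, v), h⟩ = u
      then ⟨t, not_le.1 h0, not_le.1 h1⟩
      else ⟨1 - t, by linarith [not_le.1 h1], by linarith [not_le.1 h0]⟩)

theorem seg_of_nonpos {u v : V} (h : G.Adj u v) {t : ℝ} (ht : t ≤ 0) : seg h t = .vert u :=
  dif_pos ht

theorem seg_of_one_le {u v : V} (h : G.Adj u v) {t : ℝ} (ht : 1 ≤ t) : seg h t = .vert v := by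
  rw [seg, dif_neg (by linarith), dif_pos ht]

theorem tail_head_cases {u v : V} (h : G.Adj u v) :
    tail (G := G) ⟨s(u, v), h⟩ = u ∧ head (G := G) ⟨s(u, v), h⟩ = v ∨
      tail (G := G) ⟨s(u, v), h⟩ = v ∧ head (G := G) ⟨s(u, v), h⟩ = u :=
  Sym2.eq_iff.1 (mk_tail_head (G := G) ⟨s(u, v), h⟩)

theorem seg_eq_inner {u v : V} (h : G.Adj u v) {t : ℝ} (h0 : 0 < t) (h1 : t < 1) :
    ∃ x : Ioo (0 : ℝ) 1, seg h t = .inner ⟨s(u, v), h⟩ x ∧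
      (tail (G := G) ⟨s(u, v), h⟩ = u ∧ head (G := G) ⟨s(u, v), h⟩ = v ∧ x.1 = t ∨
        tail (G := G) ⟨s(u, v), h⟩ = v ∧ head (G := G) ⟨s(u, v), h⟩ = u ∧ x.1 = 1 - t) := by
  rw [seg, dif_neg (not_le.2 h0), dif_neg (not_le.2 h1)]
  rcases tail_head_cases h with ⟨h2, h3⟩ | ⟨h2, h3⟩
  · exact ⟨_, rfl, Or.inl ⟨h2, h3, by rw [if_pos h2]⟩⟩
  · refine ⟨_, rfl, Or.inr ⟨h2, h3, ?_⟩⟩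
    rw [if_neg]
    rw [h2]; exact h.ne'

theorem inner_mem_range_seg {u v : V} (h : G.Adj u v) (x : Ioo (0 : ℝ) 1) :
    ∃ t ∈ Ioo (0 : ℝ) 1, seg h t = .inner ⟨s(u, v), h⟩ x := by
  rcases tail_head_cases h with ⟨h2, h3⟩ | ⟨h2, h3⟩
  · refine ⟨x.1, x.2, ?_⟩
    obtain ⟨y, hy, h⟩ := seg_eq_inner h x.2.1 x.2.2
    rw [hy]
    rcases h with ⟨-, -, h⟩ | ⟨h4, -, h⟩
    · rw [Subtype.ext h]
    · exact absurd (h2.symm.trans h4) ‹G.Adj u v›.ne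
  · have hx := x.2
    refine ⟨1 - x.1, ⟨by linarith [hx.2], by linarith [hx.1]⟩, ?_⟩
    obtain ⟨y, hy, h⟩ := seg_eq_inner h (t := 1 - x.1) (by linarith [hx.2]) (by linarith [hx.1])
    rw [hy]
    rcases h with ⟨h4, -, h⟩ | ⟨-, -, h⟩
    · exact absurd (h4.symm.trans h2) ‹G.Adj u v›.ne
    · rw [Subtype.ext (a1 := y) (a2 := x) (by linarith)]

theorem seg_symm {u v : V} (h : G.Adj u v) (t : ℝ) : seg h.symm t = seg h (1 - t) := by
  rcases le_or_gt t 0 with h0 | h0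
  · rw [seg_of_nonpos _ h0, seg_of_one_le _ (by linarith)]
  rcases le_or_gt 1 t with h1 | h1
  · rw [seg_of_one_le _ h1, seg_of_nonpos _ (by linarith)]
  obtain ⟨x, hx, hx'⟩ := seg_eq_inner h.symm h0 h1
  obtain ⟨y, hy, hy'⟩ := seg_eq_inner h (t := 1 - t) (by linarith) (by linarith)
  have he : (⟨s(v, u), h.symm⟩ : G.edgeSet) = ⟨s(u, v), h⟩ := Subtype.ext Sym2.eq_swap
  rw [hx, hy, he]
  rw [he] at hx'
  have hne := h.ne
  congr 1
  apply Subtype.ext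
  rcases hx' with ⟨h2, -, h3⟩ | ⟨h2, -, h3⟩ <;> rcases hy' with ⟨h4, -, h5⟩ | ⟨h4, -, h5⟩
  · exact absurd (h4.symm.trans h2) hne
  · linarith
  · linarith
  · exact absurd (h2.symm.trans h4) hne

theorem seg_mem_of_small {u v : V} (h : G.Adj u v) {U : Set (GraphPoint G)} (hU : IsOpen U)
    (hu : .vert u ∈ U) : ∃ ε > (0 : ℝ), ∀ t < ε, seg h t ∈ U := by
  obtain ⟨ε, hε, hεU⟩ := hU.1 u hu
  refine ⟨min ε 1, lt_min hε one_pos, fun t ht => ?_⟩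
  rcases le_or_gt t 0 with h0 | h0
  · rwa [seg_of_nonpos _ h0]
  obtain ⟨x, hx, hx'⟩ := seg_eq_inner h h0 (ht.trans_le (min_le_right _ _))
  rw [hx]
  have hlt := ht.trans_le (min_le_left ε 1)
  refine hεU _ _ ?_
  rcases hx' with ⟨h2, -, h3⟩ | ⟨-, h2, h3⟩
  · exact Or.inl ⟨h2, by linarith⟩
  · exact Or.inr ⟨h2, by linarith⟩

theorem continuous_seg {u v : V} (h : G.Adj u v) : Continuous (seg h) := by
  refine continuous_def.2 fun U hU => Metric.isOpen_iff.2 fun t ht => ?_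
  rcases le_or_gt t 0 with h0 | h0
  · rw [mem_preimage, seg_of_nonpos _ h0] at ht
    obtain ⟨ε, hε, hεU⟩ := seg_mem_of_small h hU ht
    refine ⟨ε, hε, fun s hs => hεU s ?_⟩
    rw [Real.ball_eq_Ioo] at hs
    linarith [hs.2]
  rcases le_or_gt 1 t with h1 | h1
  · rw [mem_preimage, seg_of_one_le _ h1] at ht
    obtain ⟨ε, hε, hεU⟩ := seg_mem_of_small h.symm hU ht
    refine ⟨ε, hε, fun s hs => ?_⟩
    rw [Real.ball_eq_Ioo] at hs
    have := hεU (1 - s) (by linarith [hs.1])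
    rwa [seg_symm, sub_sub_cancel] at this
  · obtain ⟨x, hx, hx'⟩ := seg_eq_inner h h0 h1
    rw [mem_preimage, hx] at ht
    obtain ⟨ε, hε, hεU⟩ := hU.2.1 _ _ ht
    refine ⟨min ε (min t (1 - t)), lt_min hε (lt_min h0 (by linarith)), fun s hs => ?_⟩
    rw [Metric.mem_ball, Real.dist_eq, lt_min_iff, lt_min_iff, abs_lt, abs_lt, abs_lt] at hs
    obtain ⟨y, hy, hy'⟩ := seg_eq_inner h (t := s) (by linarith) (by linarith)
    rw [mem_preimage, hy]
    refine hεU y ?_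
    have hne := h.ne
    rw [abs_lt]
    rcases hx' with ⟨h2, -, h3⟩ | ⟨h2, -, h3⟩ <;> rcases hy' with ⟨h4, -, h5⟩ | ⟨h4, -, h5⟩
    · constructor <;> linarith
    · exact absurd (h2.symm.trans h4) hne
    · exact absurd (h4.symm.trans h2) hne
    · constructor <;> linarith

theorem seg_injOn {u v : V} (h : G.Adj u v) {t t' : ℝ} (ht : t ∈ Ioo (0 : ℝ) 1)
    (ht' : t' ∈ Ioo (0 : ℝ) 1) (heq : seg h t = seg h t') : t = t' := by
  obtain ⟨x, hx, hx'⟩ := seg_eq_inner h ht.1 ht.2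
  obtain ⟨y, hy, hy'⟩ := seg_eq_inner h ht'.1 ht'.2
  rw [hx, hy, GraphPoint.inner.injEq] at heq
  have hxy := congrArg Subtype.val heq.2
  have hne := h.ne
  rcases hx' with ⟨h2, -, h3⟩ | ⟨h2, -, h3⟩ <;> rcases hy' with ⟨h4, -, h5⟩ | ⟨h4, -, h5⟩
  · linarith
  · exact absurd (h2.symm.trans h4) hne
  · exact absurd (h4.symm.trans h2) hne
  · linarith

/-- The position after time `s` of a point that runs along the walk `g` with speed `1`. -/
noncomputable def walkPt {g : ℕ → V} (hg : ∀ n, G.Adj (g n) (g (n + 1))) (s : ℝ) :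
    GraphPoint G :=
  seg (hg ⌊s⌋₊) (s - ⌊s⌋₊)

variable {g : ℕ → V} (hg : ∀ n, G.Adj (g n) (g (n + 1)))

theorem walkPt_of_floor {n : ℕ} {s : ℝ} (h : ⌊s⌋₊ = n) :
    walkPt hg s = seg (hg n) (s - n) := by
  subst h; rfl

theorem walkPt_eq_seg {n : ℕ} {s : ℝ} (h0 : n ≤ s) (h1 : s ≤ n + 1) :
    walkPt hg s = seg (hg n) (s - n) := by
  rcases h1.lt_or_eq with h1 | h1
  · have : ⌊s⌋₊ = n := (Nat.floor_eq_iff ((Nat.cast_nonneg n).trans h0)).2 ⟨h0, h1⟩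
    rw [walkPt_of_floor hg this]
  · have : ⌊s⌋₊ = n + 1 := by rw [h1]; exact_mod_cast Nat.floor_natCast (n + 1)
    rw [walkPt_of_floor hg this, seg_of_nonpos, seg_of_one_le]
    · linarith
    · push_cast; linarith

theorem walkPt_of_le_one {s : ℝ} (h1 : s ≤ 1) : walkPt hg s = seg (hg 0) s := by
  rcases le_or_gt 0 s with h0 | h0
  · rw [walkPt_eq_seg hg (n := 0) (by simpa using h0) (by simpa using h1)]; simp
  · rw [walkPt_of_floor hg (Nat.floor_of_nonpos h0.le)]; simp

theorem walkPt_natCast (n : ℕ) : walkPt hg n = .vert (g n) := by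
  rw [walkPt_eq_seg hg (n := n) le_rfl (by linarith), sub_self, seg_of_nonpos _ le_rfl]

theorem continuous_walkPt : Continuous (walkPt hg) := by
  rw [continuous_iff_continuousAt]
  intro s
  rcases lt_or_ge s 1 with h | h
  · refine (continuous_seg (hg 0)).continuousAt.congr ?_
    filter_upwards [Iio_mem_nhds h] with r hr
    exact (walkPt_of_le_one hg (le_of_lt hr)).symm
  · obtain ⟨m, hm⟩ : ∃ m, ⌊s⌋₊ = m + 1 :=
      Nat.exists_eq_succ_of_ne_zero (Nat.floor_pos.2 h).ne'
    have h1 := Nat.floor_le (show 0 ≤ s by linarith)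
    have h2 := Nat.lt_floor_add_one s
    rw [hm] at h1 h2
    push_cast at h1 h2
    -- Near `s`, the motion consists of two consecutive edges glued at the integer `m + 1`. This
    -- also covers the case that `s` is that integer.
    have hc : Continuous fun r : ℝ => if r ≤ m + 1 then seg (hg m) (r - m)
        else seg (hg (m + 1)) (r - (m + 1)) := by
      refine Continuous.if_le ?_ ?_ continuous_id continuous_const ?_
      · exact (continuous_seg _).comp (by fun_prop)
      · exact (continuous_seg _).comp (by fun_prop)
      · rintro r rfl
        rw [seg_of_one_le _ (by simp), seg_of_nonpos _ (by simp)]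
    refine hc.continuousAt.congr ?_
    filter_upwards [Ioo_mem_nhds (show (m : ℝ) < s by linarith)
      (show s < (m : ℝ) + 1 + 1 by linarith)] with r hr
    split_ifs with hr'
    · exact (walkPt_eq_seg hg hr.1.le hr').symm
    · rw [walkPt_eq_seg hg (n := m + 1) (by push_cast; linarith) (by push_cast; linarith [hr.2])]
      push_cast; rfl

theorem walkPt_cases {s : ℝ} (hs : 0 ≤ s) :
    (∃ n : ℕ, s = n ∧ walkPt hg s = .vert (g n)) ∨
      ∃ (n : ℕ) (x : Ioo (0 : ℝ) 1), (n : ℝ) < s ∧ s < n + 1 ∧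
        walkPt hg s = .inner ⟨s(g n, g (n + 1)), hg n⟩ x := by
  rcases (Nat.floor_le hs).eq_or_lt with h | h
  · refine Or.inl ⟨⌊s⌋₊, h.symm, ?_⟩
    conv_lhs => rw [← h]
    exact walkPt_natCast hg _
  · obtain ⟨x, hx, -⟩ := seg_eq_inner (hg ⌊s⌋₊) (t := s - ⌊s⌋₊) (by linarith)
      (by linarith [Nat.lt_floor_add_one s])
    exact Or.inr ⟨_, x, h, Nat.lt_floor_add_one s, hx⟩

theorem walkPt_injOn {M : ℕ} (hinj : InjOn g (Iic M)) : InjOn (walkPt hg) (Icc 0 (M : ℝ)) := by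
  intro s hs s' hs' heq
  have hsucc : ∀ {n : ℕ} {r : ℝ}, (n : ℝ) < r → r ≤ M → n + 1 ≤ M := by
    intro n r h1 h2
    exact_mod_cast h1.trans_le h2
  rcases walkPt_cases hg hs.1 with ⟨n, h1, h2⟩ | ⟨n, x, h1, h1', h2⟩ <;>
    rcases walkPt_cases hg hs'.1 with ⟨m, h3, h4⟩ | ⟨m, y, h3, h3', h4⟩ <;>
    rw [h2, h4] at heq
  · have hn : n ≤ M := by have := hs.2; rw [h1] at this; exact_mod_cast this
    have hm : m ≤ M := by have := hs'.2; rw [h3] at this; exact_mod_cast this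
    rw [h1, h3, hinj hn hm (GraphPoint.vert.inj heq)]
  · cases heq
  · cases heq
  · have hn := hsucc h1 hs.2
    have hm := hsucc h3 hs'.2
    have he := congrArg Subtype.val (GraphPoint.inner.inj heq).1
    have hnm : n = m := by
      rcases Sym2.eq_iff.1 he with ⟨h5, -⟩ | ⟨h5, h6⟩
      · exact hinj (by simp; omega) (by simp; omega) h5
      · have h7 := hinj (by simp; omega) (by simp; omega) h5
        have h8 := hinj (by simp; omega) (by simp; omega) h6
        omega
    subst hnm
    rw [← h2, ← h4, walkPt_eq_seg hg h1.le h1'.le, walkPt_eq_seg hg h3.le h3'.le] at heq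
    have := seg_injOn (hg n) ⟨by linarith, by linarith⟩ ⟨by linarith, by linarith⟩ heq
    linarith

theorem walkPt_ne_endPt {s : ℝ} {ω : Ends G} : walkPt hg s ≠ .endPt ω := by
  rw [walkPt]
  rcases le_or_gt (s - ⌊s⌋₊) 0 with h0 | h0
  · rw [seg_of_nonpos _ h0]; simp
  rcases le_or_gt 1 (s - ⌊s⌋₊) with h1 | h1
  · rw [seg_of_one_le _ h1]; simp
  obtain ⟨x, hx, -⟩ := seg_eq_inner (hg ⌊s⌋₊) h0 h1
  rw [hx]; simp

/-- The initial segment of length `L` of a walk, as an arc in `|G|_Ψ`. -/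
theorem exists_path_walkPt (Ψ : Set (Ends G)) {M : ℕ} (hinj : InjOn g (Iic M)) {L : ℝ}
    (hL : 0 < L) (hLM : L ≤ M) {a b : PsiSpace G Ψ} (ha : a.1 = .vert (g 0))
    (hb : b.1 = walkPt hg L) :
    ∃ γ : Path a b, Function.Injective γ ∧
      ∀ z, z ∈ range γ ↔ ∃ s ∈ Icc 0 L, z.1 = walkPt hg s := by
  let f : unitInterval → PsiSpace G Ψ := fun t =>
    ⟨walkPt hg (t.1 * L), fun ω h => absurd h (walkPt_ne_endPt hg)⟩
  have hf : Continuous f :=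
    ((continuous_walkPt hg).comp (by fun_prop)).subtype_mk _
  have hmem : ∀ t : unitInterval, t.1 * L ∈ Icc 0 L := fun t =>
    ⟨mul_nonneg t.2.1 hL.le, mul_le_of_le_one_left hL.le t.2.2⟩
  refine ⟨⟨⟨f, hf⟩, ?_, ?_⟩, ?_, fun z => ⟨?_, ?_⟩⟩
  · apply Subtype.ext
    change walkPt hg (0 * L) = a.1
    rw [ha, zero_mul]
    exact_mod_cast walkPt_natCast hg 0
  · apply Subtype.ext
    change walkPt hg (1 * L) = b.1
    rw [hb, one_mul]
  · intro t t' htt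
    have h1 := walkPt_injOn hg hinj ⟨(hmem t).1, (hmem t).2.trans hLM⟩
      ⟨(hmem t').1, (hmem t').2.trans hLM⟩ (congrArg Subtype.val htt)
    exact Subtype.ext (mul_right_cancel₀ hL.ne' h1)
  · rintro ⟨t, rfl⟩
    exact ⟨_, hmem t, rfl⟩
  · rintro ⟨s, hs, hz⟩
    refine ⟨⟨s / L, div_nonneg hs.1 hL.le, (div_le_one hL).2 hs.2⟩, Subtype.ext ?_⟩
    change walkPt hg (s / L * L) = z.1
    rw [hz, div_mul_cancel₀ _ hL.ne']

theorem Ray.walkPt_mem_endNhd (R : Ray G) {S : Set V} (hS : S.Finite) :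
    ∃ N : ℕ, ∀ s : ℝ, N ≤ s → walkPt R.adj s ∈ endNhd G S R.toEnd := by
  obtain ⟨N, hN⟩ := (Ray.equivalent_equivalence G).refl R S hS
  have hmem : ∀ n ≥ N, R.toFun n ∈ endComponent G S R.toEnd := fun n hn =>
    (mem_endComponent_iff hS).2 ⟨N, fun m hm => hN n hn m hm⟩
  refine ⟨N, fun s hs => ?_⟩
  have hs0 : 0 ≤ s := (Nat.cast_nonneg N).trans hs
  rcases walkPt_cases R.adj hs0 with ⟨n, h1, h2⟩ | ⟨n, x, h1, h1', h2⟩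
  · rw [h2]
    refine hmem n ?_
    rw [h1] at hs
    exact_mod_cast hs
  · rw [h2]
    refine ⟨R.toFun (n + 1), by simp, hmem _ ?_⟩
    have : (N : ℝ) < n + 1 := hs.trans_lt h1'
    exact_mod_cast this.le

/-- A ray, together with its end, as an arc in `|G|_Ψ`. -/
theorem Ray.exists_path (R : Ray G) (Ψ : Set (Ends G)) {a b : PsiSpace G Ψ}
    (ha : a.1 = .vert (R.toFun 0)) (hb : b.1 = .endPt R.toEnd) :
    ∃ γ : Path a b, Function.Injective γ ∧
      ∀ z, z ∈ range γ ↔ z = b ∨ ∃ s, 0 ≤ s ∧ z.1 = walkPt R.adj s := by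
  classical
  -- The substitution `t / (1 - t)` stretches the half-open interval over the whole ray, and the
  -- value at 1 is the end. Beyond `N / (N + 1)` the ray parameter exceeds `N`, which gives
  -- continuity at 1.
  let f : unitInterval → PsiSpace G Ψ := fun t =>
    if t.1 < 1 then ⟨walkPt R.adj (t.1 / (1 - t.1)), fun ω h => absurd h (walkPt_ne_endPt _)⟩
    else b
  have hf1 : ∀ t : unitInterval, t.1 < 1 → (f t).1 = walkPt R.adj (t.1 / (1 - t.1)) := by
    intro t ht
    simp only [f, if_pos ht]
  have hf2 : ∀ t : unitInterval, ¬ t.1 < 1 → f t = b := fun t ht => if_neg ht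
  have hone : ∀ t : unitInterval, ¬ t.1 < 1 → t = 1 := fun t ht =>
    Subtype.ext (le_antisymm t.2.2 (not_lt.1 ht))
  have hf : Continuous f := by
    rw [continuous_iff_continuousAt]
    intro t
    by_cases ht : t.1 < 1
    · rw [ContinuousAt, tendsto_subtype_rng, hf1 t ht]
      have hc : ContinuousAt (fun r : unitInterval => walkPt R.adj (r.1 / (1 - r.1))) t := by
        refine (continuous_walkPt R.adj).continuousAt.comp ?_
        refine ContinuousAt.div (by fun_prop) (by fun_prop) (by linarith)
      refine hc.tendsto.congr' ?_
      have : {r : unitInterval | r.1 < 1} ∈ nhds t :=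
        (isOpen_lt continuous_subtype_val continuous_const).mem_nhds ht
      filter_upwards [this] with r hr
      exact (hf1 r hr).symm
    · rw [ContinuousAt, hf2 t ht, tendsto_subtype_rng, hb]
      intro U hU
      obtain ⟨U', hU', hopen, hmem⟩ := mem_nhds_iff.1 hU
      obtain ⟨S, hS, hSU⟩ := hopen.2.2 _ hmem
      obtain ⟨N, hN⟩ := R.walkPt_mem_endNhd hS
      have hpos : (0 : ℝ) < N + 1 := by positivity
      have : {r : unitInterval | (N : ℝ) / (N + 1) < r.1} ∈ nhds t := by
        refine (isOpen_lt continuous_const continuous_subtype_val).mem_nhds ?_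
        rw [hone t ht]
        change (N : ℝ) / (N + 1) < 1
        rw [div_lt_one hpos]; linarith
      rw [Filter.mem_map]
      filter_upwards [this] with r hr
      refine hU' (hSU ?_)
      change (f r).1 ∈ _
      by_cases hr1 : r.1 < 1
      · rw [hf1 r hr1]
        refine hN _ ?_
        rw [le_div_iff₀ (by linarith)]
        have : (N : ℝ) / (N + 1) < r.1 := hr
        rw [div_lt_iff₀ hpos] at this
        nlinarith
      · rw [hf2 r hr1, hb]
        exact endPt_mem_endNhd hS _
  refine ⟨⟨⟨f, hf⟩, ?_, hf2 1 (by simp)⟩, ?_, fun z => ⟨?_, ?_⟩⟩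
  · apply Subtype.ext
    change (f 0).1 = a.1
    rw [hf1 0 (by simp), ha]
    simpa using walkPt_natCast R.adj 0
  · intro t t' htt
    change f t = f t' at htt
    have hnb : ∀ r : unitInterval, r.1 < 1 → f r ≠ b := by
      intro r hr h
      have := congrArg Subtype.val h
      rw [hf1 r hr, hb] at this
      exact walkPt_ne_endPt _ this
    by_cases ht : t.1 < 1 <;> by_cases ht' : t'.1 < 1
    · have h1 := congrArg Subtype.val htt
      rw [hf1 t ht, hf1 t' ht'] at h1
      have h2 : 0 ≤ t.1 / (1 - t.1) := div_nonneg t.2.1 (by linarith)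
      have h3 : 0 ≤ t'.1 / (1 - t'.1) := div_nonneg t'.2.1 (by linarith)
      obtain ⟨M, hM⟩ := exists_nat_ge (max (t.1 / (1 - t.1)) (t'.1 / (1 - t'.1)))
      have h4 := walkPt_injOn R.adj (M := M) R.injective.injOn
        ⟨h2, (le_max_left _ _).trans hM⟩ ⟨h3, (le_max_right _ _).trans hM⟩ h1
      rw [div_eq_div_iff (by linarith) (by linarith)] at h4
      exact Subtype.ext (by linarith)
    · exact absurd (htt.trans (hf2 t' ht')) (hnb t ht)
    · exact absurd (htt.symm.trans (hf2 t ht)) (hnb t' ht')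
    · rw [hone t ht, hone t' ht']
  · rintro ⟨t, rfl⟩
    by_cases ht : t.1 < 1
    · exact Or.inr ⟨_, div_nonneg t.2.1 (by linarith), hf1 t ht⟩
    · exact Or.inl (hf2 t ht)
  · rintro (rfl | ⟨s, hs, hz⟩)
    · exact ⟨1, hf2 1 (by simp)⟩
    · have h1 : 0 < 1 + s := by linarith
      have h2 : s / (1 + s) < 1 := by rw [div_lt_one h1]; linarith
      refine ⟨⟨s / (1 + s), div_nonneg hs h1.le, h2.le⟩, Subtype.ext ?_⟩
      change (f _).1 = z.1
      rw [hf1 _ h2, hz]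
      congr 1
      field_simp
      ring

end Arcs

section LadderCircuit

variable {V : Type u} {T : SimpleGraph V} {Ψ : Set (Ends (timesK2 T))}

/-! ### Ladders are `Ψ`-circuits -/

theorem finite_neighborSet_timesK2 (hfin : ∀ v, (T.neighborSet v).Finite) (a : V × Fin 2) :
    ((timesK2 T).neighborSet a).Finite := by
  refine (((hfin a.1).insert a.1).prod (finite_univ (α := Fin 2))).subset fun b hb => ?_
  rcases timesK2_adj.1 hb with ⟨h, -⟩ | ⟨-, h⟩
  · exact ⟨Or.inr h, trivial⟩
  · exact ⟨Or.inl h.symm, trivial⟩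

theorem adj_rung (v : V) (i : Fin 2) : (timesK2 T).Adj (v, i) (v, i + 1) :=
  timesK2_adj_rung v (by revert i; decide)

theorem mk_rung (v : V) (i : Fin 2) : s((v, i), (v, i + 1)) = rung v := by
  have : i = 0 ∨ i = 1 := by omega
  rcases this with rfl | rfl
  · rfl
  · exact Sym2.eq_swap

theorem seg_rung_one (v : V) (t : ℝ) :
    seg (adj_rung (T := T) v 1) t = seg (adj_rung (T := T) v 0) (1 - t) :=
  seg_symm (adj_rung (T := T) v 0) t

/-- The middle of the rung at a vertex, or an end itself. -/
noncomputable def tipPt : Pt T → GraphPoint (timesK2 T)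
  | .inl v => seg (adj_rung v 0) (1 / 2)
  | .inr ω => .endPt ω

theorem seg_half_eq_tipPt (v : V) (i : Fin 2) :
    seg (adj_rung (T := T) v i) (1 / 2) = tipPt (.inl v) := by
  have : i = 0 ∨ i = 1 := by omega
  rcases this with rfl | rfl
  · rfl
  · rw [seg_rung_one]; norm_num; rfl

theorem seg_rung_eq_inner (v : V) (i : Fin 2) {t : ℝ} (h0 : 0 < t) (h1 : t < 1) :
    ∃ x, seg (adj_rung (T := T) v i) t = .inner ⟨rung v, rung_mem_edgeSet v⟩ x := by
  obtain ⟨x, hx, -⟩ := seg_eq_inner (adj_rung (T := T) v i) h0 h1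
  refine ⟨x, hx.trans ?_⟩
  congr 1
  exact Subtype.ext (mk_rung v i)

/-! ### Decomposition of a ladder into four half-arcs -/

/-- The points on the half of the ladder at level `i` that leads from `w` to `q`. -/
def OnHalf (q : Pt T) (w : V) (i : Fin 2) (z : GraphPoint (timesK2 T)) : Prop :=
  z = tipPt q ∨
  (∃ n, (∀ k < n, q ≠ .inl (toward q w k)) ∧ z = .vert (toward q w n, i)) ∨
  (∃ n x h, (∀ k ≤ n, q ≠ .inl (toward q w k)) ∧
    z = .inner ⟨hor (toward q w n) (toward q w (n + 1)) i, h⟩ x) ∨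
  ∃ v t, q = .inl v ∧ 0 < t ∧ t < 1 / 2 ∧ z = seg (adj_rung v i) t

/-- The arc follows level `i` from `w` towards `q`. At an end it is the whole ray with its limit. At
a vertex it turns onto the rung and stops in the middle, so that the two levels meet in one point in
either case. -/
theorem exists_halfArc (hT : T.IsTree) {q : Pt T} (w : V) (i : Fin 2)
    {a b : PsiSpace (timesK2 T) Ψ} (ha : a.1 = .vert (w, i)) (hb : b.1 = tipPt q) :
    ∃ γ : Path a b, Function.Injective γ ∧ ∀ z, z ∈ range γ ↔ OnHalf q w i z.1 := by
  classical
  rcases q with v | ω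
  · have hex := exists_toward_eq hT v w
    set N := Nat.find hex with hN
    have hNv : toward (.inl v : Pt T) w N = v := Nat.find_spec hex
    have hlt : ∀ k < N, (.inl v : Pt T) ≠ .inl (toward (.inl v : Pt T) w k) := fun k hk h =>
      Nat.find_min hex hk (Sum.inl.inj h).symm
    have hle : ∀ n, (∀ k < n, (.inl v : Pt T) ≠ .inl (toward (.inl v : Pt T) w k)) → n ≤ N :=
      fun n hn => not_lt.1 fun h => hn N h (by rw [hNv])
    have hge : ∀ n ≥ N, toward (.inl v : Pt T) w n = v := by
      intro n hn
      induction n, hn using Nat.le_induction with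
      | base => exact hNv
      | succ n _ ih => exact toward_of_eq hT ih
    -- The truncated difference is zero up to step `N`, so the level is constant until `v` is
    -- reached. Afterwards the walk alternates between the clones of `v`; the arc has length `N + 1
    -- / 2` and uses only half of the first change of level.
    let g : ℕ → V × Fin 2 := fun n => (toward (.inl v : Pt T) w n, i + (n - N) • 1)
    have hgle : ∀ n ≤ N, g n = (toward (.inl v : Pt T) w n, i) := by
      intro n hn
      simp only [g, Nat.sub_eq_zero_of_le hn, zero_smul, add_zero]
    have hg1 : g (N + 1) = (v, i + 1) := by
      simp only [g, hge (N + 1) (by omega), Nat.add_sub_cancel_left, one_smul]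
    have hg : ∀ n, (timesK2 T).Adj (g n) (g (n + 1)) := by
      intro n
      rcases lt_or_ge n N with h | h
      · rw [hgle n h.le, hgle (n + 1) h]
        exact timesK2_adj_horizontal (toward_adj hT (hlt n h))
      · simp only [g, hge n h, hge (n + 1) (by omega)]
        rw [show n + 1 - N = (n - N) + 1 by omega, succ_nsmul, ← add_assoc]
        exact adj_rung v _
    have hedge : ∀ n < N, s(g n, g (n + 1)) =
        hor (toward (.inl v : Pt T) w n) (toward (.inl v : Pt T) w (n + 1)) i := by
      intro n hn
      rw [hgle n hn.le, hgle (n + 1) hn]; rfl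
    have hsegN : ∀ t, seg (hg N) t = seg (adj_rung (T := T) v i) t := by
      have h1 := (hgle N le_rfl).trans (by rw [hNv])
      have : ∀ {a b : V × Fin 2} (h : (timesK2 T).Adj a b), a = (v, i) → b = (v, i + 1) →
          ∀ t, seg h t = seg (adj_rung (T := T) v i) t := by
        rintro a b h rfl rfl t; rfl
      exact this _ h1 hg1
    have hinj : InjOn g (Iic (N + 1)) := by
      have key : ∀ m n, m < n → n ≤ N + 1 → g m ≠ g n := by
        intro m n hmn hn heq
        rcases hn.lt_or_eq with hn | rfl
        · rw [hgle n (by omega), hgle m (by omega)] at heq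
          exact toward_injOn hT hlt hmn (by omega) (congrArg Prod.fst heq)
        · rw [hg1, hgle m (by omega)] at heq
          have := congrArg Prod.snd heq
          revert this; simp
      intro m hm n hn heq
      rcases lt_trichotomy m n with h | h | h
      · exact absurd heq (key m n h hn)
      · exact h
      · exact absurd heq.symm (key n m h hm)
    obtain ⟨γ, hγ, hran⟩ := exists_path_walkPt hg Ψ (M := N + 1) hinj (L := N + 1 / 2)
      (by positivity) (by push_cast; linarith) (a := a) (b := b)
      (by rw [ha, hgle 0 (Nat.zero_le _)]; rfl)
      (by rw [hb, walkPt_eq_seg hg (n := N) (by linarith) (by linarith), hsegN,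
            add_sub_cancel_left, seg_half_eq_tipPt])
    refine ⟨γ, hγ, fun z => (hran z).trans ⟨?_, ?_⟩⟩
    · rintro ⟨s, hs, hz⟩
      rcases walkPt_cases hg hs.1 with ⟨n, h1, h2⟩ | ⟨n, x, h1, h1', h2⟩
      · have hn : n ≤ N := by
          have := hs.2
          rw [h1] at this
          have : (n : ℝ) < N + 1 := by linarith
          exact Nat.lt_succ_iff.1 (by exact_mod_cast this)
        refine Or.inr (Or.inl ⟨n, fun k hk => hlt k (by omega), ?_⟩)
        rw [hz, h2, hgle n hn]
      · have hn : n ≤ N := by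
          have : (n : ℝ) < N + 1 := by linarith [hs.2]
          exact Nat.lt_succ_iff.1 (by exact_mod_cast this)
        rcases hn.lt_or_eq with hn | rfl
        · refine Or.inr (Or.inr (Or.inl ⟨n, x, hor_mem_edgeSet.2 (toward_adj hT (hlt n hn)),
            fun k hk => hlt k (by omega), ?_⟩))
          rw [hz, h2]
          congr 1
          exact Subtype.ext (hedge n hn)
        · rw [walkPt_eq_seg hg h1.le h1'.le, hsegN] at hz
          rcases hs.2.lt_or_eq with hs' | hs'
          · exact Or.inr (Or.inr (Or.inr ⟨v, _, rfl, by linarith, by linarith, hz⟩))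
          · left
            rw [hz, hs', add_sub_cancel_left, seg_half_eq_tipPt]
    · rintro (h | ⟨n, hn, h⟩ | ⟨n, x, hE, hn, h⟩ | ⟨v', t, hv', h0, h1, h⟩)
      · refine ⟨N + 1 / 2, ⟨by positivity, le_rfl⟩, ?_⟩
        rw [h, walkPt_eq_seg hg (n := N) (by linarith) (by linarith), hsegN,
            add_sub_cancel_left, seg_half_eq_tipPt]
      · have hnN := hle n hn
        refine ⟨n, ⟨by positivity, ?_⟩, by rw [h, walkPt_natCast, hgle n hnN]⟩
        have : (n : ℝ) ≤ N := by exact_mod_cast hnN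
        linarith
      · have hnN : n + 1 ≤ N := hle (n + 1) fun k hk => hn k (by omega)
        have hnN' : (n : ℝ) + 1 ≤ N := by exact_mod_cast hnN
        obtain ⟨t, ht, htx⟩ := inner_mem_range_seg (hg n) x
        refine ⟨n + t, ⟨by linarith [ht.1, (Nat.cast_nonneg n : (0 : ℝ) ≤ n)],
          by linarith [ht.2]⟩, ?_⟩
        rw [h, walkPt_eq_seg hg (n := n) (by linarith [ht.1]) (by linarith [ht.2]),
          add_sub_cancel_left, htx]
        congr 1
        exact Subtype.ext (hedge n hnN).symm
      · obtain rfl := Sum.inl.inj hv'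
        refine ⟨N + t, ⟨by positivity, by linarith⟩, ?_⟩
        rw [h, walkPt_eq_seg hg (n := N) (by linarith) (by linarith), hsegN, add_sub_cancel_left]
  · have hne : ∀ k, (.inr ω : Pt T) ≠ .inl (toward (.inr ω : Pt T) w k) := fun _ => end_ne_inl
    obtain ⟨γ, hγ, hran⟩ := (towardRay hT ω w i).exists_path Ψ (a := a) (b := b) ha
      (by rw [hb, toEnd_towardRay]; rfl)
    refine ⟨γ, hγ, fun z => (hran z).trans ⟨?_, ?_⟩⟩
    · rintro (rfl | ⟨s, hs, hz⟩)
      · exact Or.inl hb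
      · rcases walkPt_cases (towardRay hT ω w i).adj hs with ⟨n, -, h2⟩ | ⟨n, x, -, -, h2⟩
        · exact Or.inr (Or.inl ⟨n, fun k _ => hne k, hz.trans h2⟩)
        · exact Or.inr (Or.inr (Or.inl ⟨n, x, _, fun k _ => hne k, hz.trans h2⟩))
    · rintro (h | ⟨n, -, h⟩ | ⟨n, x, hE, -, h⟩ | ⟨v, t, h, -⟩)
      · exact Or.inl (Subtype.ext (h.trans hb.symm))
      · exact Or.inr ⟨n, Nat.cast_nonneg n, h.trans (walkPt_natCast (towardRay hT ω w i).adj n).symm⟩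
      · obtain ⟨t, ht, htx⟩ := inner_mem_range_seg ((towardRay hT ω w i).adj n) x
        refine Or.inr ⟨n + t, by have := ht.1; positivity, ?_⟩
        rw [h, walkPt_eq_seg _ (n := n) (by linarith [ht.1]) (by linarith [ht.2]),
          add_sub_cancel_left, htx]
        rfl
      · cases h

theorem OnHalf.tipPt_of_levels {q : Pt T} {w : V} {z : GraphPoint (timesK2 T)}
    (h0 : OnHalf q w 0 z) (h1 : OnHalf q w 1 z) : z = tipPt q := by
  by_contra hne
  rcases h0 with h | ⟨n, -, h⟩ | ⟨n, x, hE, -, h⟩ | ⟨v, t, hv, ht0, ht1, h⟩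
  · exact hne h
  · rcases h1 with h' | ⟨m, -, h'⟩ | ⟨m, y, hE', -, h'⟩ | ⟨v', t', hv', ht0', ht1', h'⟩
    · exact hne h'
    · rw [h, GraphPoint.vert.injEq] at h'
      exact absurd (congrArg Prod.snd h') (show (0 : Fin 2) ≠ 1 by decide)
    · rw [h] at h'; cases h'
    · obtain ⟨y, hy⟩ := seg_rung_eq_inner (T := T) v' 1 ht0' (by linarith)
      rw [hy, h] at h'; cases h'
  · rcases h1 with h' | ⟨m, -, h'⟩ | ⟨m, y, hE', -, h'⟩ | ⟨v', t', hv', ht0', ht1', h'⟩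
    · exact hne h'
    · rw [h] at h'; cases h'
    · rw [h, GraphPoint.inner.injEq] at h'
      exact absurd (hor_inj.1 (congrArg Subtype.val h'.1)).1 (by decide)
    · obtain ⟨y, hy⟩ := seg_rung_eq_inner (T := T) v' 1 ht0' (by linarith)
      rw [hy, h, GraphPoint.inner.injEq] at h'
      exact rung_ne_hor (congrArg Subtype.val h'.1).symm
  · obtain ⟨x, hx⟩ := seg_rung_eq_inner (T := T) v 0 ht0 (by linarith)
    rcases h1 with h' | ⟨m, -, h'⟩ | ⟨m, y, hE', -, h'⟩ | ⟨v', t', hv', ht0', ht1', h'⟩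
    · exact hne h'
    · rw [h, hx] at h'; cases h'
    · rw [h, hx, GraphPoint.inner.injEq] at h'
      exact rung_ne_hor (congrArg Subtype.val h'.1)
    · obtain rfl := Sum.inl.inj (hv.symm.trans hv')
      rw [h, seg_rung_one] at h'
      have := seg_injOn _ ⟨ht0, by linarith⟩ ⟨by linarith, by linarith⟩ h'
      linarith

/-- The point `z` is a vertex over `y`, or an interior point of an edge at such a vertex. -/
def LiesOver (z : GraphPoint (timesK2 T)) (y : V) : Prop :=
  (∃ i, z = .vert (y, i)) ∨ ∃ e x i, z = .inner e x ∧ (y, i) ∈ e.1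

theorem liesOver_tipPt (v : V) : LiesOver (tipPt (.inl v : Pt T)) v := by
  obtain ⟨x, hx⟩ := seg_rung_eq_inner (T := T) v 0 (t := 1 / 2) (by norm_num) (by norm_num)
  exact Or.inr ⟨_, x, 0, hx, by simp [rung]⟩

theorem liesOver_seg {v y : V} {i : Fin 2} {t : ℝ} (h0 : 0 < t) (h1 : t < 1) :
    LiesOver (seg (adj_rung (T := T) v i) t) y ↔ y = v := by
  obtain ⟨x, hx⟩ := seg_rung_eq_inner (T := T) v i h0 h1
  rw [hx]
  constructor
  · rintro (⟨j, h⟩ | ⟨e, x', j, h, hy⟩)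
    · cases h
    · rw [GraphPoint.inner.injEq] at h
      rw [← h.1] at hy
      rcases Sym2.mem_iff.1 hy with h | h <;> exact congrArg Prod.fst h
  · rintro rfl
    exact Or.inr ⟨_, x, 0, rfl, by simp [rung]⟩

theorem liesOver_hor {a b y : V} {i : Fin 2} {hE : hor a b i ∈ (timesK2 T).edgeSet}
    {x : Ioo (0 : ℝ) 1} : LiesOver (.inner ⟨hor a b i, hE⟩ x) y ↔ y = a ∨ y = b := by
  constructor
  · rintro (⟨j, h⟩ | ⟨e, x', j, h, hy⟩)
    · cases h
    · rw [GraphPoint.inner.injEq] at h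
      rw [← h.1] at hy
      exact (Sym2.mem_iff.1 hy).imp (congrArg Prod.fst) (congrArg Prod.fst)
  · intro h
    refine Or.inr ⟨_, x, i, rfl, Sym2.mem_iff.2 ?_⟩
    rcases h with rfl | rfl
    · exact Or.inl rfl
    · exact Or.inr rfl

theorem liesOver_vert {a y : V} {i : Fin 2} :
    LiesOver (.vert (a, i) : GraphPoint (timesK2 T)) y ↔ y = a := by
  constructor
  · rintro (⟨j, h⟩ | ⟨e, x', j, h, hy⟩)
    · exact (congrArg Prod.fst (GraphPoint.vert.inj h)).symm
    · cases h
  · rintro rfl; exact Or.inl ⟨i, rfl⟩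

theorem toward_mem_of_beyond (hT : T.IsTree) {x w u : V} (h : T.Adj x w) {q : Pt T}
    (hq : Beyond T x w q) (hu : u ∈ branch T x w) (n : ℕ) : toward q u n ∈ branch T x w := by
  induction n with
  | zero => exact hu
  | succ n ih =>
    by_contra hcon
    by_cases hn : q = .inl (toward q u n)
    · have : toward q u (n + 1) = toward q u n := by
        rw [toward_succ]
        nth_rewrite 1 [hn]
        exact next_self hT _
      exact hcon (this ▸ ih)
    · obtain ⟨h1, h2⟩ := branch_cross hT h ih (toward_adj hT hn) hcon
      have := toward_beyond hT hn
      rw [h1, h2, beyond_swap hT h] at this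
      exact this hq

theorem OnHalf.mem_branch (hT : T.IsTree) {x w u : V} (h : T.Adj x w) {q : Pt T}
    (hq : Beyond T x w q) (hu : u ∈ branch T x w) {i : Fin 2} {z : GraphPoint (timesK2 T)}
    (hz : OnHalf q u i z) :
    (∃ ω, q = .inr ω ∧ z = .endPt ω) ∨
      (∃ y, LiesOver z y) ∧ ∀ y, LiesOver z y → y ∈ branch T x w := by
  have hmem := toward_mem_of_beyond hT h hq hu
  rcases hz with h' | ⟨n, -, h'⟩ | ⟨n, x, hE, -, h'⟩ | ⟨v, t, hv, ht0, ht1, h'⟩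
  · rcases q with v | ω
    · refine Or.inr ⟨⟨v, h' ▸ liesOver_tipPt v⟩, fun y hy => ?_⟩
      rw [h', tipPt, liesOver_seg (by norm_num) (by norm_num)] at hy
      rw [hy]; exact hq
    · exact Or.inl ⟨ω, rfl, h'⟩
  · subst h'
    refine Or.inr ⟨⟨_, liesOver_vert.2 rfl⟩, fun y hy => ?_⟩
    rw [liesOver_vert.1 hy]; exact hmem n
  · subst h'
    refine Or.inr ⟨⟨_, liesOver_hor.2 (Or.inl rfl)⟩, fun y hy => ?_⟩
    rcases liesOver_hor.1 hy with rfl | rfl <;> exact hmem _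
  · subst h' hv
    refine Or.inr ⟨⟨_, (liesOver_seg ht0 (by linarith)).2 rfl⟩, fun y hy => ?_⟩
    rw [(liesOver_seg ht0 (by linarith)).1 hy]; exact hq

theorem OnHalf.notMem_branch (hT : T.IsTree) {x w : V} (h : T.Adj x w) {p : Pt T}
    (hp : ¬ Beyond T x w p) {i : Fin 2} {z : GraphPoint (timesK2 T)} (hz : OnHalf p w i z) :
    z = .vert (w, i) ∨ (∃ ω, p = .inr ω ∧ z = .endPt ω) ∨ ∃ y ∉ branch T x w, LiesOver z y := by
  have h1 : toward p w 1 = x := next_eq hT h.symm ((beyond_swap hT h p).2 hp)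
  have hmem : ∀ n, toward p w (n + 1) ∉ branch T x w := by
    intro n
    rw [← mem_branch_swap hT h, add_comm, toward_add, h1]
    exact toward_mem_of_beyond hT h.symm ((beyond_swap hT h p).2 hp) (mem_branch_self w x) n
  rcases hz with h' | ⟨n, -, h'⟩ | ⟨n, x, hE, -, h'⟩ | ⟨v, t, hv, ht0, ht1, h'⟩
  · rcases p with v | ω
    · exact Or.inr (Or.inr ⟨v, hp, h' ▸ liesOver_tipPt v⟩)
    · exact Or.inr (Or.inl ⟨ω, rfl, h'⟩)
  · rcases n with _ | n
    · exact Or.inl h'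
    · exact Or.inr (Or.inr ⟨_, hmem n, h' ▸ liesOver_vert.2 rfl⟩)
  · exact Or.inr (Or.inr ⟨_, hmem n, h' ▸ liesOver_hor.2 (Or.inr rfl)⟩)
  · subst hv
    exact Or.inr (Or.inr ⟨_, hp, h' ▸ (liesOver_seg ht0 (by linarith)).2 rfl⟩)

theorem not_liesOver_endPt {ω : Ends (timesK2 T)} {y : V} : ¬ LiesOver (.endPt ω) y := by
  rintro (⟨i, h⟩ | ⟨e, x, i, h, -⟩) <;> cases h

/-- Projected to `T`, the half-arc to `q` stays beyond the edge `xw`, while the one to `p` goes back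
over that edge immediately. Only the starting vertex is common. -/
theorem OnHalf.eq_vert_of_sides (hT : T.IsTree) {x w : V} (h : T.Adj x w) {p q : Pt T}
    (hp : ¬ Beyond T x w p) (hq : Beyond T x w q) {i j : Fin 2} {z : GraphPoint (timesK2 T)}
    (hzp : OnHalf p w i z) (hzq : OnHalf q w j z) : i = j ∧ z = .vert (w, i) := by
  have hz : z = .vert (w, i) := by
    rcases hzp.notMem_branch hT h hp with h1 | ⟨ω, rfl, rfl⟩ | ⟨y, hy, hyz⟩
    · exact h1
    · exfalso
      rcases hzq.mem_branch hT h hq (mem_branch_self x w) with ⟨ω', rfl, h2⟩ | ⟨⟨y, h2⟩, -⟩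
      · rw [GraphPoint.endPt.injEq] at h2
        subst h2; exact hp hq
      · exact not_liesOver_endPt h2
    · exfalso
      rcases hzq.mem_branch hT h hq (mem_branch_self x w) with ⟨ω', rfl, rfl⟩ | ⟨-, h2⟩
      · exact not_liesOver_endPt hyz
      · exact hy (h2 y hyz)
  refine ⟨?_, hz⟩
  subst hz
  rcases hzq with h' | ⟨n, -, h'⟩ | ⟨n, x, hE, -, h'⟩ | ⟨v, t, hv, ht0, ht1, h'⟩
  · rcases q with v | ω
    · obtain ⟨x, hx⟩ := seg_rung_eq_inner (T := T) v 0 (t := 1 / 2) (by norm_num) (by norm_num)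
      rw [tipPt, hx] at h'; cases h'
    · cases h'
  · exact congrArg Prod.snd (GraphPoint.vert.inj h')
  · cases h'
  · obtain ⟨x, hx⟩ := seg_rung_eq_inner (T := T) v j ht0 (by linarith)
    rw [hx] at h'; cases h'

theorem vert_mem_closure_interiorPoints {V : Type u} {G : SimpleGraph V} {Ψ : Set (Ends G)}
    {C : Set (Sym2 V)} (hC : C ⊆ G.edgeSet)
    {e : Sym2 V} (he : e ∈ C) {v : V} (hv : v ∈ e) {z : PsiSpace G Ψ} (hz : z.1 = .vert v) :
    z ∈ closure (interiorPoints G Ψ C) := by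
  rw [mem_closure_iff]
  rintro _ ⟨U, hU, rfl⟩ hzU
  rw [mem_preimage, hz] at hzU
  obtain ⟨ε, hε, hεU⟩ := hU.1 v hzU
  set r := min ε 1 / 2 with hr
  have hr0 : 0 < r := half_pos (lt_min hε one_pos)
  have hrε : r < ε := by linarith [min_le_left ε 1, lt_min hε one_pos]
  have hr1 : r < 1 := by linarith [min_le_right ε 1]
  set f : G.edgeSet := ⟨e, hC he⟩
  have hor : tail f = v ∨ head f = v := by
    have : v ∈ s(tail f, head f) := by rw [mk_tail_head]; exact hv
    exact (Sym2.mem_iff.1 this).imp Eq.symm Eq.symm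
  rcases hor with h | h
  · exact ⟨psiInner Ψ f ⟨r, hr0, hr1⟩, hεU _ _ (Or.inl ⟨h, hrε⟩), f, _, he, rfl⟩
  · exact ⟨psiInner Ψ f ⟨1 - r, by linarith, by linarith⟩,
      hεU _ _ (Or.inr ⟨h, by linarith⟩), f, _, he, rfl⟩

theorem hor_toward_right_mem_ladder (hT : T.IsTree) {x w : V} (h : T.Adj x w) {p q : Pt T}
    (hp : ¬ Beyond T x w p) (hq : Beyond T x w q) {n : ℕ}
    (hn : ∀ k ≤ n, q ≠ .inl (toward q w k)) (i : Fin 2) :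
    hor (toward q w n) (toward q w (n + 1)) i ∈ ladder p q := by
  obtain ⟨h1, h2⟩ := toward_step_separates hT hn
  have hadj := toward_adj hT (hn n le_rfl)
  have hmem := toward_mem_of_beyond hT h hq (mem_branch_self x w)
  refine Or.inl ⟨_, _, i, hadj, fun hp' => hp (Beyond.mono (branch_subset hT h (hmem _) ?_) hp'),
    h2, rfl⟩
  intro hx
  have := branch_cross hT hadj hx h h1
  exact notMem_branch hT h (this.1 ▸ hmem (n + 1))

theorem hor_toward_left_mem_ladder (hT : T.IsTree) {x w : V} (h : T.Adj x w) {p q : Pt T}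
    (hp : ¬ Beyond T x w p) (hq : Beyond T x w q) {n : ℕ}
    (hn : ∀ k ≤ n, p ≠ .inl (toward p w k)) (i : Fin 2) :
    hor (toward p w n) (toward p w (n + 1)) i ∈ ladder p q := by
  rw [ladder_comm hT]
  have hsub := branch_toward_subset hT (Nat.zero_le n) hn
  have h1 : toward p w (0 + 1) = x := next_eq hT h.symm ((beyond_swap hT h p).2 hp)
  rw [h1, toward_zero] at hsub
  exact Or.inl ⟨_, _, i, toward_adj hT (hn n le_rfl),
    fun hq' => (beyond_swap hT h q).1 (Beyond.mono hsub hq') hq, toward_beyond hT (hn n le_rfl), rfl⟩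

theorem OnHalf.mem_closure (hT : T.IsTree) {C : Set (Sym2 (V × Fin 2))}
    (hE : C ⊆ (timesK2 T).edgeSet) {q : Pt T} {w : V} (hrung : ∀ v, q = .inl v → rung v ∈ C)
    (hhor : ∀ n, (∀ k ≤ n, q ≠ .inl (toward q w k)) → ∀ i,
      hor (toward q w n) (toward q w (n + 1)) i ∈ C)
    {i : Fin 2} {z : PsiSpace (timesK2 T) Ψ}
    (hz : OnHalf q w i z.1) : z ∈ closure (interiorPoints (timesK2 T) Ψ C) := by
  have hinner : ∀ e x, e.1 ∈ C → z.1 = .inner e x →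
      z ∈ closure (interiorPoints (timesK2 T) Ψ C) := fun e x he hx =>
    subset_closure ⟨e, x, he, hx⟩
  rcases hz with h' | ⟨n, hn, h'⟩ | ⟨n, x, hE', hn, h'⟩ | ⟨v, t, rfl, ht0, ht1, h'⟩
  · rcases q with v | ω
    · obtain ⟨x, hx⟩ := seg_rung_eq_inner (T := T) v 0 (t := 1 / 2) (by norm_num) (by norm_num)
      exact hinner _ x (hrung v rfl) (h'.trans hx)
    · rw [mem_closure_iff]
      rintro _ ⟨U, hU, rfl⟩ hzU
      rw [mem_preimage, h'] at hzU
      obtain ⟨S, hS, hSU⟩ := hU.2.2 _ hzU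
      obtain ⟨N, hN⟩ := (towardRay hT ω w 0).walkPt_mem_endNhd hS
      rw [toEnd_towardRay] at hN
      have h1 := hN (N + 1 / 2) (by linarith)
      rw [walkPt_eq_seg _ (n := N) (by linarith) (by linarith), add_sub_cancel_left] at h1
      obtain ⟨x, hx, -⟩ := seg_eq_inner ((towardRay hT ω w 0).adj N) (t := 1 / 2)
        (by norm_num) (by norm_num)
      rw [hx] at h1
      exact ⟨psiInner Ψ _ x, hSU h1, _, x,
        hhor N (fun k _ => end_ne_inl) 0, rfl⟩
  · by_cases hqn : q = .inl (toward q w n)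
    · refine vert_mem_closure_interiorPoints hE (hrung _ hqn) ?_ h'
      rw [← mk_rung _ i]; simp
    · refine vert_mem_closure_interiorPoints hE
        (hhor n (fun k hk => ?_) i) ?_ h'
      · rcases hk.lt_or_eq with hk | rfl
        · exact hn k hk
        · exact hqn
      · simp [hor]
  · exact hinner _ x (hhor n hn i) h'
  · obtain ⟨x, hx⟩ := seg_rung_eq_inner (T := T) v i ht0 (by linarith)
    exact hinner _ x (hrung v rfl) (h'.trans hx)

theorem exists_onHalf_rung (v w : V) (x : Ioo (0 : ℝ) 1) :
    ∃ i, OnHalf (.inl v : Pt T) w i (.inner ⟨rung v, rung_mem_edgeSet v⟩ x) := by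
  obtain ⟨t, ht, hx⟩ := inner_mem_range_seg (adj_rung (T := T) v 0) x
  have hx' : seg (adj_rung (T := T) v 0) t = .inner ⟨rung v, rung_mem_edgeSet v⟩ x := hx
  rw [← hx']
  rcases lt_trichotomy t (1 / 2) with h | rfl | h
  · exact ⟨0, Or.inr (Or.inr (Or.inr ⟨v, t, rfl, ht.1, h, rfl⟩))⟩
  · exact ⟨0, Or.inl rfl⟩
  · refine ⟨1, Or.inr (Or.inr (Or.inr ⟨v, 1 - t, rfl, by linarith [ht.2], by linarith, ?_⟩))⟩
    rw [seg_rung_one, sub_sub_cancel]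

theorem onHalf_hor (hT : T.IsTree) {y z w : V} (h : T.Adj y z) {q : Pt T}
    (hq : Beyond T y z q) (hw : w ∉ branch T y z) (i : Fin 2) (x : Ioo (0 : ℝ) 1) :
    OnHalf q w i (.inner ⟨hor y z i, hor_mem_edgeSet.2 h⟩ x) := by
  obtain ⟨n, rfl, rfl⟩ := exists_toward_step hT h hw hq
  refine Or.inr (Or.inr (Or.inl ⟨n, x, _, fun k hk hqk => ?_, rfl⟩))
  -- The way to a vertex is constant once it has arrived, so a genuine edge on it cannot come after
  -- the arrival.
  have hstay : ∀ m ≥ k, toward q w m = toward q w k := by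
    intro m hm
    induction m, hm using Nat.le_induction with
    | base => rfl
    | succ m _ ih =>
      rw [toward_succ, ih]
      nth_rewrite 1 [hqk]
      exact next_self hT _
  exact h.ne ((hstay n hk).trans (hstay (n + 1) (by omega)).symm)

theorem isPsiCircuit_ladder (hT : T.IsTree) (hfin : ∀ v, (T.neighborSet v).Finite) {p q : Pt T}
    (hpq : p ≠ q) (hp : IsTerm Set.univ Ψ p) (hq : IsTerm Set.univ Ψ q) :
    IsPsiCircuit (timesK2 T) Ψ (ladder p q) := by
  have hG := finite_neighborSet_timesK2 hfin
  have := t2Space_psiSpace hG (Ψ := Ψ)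
  rw [isPsiCircuit_iff hG]
  refine ⟨ladder_subset_edgeSet p q, ?_⟩
  obtain ⟨x, w, h, hxp, hxq⟩ := exists_separating hT hpq
  have hwp := (beyond_swap hT h p).2 hxp
  have htip : ∀ r : Pt T, IsTerm Set.univ Ψ r → ∃ b : PsiSpace (timesK2 T) Ψ, b.1 = tipPt r := by
    rintro (v | ω) hr
    · obtain ⟨y, hy⟩ := seg_rung_eq_inner (T := T) v 0 (t := 1 / 2) (by norm_num) (by norm_num)
      exact ⟨psiInner Ψ _ y, hy.symm⟩
    · exact ⟨⟨.endPt ω, fun η hη => by cases hη; exact hr⟩, rfl⟩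
  obtain ⟨bp, hbp⟩ := htip p hp
  obtain ⟨bq, hbq⟩ := htip q hq
  let a : Fin 2 → PsiSpace (timesK2 T) Ψ := fun i => ⟨.vert (w, i), fun _ hη => by cases hη⟩
  have ha : ∀ i, (a i).1 = .vert (w, i) := fun _ => rfl
  -- Here `w` is an end of an edge separating `p` from `q`. At each level the half-arcs from `(w,
  -- i)` to the two tips join to one arc, and the arcs of the two levels meet exactly in the tips.
  choose γ hγ hγr using fun i => exists_halfArc hT (q := p) w i (ha i) hbp
  choose δ hδ hδr using fun i => exists_halfArc hT (q := q) w i (ha i) hbq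
  have hsides : ∀ i j (z : PsiSpace (timesK2 T) Ψ), OnHalf p w i z.1 → OnHalf q w j z.1 →
      i = j ∧ z = a i := fun i j z h1 h2 => by
    obtain ⟨h3, h4⟩ := OnHalf.eq_vert_of_sides hT h hxp hxq h1 h2
    exact ⟨h3, Subtype.ext h4⟩
  have hinj : ∀ i, Function.Injective ((γ i).symm.trans (δ i)) := by
    intro i
    refine Path.trans_injective ?_ (hδ i) ?_
    · intro s t hst
      exact unitInterval.symm_bijective.injective (hγ i hst)
    · intro z h1 h2
      rw [Path.symm_range] at h1
      exact (hsides i i z ((hγr i z).1 h1) ((hδr i z).1 h2)).2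
  have hran : ∀ i z, z ∈ range ((γ i).symm.trans (δ i)) ↔ OnHalf p w i z.1 ∨ OnHalf q w i z.1 := by
    intro i z
    rw [Path.trans_range, Path.symm_range, mem_union, hγr, hδr]
  have hinj1 : Function.Injective ((γ 1).symm.trans (δ 1)).symm := fun s t hst =>
    unitInterval.symm_bijective.injective (hinj 1 hst)
  have hcirc := nonempty_homeomorph_circle_of_arcs (hinj 0) hinj1 (by
    intro z h0 h1
    rw [Path.symm_range] at h1
    rw [hran] at h0 h1
    rcases h0 with h0 | h0 <;> rcases h1 with h1 | h1
    · exact Or.inl (Subtype.ext ((h0.tipPt_of_levels h1).trans hbp.symm))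
    · exact absurd (hsides 0 1 z h0 h1).1 (by decide)
    · exact absurd (hsides 1 0 z h1 h0).1 (by decide)
    · exact Or.inr (Subtype.ext ((h0.tipPt_of_levels h1).trans hbq.symm)))
  rw [Path.symm_range] at hcirc
  suffices hK : closure (interiorPoints (timesK2 T) Ψ (ladder p q)) =
      range ((γ 0).symm.trans (δ 0)) ∪ range ((γ 1).symm.trans (δ 1)) by rwa [hK]
  refine subset_antisymm (closure_minimal ?_ ?_) ?_
  · have hlev : ∀ (i : Fin 2) z, z ∈ range ((γ i).symm.trans (δ i)) →
        z ∈ range ((γ 0).symm.trans (δ 0)) ∪ range ((γ 1).symm.trans (δ 1)) := by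
      intro i z hz
      have : i = 0 ∨ i = 1 := by omega
      rcases this with rfl | rfl
      · exact Or.inl hz
      · exact Or.inr hz
    rintro z ⟨⟨e, hE⟩, y, he, hz⟩
    rcases he with ⟨c, d, i, hcd, h1, h2, heq⟩ | ⟨v, heq, hv⟩
    · have heq : e = hor c d i := heq
      subst heq
      refine hlev i z ((hran i z).2 ?_)
      rw [hz]
      by_cases hw : w ∈ branch T c d
      · left
        have hw' : w ∉ branch T d c := fun h' => (mem_branch_swap hT hcd w).1 h' hw
        have := onHalf_hor hT hcd.symm ((beyond_swap hT hcd p).2 h1) hw' i y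
        have he : (⟨hor d c i, hor_mem_edgeSet.2 hcd.symm⟩ : (timesK2 T).edgeSet) =
          ⟨hor c d i, hE⟩ := Subtype.ext (hor_comm d c i)
        rwa [he] at this
      · exact Or.inr (onHalf_hor hT hcd h2 hw i y)
    · have heq : e = rung v := heq
      subst heq
      obtain ⟨i, hi⟩ := exists_onHalf_rung (T := T) v w y
      refine hlev i z ((hran i z).2 ?_)
      rw [hz]
      rcases hv with rfl | rfl
      · exact Or.inl hi
      · exact Or.inr hi
  · exact (isCompact_range (Path.continuous _)).isClosed.union
      (isCompact_range (Path.continuous _)).isClosed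
  · have hboth : ∀ i z, z ∈ range ((γ i).symm.trans (δ i)) →
        z ∈ closure (interiorPoints (timesK2 T) Ψ (ladder p q)) := by
      intro i z hz
      rcases (hran i z).1 hz with hz | hz
      · exact hz.mem_closure hT (ladder_subset_edgeSet p q)
          (fun v hv => rung_mem_ladder.2 (Or.inl hv))
          fun n hn => hor_toward_left_mem_ladder hT h hxp hxq hn
      · exact hz.mem_closure hT (ladder_subset_edgeSet p q)
          (fun v hv => rung_mem_ladder.2 (Or.inr hv))
          fun n hn => hor_toward_right_mem_ladder hT h hxp hxq hn
    exact union_subset (hboth 0) (hboth 1)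

end LadderCircuit

section Maximality

variable {V : Type u} {T : SimpleGraph V} {Ψ : Set (Ends (timesK2 T))}

/-! ### Connections in a tree -/

theorem Conn.edge_mem (hT : T.IsTree) {F : Set (Sym2 V)} {x : V} {p : Pt T}
    (h : Conn F (.inl x) p) {n : ℕ} (hn : ∀ k ≤ n, p ≠ .inl (toward p x k)) :
    s(toward p x n, toward p x (n + 1)) ∈ F := by
  by_contra hF
  obtain ⟨h1, h2⟩ := toward_step_separates hT hn
  exact h1 ((h _ _ (toward_adj hT (hn n le_rfl)) hF).2 h2)

theorem ne_toward_of_step (hT : T.IsTree) {p : Pt T} {x : V} {n : ℕ}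
    (h : T.Adj (toward p x n) (toward p x (n + 1))) : ∀ k ≤ n, p ≠ .inl (toward p x k) := by
  intro k hk hqk
  have hstay : ∀ m ≥ k, toward p x m = toward p x k := by
    intro m hm
    induction m, hm using Nat.le_induction with
    | base => rfl
    | succ m _ ih =>
      rw [toward_succ, ih]
      nth_rewrite 1 [hqk]
      exact next_self hT _
  exact h.ne ((hstay n hk).trans (hstay (n + 1) (by omega)).symm)

/-- The edges that separate `x` from `p` are precisely those on the way from `x` to `p`, so only
these need to be in `F`. -/
theorem Conn.of_edges (hT : T.IsTree) {F : Set (Sym2 V)} {x : V} {p : Pt T}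
    (h : ∀ n, (∀ k ≤ n, p ≠ .inl (toward p x k)) → s(toward p x n, toward p x (n + 1)) ∈ F) :
    Conn F (.inl x) p := by
  have key : ∀ y z, T.Adj y z → s(y, z) ∉ F → Beyond T y z p → x ∈ branch T y z := by
    intro y z hyz hF hp
    by_contra hx
    obtain ⟨n, rfl, rfl⟩ := exists_toward_step hT hyz hx hp
    exact hF (h n (ne_toward_of_step hT hyz))
  intro y z hyz hF
  refine ⟨fun hx => ?_, key y z hyz hF⟩
  by_contra hp
  have := key z y hyz.symm (by rwa [Sym2.eq_swap]) ((beyond_swap hT hyz p).2 hp)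
  exact (mem_branch_swap hT hyz x).1 this hx

/-- Every vertex on the path between two connected points is connected to them. -/
theorem Conn.of_separating (hT : T.IsTree) {F : Set (Sym2 V)} {x w : V} {p q : Pt T}
    (hpq : Conn F p q) (h : T.Adj x w) (hp : ¬ Beyond T x w p) (hq : Beyond T x w q) :
    Conn F (.inl x) p := by
  have key : ∀ y z, T.Adj y z → s(y, z) ∉ F → Beyond T y z p → x ∈ branch T y z := by
    intro y z hyz hF hyp
    have hyq := (hpq y z hyz hF).1 hyp
    by_contra hx
    by_cases hz : z ∈ branch T x w
    · exact hp (Beyond.mono (branch_subset hT h hz hx) hyp)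
    · by_cases hw : w ∈ branch T y z
      · obtain ⟨rfl, rfl⟩ := branch_cross hT hyz hw h.symm hx
        exact hp hyp
      · refine (beyond_swap hT h q).1 (Beyond.mono (branch_subset hT h.symm ?_ hw) hyq) hq
        exact (mem_branch_swap hT h z).2 hz
  intro y z hyz hF
  refine ⟨fun hx => ?_, key y z hyz hF⟩
  by_contra hyp
  have := key z y hyz.symm (by rwa [Sym2.eq_swap]) ((beyond_swap hT hyz p).2 hyp)
  exact (mem_branch_swap hT hyz x).1 this hx

/-! ### Extensions that freeze terminated vertices -/

/-- No two terminals are connected. -/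
def NoCirc (Ψ : Set (Ends (timesK2 T))) (F : Set (Sym2 V)) (R : Set V) : Prop :=
  ∀ p q, IsTerm R Ψ p → IsTerm R Ψ q → Conn F p q → p = q

/-- The vertex `x` is connected to some terminal. -/
def Terminated (Ψ : Set (Ends (timesK2 T))) (F : Set (Sym2 V)) (R : Set V) (x : V) : Prop :=
  ∃ p, IsTerm R Ψ p ∧ Conn F (.inl x) p

theorem Terminated.mono {F F' : Set (Sym2 V)} {R R' : Set V} (hF : F ⊆ F') (hR : R ⊆ R') {x : V}
    (h : Terminated Ψ F R x) : Terminated Ψ F' R' x := by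
  obtain ⟨p, hp, hc⟩ := h
  exact ⟨p, hp.mono hR, hc.mono hF⟩

theorem Terminated.of_conn {F : Set (Sym2 V)} {R : Set V} {x y : V}
    (h : Terminated Ψ F R y) (hxy : Conn F (.inl x : Pt T) (.inl y)) : Terminated Ψ F R x := by
  obtain ⟨p, hp, hc⟩ := h
  exact ⟨p, hp, hxy.trans hc⟩

/-- Every terminated vertex of `a` is frozen in the extension `b` of `a`. -/
structure Freezes (Ψ : Set (Ends (timesK2 T))) (a b : Set (Sym2 V) × Set V) : Prop where
  edges : a.1 ⊆ b.1
  verts : a.2 ⊆ b.2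
  new_edge : ∀ e ∈ b.1, e ∉ a.1 → ∀ x ∈ e, ¬ Terminated Ψ a.1 a.2 x
  new_vert : ∀ x ∈ b.2, x ∉ a.2 → ¬ Terminated Ψ a.1 a.2 x

theorem Freezes.refl (a : Set (Sym2 V) × Set V) : Freezes Ψ a a :=
  ⟨Subset.rfl, Subset.rfl, fun _ h h' => absurd h h', fun _ h h' => absurd h h'⟩

theorem Freezes.trans {a b c : Set (Sym2 V) × Set V} (h : Freezes Ψ a b) (h' : Freezes Ψ b c) :
    Freezes Ψ a c := by
  refine ⟨h.edges.trans h'.edges, h.verts.trans h'.verts, fun e he hea x hx hterm => ?_,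
    fun x hx hxa hterm => ?_⟩
  · by_cases heb : e ∈ b.1
    · exact h.new_edge e heb hea x hx hterm
    · exact h'.new_edge e he heb x hx (hterm.mono h.edges h.verts)
  · by_cases hxb : x ∈ b.2
    · exact h.new_vert x hxb hxa hterm
    · exact h'.new_vert x hx hxb (hterm.mono h.edges h.verts)

/-- Follow the way from `x`: each vertex reached in the smaller stage is connected to `x` and hence
terminated there, so the next edge cannot be a new one. -/
theorem Freezes.conn (hT : T.IsTree) {a b : Set (Sym2 V) × Set V} (h : Freezes Ψ a b) {x : V}
    (hx : Terminated Ψ a.1 a.2 x) {p : Pt T} (hp : Conn b.1 (.inl x) p) :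
    Conn a.1 (.inl x) p := by
  have key : ∀ n, (∀ k < n, p ≠ .inl (toward p x k)) →
      Conn a.1 (.inl x : Pt T) (.inl (toward p x n)) ∧
        (p ≠ .inl (toward p x n) → s(toward p x n, toward p x (n + 1)) ∈ a.1) := by
    intro n
    induction n with
    | zero =>
      intro _
      refine ⟨Conn.refl _ _, fun h0 => ?_⟩
      by_contra hcon
      refine h.new_edge _ (hp.edge_mem hT fun k hk => ?_) hcon _ (Sym2.mem_mk_left _ _) hx
      rw [Nat.le_zero.1 hk]; exact h0
    | succ n ih =>
      intro hn
      obtain ⟨h1, h2⟩ := ih fun k hk => hn k (by omega)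
      have hne := hn n (by omega)
      have h3 := h1.trans (Conn.of_mem (toward_adj hT hne) (h2 hne))
      refine ⟨h3, fun h0 => ?_⟩
      by_contra hcon
      refine h.new_edge _ (hp.edge_mem hT fun k hk => ?_) hcon _ (Sym2.mem_mk_left _ _)
        (hx.of_conn h3.symm)
      rcases hk.lt_or_eq with hk | rfl
      · exact hn k hk
      · exact h0
  exact Conn.of_edges hT fun n hn => (key n fun k hk => hn k hk.le).2 (hn n le_rfl)

theorem Freezes.isTerm (hT : T.IsTree) {a b : Set (Sym2 V) × Set V} (h : Freezes Ψ a b) {x : V}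
    (hx : Terminated Ψ a.1 a.2 x) {p : Pt T} (hp : Conn b.1 (.inl x) p) (hb : IsTerm b.2 Ψ p) :
    IsTerm a.2 Ψ p := by
  rcases p with v | ω
  · by_contra hv
    exact h.new_vert v hb hv (hx.of_conn (h.conn hT hx hp).symm)
  · exact hb

/-- The vertex at which the path to `p` leaves the ray from `x` to `ω`. -/
theorem exists_gate (hT : T.IsTree) (x : V) {p : Pt T} {ω : Ends (timesK2 T)} (hp : p ≠ .inr ω) :
    ∃ m, ∀ j, (Beyond T (toward (.inr ω : Pt T) x j) (toward (.inr ω : Pt T) x (j + 1))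
        (.inl (toward (.inr ω : Pt T) x m)) ↔
      Beyond T (toward (.inr ω : Pt T) x j) (toward (.inr ω : Pt T) x (j + 1)) p) ∧
      (m ≤ j → ¬ Beyond T (toward (.inr ω : Pt T) x j) (toward (.inr ω : Pt T) x (j + 1)) p) := by
  classical
  set y : ℕ → V := toward (.inr ω : Pt T) x
  have hne : ∀ n, (.inr ω : Pt T) ≠ .inl (y n) := fun n => end_ne_inl
  have hex : ∃ m, ¬ Beyond T (y m) (y (m + 1)) p := by
    obtain ⟨a, b, hab, h1, h2⟩ := exists_separating hT hp
    rw [← toEnd_towardRay hT ω x 0, beyond_toEnd_iff hT hab] at h2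
    obtain ⟨N, hN⟩ := h2
    obtain ⟨n, hn⟩ := exists_disjoint_branch hT (S := {a}) (x := x) hne (finite_singleton a)
    refine ⟨max n N, fun hb => h1 (Beyond.mono (branch_subset hT hab
      (hN (max n N + 1) (by omega)) fun ha => ?_) hb)⟩
    exact hn a rfl (branch_toward_subset hT (le_max_left n N) (fun k _ => hne k) ha)
  refine ⟨Nat.find hex, fun j => ?_⟩
  have hlate : Nat.find hex ≤ j → ¬ Beyond T (y j) (y (j + 1)) p := fun hj hb =>
    Nat.find_spec hex (Beyond.mono (branch_toward_subset hT hj fun k _ => hne k) hb)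
  refine ⟨?_, hlate⟩
  rcases lt_or_ge j (Nat.find hex) with hj | hj
  · exact iff_of_true (toward_mem_branch hT hj fun k _ => hne k) (not_not.1 (Nat.find_min hex hj))
  · exact iff_of_false (toward_notMem_branch hT hj fun k _ => hne k) (hlate hj)

/-- There is an extension in which every admissible vertex and every admissible ray to an end in
`Ψ` meets a terminated vertex. -/
theorem exists_terminating_extension (hT : T.IsTree) {F₀ A : Set (Sym2 V)} {R₀ B : Set V}
    (hFA : F₀ ⊆ A) (hRB : R₀ ⊆ B) (h0 : NoCirc Ψ F₀ R₀) :
    ∃ F R, F₀ ⊆ F ∧ F ⊆ A ∧ R₀ ⊆ R ∧ R ⊆ B ∧ NoCirc Ψ F R ∧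
      (∀ v ∈ B, v ∉ R → Terminated Ψ F R v) ∧
      ∀ x, ∀ ω ∈ Ψ, Conn A (.inl x) (.inr ω : Pt T) →
        ∃ n, Terminated Ψ F R (toward (.inr ω : Pt T) x n) := by
  classical
  -- The last clause restricts new edges to terminated vertices. Without it the union of a chain
  -- could terminate a vertex that no stage terminates.
  let Good : Set (Sym2 V) × Set V → Prop := fun a =>
    F₀ ⊆ a.1 ∧ a.1 ⊆ A ∧ R₀ ⊆ a.2 ∧ a.2 ⊆ B ∧ NoCirc Ψ a.1 a.2 ∧
      ∀ e ∈ a.1, e ∉ F₀ → ∀ x ∈ e, Terminated Ψ a.1 a.2 x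
  let S := {a : Set (Sym2 V) × Set V // Good a}
  have : Nonempty S := ⟨⟨(F₀, R₀), Subset.rfl, hFA, Subset.rfl, hRB, h0, fun e h h' => absurd h h'⟩⟩
  obtain ⟨⟨⟨F, R⟩, hF0, hFA', hR0, hRB', hNC, htouch⟩, hmax⟩ :=
    exists_maximal_of_nonempty_chains_bounded (α := S) (r := fun a b => Freezes Ψ a.1 b.1) (by
      intro c hc ⟨s₀, hs₀⟩
      have hle : ∀ a ∈ c, ∀ b ∈ c, Freezes Ψ a.1 b.1 ∨ Freezes Ψ b.1 a.1 := by
        intro a ha b hb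
        by_cases hab : a = b
        · subst hab; exact Or.inl (Freezes.refl _)
        · exact hc ha hb hab
      let F : Set (Sym2 V) := {e | ∃ a ∈ c, e ∈ a.1.1}
      let R : Set V := {v | ∃ a ∈ c, v ∈ a.1.2}
      have hup : ∀ a ∈ c, Freezes Ψ a.1 (F, R) := by
        intro a ha
        refine ⟨fun e he => ⟨a, ha, he⟩, fun v hv => ⟨a, ha, hv⟩, ?_, ?_⟩
        · rintro e ⟨b, hb, heb⟩ hea x hx
          rcases hle a ha b hb with h | h
          · exact h.new_edge e heb hea x hx
          · exact absurd (h.edges heb) hea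
        · rintro v ⟨b, hb, hvb⟩ hva
          rcases hle a ha b hb with h | h
          · exact h.new_vert v hvb hva
          · exact absurd (h.verts hvb) hva
      -- If no stage terminated `x`, the way from `x` to its terminal in the union could use no edge
      -- outside `F₀`, since new edges touch only terminated vertices. But then the connection
      -- already exists at some stage.
      have hstage : ∀ x, Terminated Ψ F R x → ∃ a ∈ c, Terminated Ψ a.1.1 a.1.2 x := by
        rintro x ⟨p, hp, hxp⟩
        by_contra! hcon
        have hno : ∀ y, Conn F₀ (.inl x : Pt T) (.inl y) → ∀ a ∈ c, ¬ Terminated Ψ a.1.1 a.1.2 y :=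
          fun y hy a ha hterm => hcon a ha (hterm.of_conn (hy.mono a.2.1))
        have hedge : ∀ n, (∀ k ≤ n, p ≠ .inl (toward p x k)) →
            Conn F₀ (.inl x : Pt T) (.inl (toward p x n)) →
            s(toward p x n, toward p x (n + 1)) ∈ F₀ := by
          intro n hn hc0
          obtain ⟨a, ha, hea⟩ := hxp.edge_mem hT hn
          by_contra hcon'
          exact hno _ hc0 a ha (a.2.2.2.2.2.2 _ hea hcon' _ (Sym2.mem_mk_left _ _))
        have hall : ∀ n, (∀ k < n, p ≠ .inl (toward p x k)) →
            Conn F₀ (.inl x : Pt T) (.inl (toward p x n)) := by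
          intro n
          induction n with
          | zero => exact fun _ => Conn.refl _ _
          | succ n ih =>
            intro hn
            have h1 := ih fun k hk => hn k (by omega)
            exact h1.trans (Conn.of_mem (toward_adj hT (hn n (by omega)))
              (hedge n (fun k hk => hn k (by omega)) h1))
        have hxp0 : Conn F₀ (.inl x) p :=
          Conn.of_edges hT fun n hn => hedge n hn (hall n fun k hk => hn k hk.le)
        rcases p with v | ω
        · obtain ⟨a, ha, hva⟩ := hp
          exact hcon a ha ⟨.inl v, hva, hxp0.mono a.2.1⟩
        · exact hcon s₀ hs₀ ⟨.inr ω, hp, hxp0.mono s₀.2.1⟩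
      refine ⟨⟨(F, R), fun e he => ⟨s₀, hs₀, s₀.2.1 he⟩, ?_, fun v hv => ⟨s₀, hs₀, s₀.2.2.2.1 hv⟩,
        ?_, ?_, ?_⟩, hup⟩
      · rintro e ⟨a, -, he⟩; exact a.2.2.1 he
      · rintro v ⟨a, -, hv⟩; exact a.2.2.2.2.1 hv
      · intro p q hp hq hpq
        by_contra hne
        -- A vertex between two connected terminals is terminated at some stage. Both connections
        -- are frozen from there on, contradicting `NoCirc` at that stage.
        obtain ⟨x, w, h, h1, h2⟩ := exists_separating hT hne
        have hxp := hpq.of_separating hT h h1 h2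
        have hxq := hxp.trans hpq
        obtain ⟨a, ha, hterm⟩ := hstage x ⟨p, hp, hxp⟩
        have hfr := hup a ha
        exact hne (a.2.2.2.2.2.1 p q (hfr.isTerm hT hterm hxp hp) (hfr.isTerm hT hterm hxq hq)
          ((hfr.conn hT hterm hxp).symm.trans (hfr.conn hT hterm hxq)))
      · rintro e ⟨a, ha, hea⟩ he0 x hx
        exact (a.2.2.2.2.2.2 e hea he0 x hx).mono (hup a ha).edges (hup a ha).verts)
      (fun h h' => h.trans h')
  simp only at hF0 hFA' hR0 hRB' hNC htouch
  refine ⟨F, R, hF0, hFA', hR0, hRB', hNC, fun v hvB hvR => ?_, fun x ω hω hxω => ?_⟩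
  · by_contra hterm
    have hgood : Good (F, insert v R) := by
      refine ⟨hF0, hFA', hR0.trans (subset_insert _ _), insert_subset hvB hRB', ?_,
        fun e he he0 x hx => (htouch e he he0 x hx).mono Subset.rfl (subset_insert _ _)⟩
      have key : ∀ p, IsTerm (insert v R) Ψ p → p = .inl v ∨ IsTerm R Ψ p := by
        rintro (u | ω) hp
        · exact hp.imp (fun h => by rw [h]) id
        · exact Or.inr hp
      intro p q hp hq hpq
      rcases key p hp with rfl | hp <;> rcases key q hq with rfl | hq
      · rfl
      · exact absurd ⟨q, hq, hpq⟩ hterm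
      · exact absurd ⟨p, hp, hpq.symm⟩ hterm
      · exact hNC p q hp hq hpq
    have := hmax ⟨(F, insert v R), hgood⟩ ⟨Subset.rfl, subset_insert _ _,
      fun e h h' => absurd h h', by
        rintro y (rfl | hy) hyR
        · exact hterm
        · exact absurd hy hyR⟩
    exact hvR (this.verts (mem_insert _ _))
  -- If the ray met no terminated vertex, all its edges could be added at once. By `exists_gate`,
  -- any terminal other than `ω` that became connected to the ray would already terminate a vertex
  -- of it, so `ω` is the only terminal it gains and maximality is violated.
  · by_contra! hterm
    let y : ℕ → V := toward (.inr ω : Pt T) x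
    have hne : ∀ n, (.inr ω : Pt T) ≠ .inl (y n) := fun n => end_ne_inl
    let P : Set (Sym2 V) := {e | ∃ n, e = s(y n, y (n + 1))}
    have hPv : ∀ e ∈ P, ∀ z ∈ e, ∃ n, z = y n := by
      rintro e ⟨n, rfl⟩ z hz
      rcases Sym2.mem_iff.1 hz with rfl | rfl
      · exact ⟨n, rfl⟩
      · exact ⟨n + 1, rfl⟩
    have hyω : ∀ n, Conn (F ∪ P) (.inl (y n)) (.inr ω : Pt T) := by
      have hx : Conn (F ∪ P) (.inl x) (.inr ω : Pt T) :=
        Conn.of_edges hT fun n _ => Or.inr ⟨n, rfl⟩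
      intro n
      induction n with
      | zero => exact hx
      | succ n ih => exact (Conn.of_mem (toward_adj hT (hne n)) (Or.inr ⟨n, rfl⟩)).symm.trans ih
    -- a terminal that is connected to the ray is the end of the ray
    have honly : ∀ n p, IsTerm R Ψ p → Conn (F ∪ P) (.inl (y n)) p → p = .inr ω := by
      intro n p hp hc
      by_contra hpω
      obtain ⟨m, hm⟩ := exists_gate hT x hpω
      have hc' : Conn (F ∪ P) (.inl (y m)) p := (hyω m).trans ((hyω n).symm.trans hc)
      refine hterm m ⟨p, hp, fun a b hab habF => ?_⟩
      by_cases habP : s(a, b) ∈ P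
      · obtain ⟨j, hj⟩ := habP
        rcases Sym2.eq_iff.1 hj with ⟨rfl, rfl⟩ | ⟨rfl, rfl⟩
        · exact (hm j).1
        · rw [beyond_swap hT hab.symm, beyond_swap hT hab.symm]
          exact not_congr (hm j).1
      · exact hc' a b hab fun h => h.elim habF habP
    have hgood : Good (F ∪ P, R) := by
      refine ⟨hF0.trans subset_union_left, union_subset hFA' ?_, hR0, hRB', ?_, ?_⟩
      · rintro e ⟨n, rfl⟩
        exact hxω.edge_mem hT fun k _ => hne k
      · intro p q hp hq hpq
        by_contra hpq'
        have hF : ¬ Conn F p q := fun h => hpq' (hNC p q hp hq h)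
        rw [Conn] at hF
        push Not at hF
        obtain ⟨a, b, hab, habF, hsep⟩ := hF
        have habP : s(a, b) ∈ P := by
          by_contra h
          have := hpq a b hab fun h' => h'.elim habF h
          tauto
        obtain ⟨n, hn⟩ := hPv _ habP a (Sym2.mem_mk_left _ _)
        have hap : Conn (F ∪ P) (.inl a) p := by
          by_cases h1 : Beyond T a b p
          · have h2 : ¬ Beyond T a b q := by tauto
            exact (hpq.symm.of_separating hT hab h2 h1).trans hpq.symm
          · exact hpq.of_separating hT hab h1 (by tauto)
        rw [hn] at hap
        exact hpq' ((honly n p hp hap).trans (honly n q hq (hap.trans hpq)).symm)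
      · rintro e (he | he) he0 z hz
        · exact (htouch e he he0 z hz).mono subset_union_left Subset.rfl
        · obtain ⟨n, rfl⟩ := hPv e he z hz
          exact ⟨.inr ω, hω, hyω n⟩
    have := hmax ⟨(F ∪ P, R), hgood⟩ ⟨subset_union_left, Subset.rfl, ?_,
      fun e h h' => absurd h h'⟩
    · have hF : ∀ n, s(y n, y (n + 1)) ∈ F := fun n => this.edges (Or.inr ⟨n, rfl⟩)
      exact hterm 0 ⟨.inr ω, hω, Conn.of_edges hT fun n _ => hF n⟩
    · rintro e (he | he) heF z hz
      · exact absurd he heF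
      · obtain ⟨n, rfl⟩ := hPv e he z hz
        exact hterm n

end Maximality

/-! ### Maximal circuit-free sets, the matroid, and the shape of its bonds -/

section Existence

variable {V : Type u} {T : SimpleGraph V} {Ψ : Set (Ends (timesK2 T))}

/-- A connection between two vertices uses finitely many edges, so it is already present in one
member of the chain. For ends this compactness fails, which is why the terminating extension is
needed. -/
theorem Conn.exists_mem_chain (hT : T.IsTree) {c : Set (Set (Sym2 V))} (hc : IsChain (· ⊆ ·) c)
    (hne : c.Nonempty) {y z : V} (h : Conn (⋃₀ c) (.inl y : Pt T) (.inl z)) :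
    ∃ F ∈ c, Conn F (.inl y : Pt T) (.inl z) := by
  have key : ∀ n, ∃ F ∈ c, Conn F (.inl y : Pt T) (.inl (toward (.inl z : Pt T) y n)) := by
    intro n
    induction n with
    | zero => exact ⟨_, hne.some_mem, Conn.refl _ _⟩
    | succ n ih =>
      obtain ⟨F, hF, hyn⟩ := ih
      by_cases hn : ∀ k ≤ n, (.inl z : Pt T) ≠ .inl (toward (.inl z : Pt T) y k)
      · obtain ⟨F', hF', he⟩ := h.edge_mem hT hn
        have hadj := toward_adj hT (hn n le_rfl)
        rcases hc.total hF hF' with hsub | hsub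
        · exact ⟨F', hF', (hyn.mono hsub).trans (Conn.of_mem hadj he)⟩
        · exact ⟨F, hF, hyn.trans (Conn.of_mem hadj (hsub he))⟩
      · refine ⟨F, hF, ?_⟩
        have : toward (.inl z : Pt T) y (n + 1) = toward (.inl z : Pt T) y n := by
          by_contra hne'
          refine hn (ne_toward_of_step hT ?_)
          refine toward_adj hT fun heq => hne' ?_
          rw [toward_succ]
          nth_rewrite 1 [heq]
          exact next_self hT _
        rwa [this]
  obtain ⟨n, hn⟩ := exists_toward_eq hT z y
  have := key n
  rwa [hn] at this

/-- Maximal extensions of terminal-free connections. -/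
theorem exists_maximal_noCirc (hT : T.IsTree) {F₀ A : Set (Sym2 V)} {R₀ B : Set V}
    (hFA : F₀ ⊆ A) (hRB : R₀ ⊆ B) (h0 : NoCirc Ψ F₀ R₀) :
    ∃ F R, F₀ ⊆ F ∧ F ⊆ A ∧ R₀ ⊆ R ∧ R ⊆ B ∧ NoCirc Ψ F R ∧
      (∀ v ∈ B, v ∉ R → Terminated Ψ F R v) ∧
      ∀ e ∈ A, e ∉ F → ¬ NoCirc Ψ (insert e F) R := by
  obtain ⟨F₁, R, hF01, hF1A, hR0, hRB', hNC, hvert, hend⟩ :=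
    exists_terminating_extension hT hFA hRB h0
  -- The vertex set `R` is now fixed and only edges are added, ordered by inclusion.
  obtain ⟨F, hF1, hF⟩ := zorn_subset_nonempty {F | F₁ ⊆ F ∧ F ⊆ A ∧ NoCirc Ψ F R} (by
      intro c hcS hc hne
      have hsub : F₁ ⊆ ⋃₀ c := by
        obtain ⟨F, hF⟩ := hne
        exact (hcS hF).1.trans (subset_sUnion_of_mem hF)
      have hsubA : ⋃₀ c ⊆ A := sUnion_subset fun F hF => (hcS hF).2.1
      refine ⟨⋃₀ c, ⟨hsub, hsubA, ?_⟩,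
        fun F hF => subset_sUnion_of_mem hF⟩
      -- A connection to an end in the union may start far from the end; it suffices that some
      -- vertex is connected to the end within one member of the chain. The remaining connections
      -- are between vertices and hence finite.
      have hreach : ∀ x p, IsTerm R Ψ p → Conn (⋃₀ c) (.inl x) p →
          ∃ z, ∃ F ∈ c, Conn F (.inl z) p := by
        rintro x (v | ω) hp hxp
        · exact ⟨v, _, hne.some_mem, Conn.refl _ _⟩
        let y : ℕ → V := toward (.inr ω : Pt T) x
        have hyne : ∀ n, (.inr ω : Pt T) ≠ .inl (y n) := fun n => end_ne_inl
        have hyω : ∀ n, Conn (⋃₀ c) (.inl (y n)) (.inr ω : Pt T) := by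
          intro n
          induction n with
          | zero => exact hxp
          | succ n ih =>
            exact (Conn.of_mem (toward_adj hT (hyne n))
              (hxp.edge_mem hT fun k _ => hyne k)).symm.trans ih
        have hlate : ∀ N, ∃ n ≥ N, Terminated Ψ F₁ R (y n) := by
          intro N
          obtain ⟨n, hn⟩ := hend (y N) ω hp ((hyω N).mono hsubA)
          rw [← toward_add] at hn
          exact ⟨N + n, by omega, hn⟩
        obtain ⟨n₀, -, p₀, hp₀, hyp₀⟩ := hlate 0
        by_cases hpω : p₀ = .inr ω
        · subst hpω
          exact ⟨y n₀, _, hne.some_mem, hyp₀.mono (hcS hne.some_mem).1⟩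
        -- The ray meets terminated vertices arbitrarily late. Each pair of them is connected in
        -- some member of the chain, so all have the same terminal `p₀`. Past the gate of `p₀`,
        -- every edge of the ray separates a later terminated vertex from `p₀`, and so belongs to
        -- `F₁`.
        obtain ⟨m, hm⟩ := exists_gate hT x hpω
        refine ⟨y m, _, hne.some_mem, Conn.mono (hcS hne.some_mem).1 (Conn.of_edges hT ?_)⟩
        intro j _
        rw [← toward_add, ← toward_add, ← add_assoc]
        obtain ⟨n, hn, p₁, hp₁, hyp₁⟩ := hlate (m + j + 1)
        obtain ⟨F, hF, hFn⟩ := Conn.exists_mem_chain hT hc hne ((hyω n).trans (hyω n₀).symm)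
        have hsubF := (hcS hF).1
        obtain rfl : p₁ = p₀ := (hcS hF).2.2 p₁ p₀ hp₁ hp₀
          ((hyp₁.mono hsubF).symm.trans (hFn.trans (hyp₀.mono hsubF)))
        by_contra hcon
        exact (hm (m + j)).2 (by omega) ((hyp₁ _ _ (toward_adj hT (hyne _)) hcon).1
          (toward_mem_branch hT (by omega) fun k _ => hyne k))
      intro p q hp hq hpq
      by_contra hpq'
      obtain ⟨x, w, h, h1, h2⟩ := exists_separating hT hpq'
      have hxp := hpq.of_separating hT h h1 h2
      obtain ⟨z, F, hF, hzp⟩ := hreach x p hp hxp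
      obtain ⟨z', F', hF', hzq⟩ := hreach x q hq (hxp.trans hpq)
      have hzz : Conn (⋃₀ c) (.inl z : Pt T) (.inl z') :=
        (hzp.mono (subset_sUnion_of_mem hF)).trans
          (hpq.trans (hzq.mono (subset_sUnion_of_mem hF')).symm)
      obtain ⟨F'', hF'', hzz'⟩ := Conn.exists_mem_chain hT hc hne hzz
      obtain ⟨H, hH, h3, h4, h5⟩ : ∃ H ∈ c, F ⊆ H ∧ F' ⊆ H ∧ F'' ⊆ H := by
        obtain ⟨H, hH, h3, h4⟩ := hc.directedOn F hF F' hF'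
        obtain ⟨H', hH', h5, h6⟩ := hc.directedOn H hH F'' hF''
        exact ⟨H', hH', h3.trans h5, h4.trans h5, h6⟩
      exact hpq' ((hcS hH).2.2 p q hp hq
        ((hzp.mono h3).symm.trans ((hzz'.mono h5).trans (hzq.mono h4)))))
    F₁ ⟨Subset.rfl, hF1A, hNC⟩
  refine ⟨F, R, hF01.trans hF1, hF.prop.2.1, hR0, hRB', hF.prop.2.2,
    fun v hv hvR => (hvert v hv hvR).mono hF1 Subset.rfl, fun e he heF hcon => heF ?_⟩
  exact hF.le_of_ge (y := insert e F) ⟨hF1.trans (subset_insert _ _),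
    insert_subset he hF.prop.2.1, hcon⟩ (subset_insert _ _) (mem_insert _ _)

theorem ladder_subset_iff (hT : T.IsTree) {P : Set (Sym2 (V × Fin 2))} {p q : Pt T} :
    ladder p q ⊆ P ↔ Conn (bothIn P) p q ∧ (∀ v, p = .inl v → rung v ∈ P) ∧
      ∀ v, q = .inl v → rung v ∈ P := by
  constructor
  · intro h
    refine ⟨fun x w hxw hF => ?_, fun v hv => h (rung_mem_ladder.2 (Or.inl hv)),
      fun v hv => h (rung_mem_ladder.2 (Or.inr hv))⟩
    by_contra hsep
    exact hF (mem_bothIn.2 fun i => h ((hor_mem_ladder hT hxw).2 hsep))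
  · rintro ⟨h1, h2, h3⟩ e he
    rcases edge_cases (ladder_subset_edgeSet _ _ he) with ⟨x, w, i, hxw, rfl⟩ | ⟨v, rfl⟩
    · by_contra hP
      exact (hor_mem_ladder hT hxw).1 he (h1 x w hxw fun hF => hP (mem_bothIn.1 hF i))
    · exact (rung_mem_ladder.1 he).elim (h2 v) (h3 v)

theorem isTerm_rung_iff {P : Set (Sym2 (V × Fin 2))} {p : Pt T} :
    IsTerm {v | rung v ∈ P} Ψ p ↔ IsTerm Set.univ Ψ p ∧ ∀ v, p = .inl v → rung v ∈ P := by
  rcases p with v | ω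
  · exact ⟨fun h => ⟨trivial, fun w hw => Sum.inl.inj hw ▸ h⟩, fun h => h.2 v rfl⟩
  · exact ⟨fun h => ⟨h, fun w hw => by cases hw⟩, fun h => h.1⟩

/-- Paint `C \ {e}` for an edge `e` of the circuit `C`. A bounded cut through `e` would meet `C` in
`e` alone, which is impossible. So there is a ladder inside `C`, and it is all of `C`. -/
theorem isPsiCircuit_iff_ladder (hT : T.IsTree) (hfin : ∀ v, (T.neighborSet v).Finite)
    {C : Set (Sym2 (V × Fin 2))} :
    IsPsiCircuit (timesK2 T) Ψ C ↔
      ∃ p q, p ≠ q ∧ IsTerm Set.univ Ψ p ∧ IsTerm Set.univ Ψ q ∧ C = ladder p q := by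
  have hG := finite_neighborSet_timesK2 hfin
  constructor
  · intro hC
    obtain ⟨e, he⟩ := hC.nonempty hG
    rcases exists_ladder_or_cut hT Ψ (hC.1 he) (P := C \ {e}) (by simp) with
      ⟨p, q, hpq, hp, hq, -, hsub⟩ | ⟨W, heW, hdisj, hav, -⟩
    · rw [insert_sdiff_singleton, insert_eq_of_mem he] at hsub
      exact ⟨p, q, hpq, hp, hq,
        ((isPsiCircuit_ladder hT hfin hpq hp hq).eq_of_subset hG hC hsub).symm⟩
    · refine absurd ?_ (hC.inter_cut_ne_singleton hG hav e)
      ext f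
      constructor
      · rintro ⟨hfC, hfW⟩
        by_contra hne
        exact disjoint_left.1 hdisj hfW ⟨hfC, hne⟩
      · rintro rfl; exact ⟨he, heW⟩
  · rintro ⟨p, q, hpq, hp, hq, rfl⟩
    exact isPsiCircuit_ladder hT hfin hpq hp hq

/-- Whether a set contains a ladder depends only on its rungs and on the edges of `T` of which it
has both copies. So the problem is solved in the tree and the solution is lifted. -/
theorem exists_maximal_circuitFree (hT : T.IsTree) (hfin : ∀ v, (T.neighborSet v).Finite)
    {I X : Set (Sym2 (V × Fin 2))} (hIX : I ⊆ X) (hX : X ⊆ (timesK2 T).edgeSet)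
    (hI : ∀ C ⊆ I, ¬ IsPsiCircuit (timesK2 T) Ψ C) :
    ∃ J, I ⊆ J ∧ J ⊆ X ∧ (∀ C ⊆ J, ¬ IsPsiCircuit (timesK2 T) Ψ C) ∧
      ∀ x ∈ X \ J, ∃ C, IsPsiCircuit (timesK2 T) Ψ C ∧ C ⊆ insert x J := by
  classical
  have hNC : NoCirc Ψ (bothIn I) {v | rung v ∈ I} := by
    intro p q hp hq hpq
    by_contra hne
    rw [isTerm_rung_iff] at hp hq
    exact hI (ladder p q) ((ladder_subset_iff hT).2 ⟨hpq, hp.2, hq.2⟩)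
      (isPsiCircuit_ladder hT hfin hne hp.1 hq.1)
  obtain ⟨F, R, hF0, hFX, hR0, hRX, hFR, hvert, hedge⟩ := exists_maximal_noCirc hT
    (A := bothIn X) (B := {v | rung v ∈ X}) (fun t (ht : t ∈ bothIn I) x w hxw i => hIX (ht x w hxw i))
    (fun v (hv : rung v ∈ I) => hIX hv) hNC
  have hlevel : ∀ t : Sym2 V, ∃ k : Fin 2, t ∉ F → ∀ x w i, t = s(x, w) → hor x w i ∈ I →
      i = k := by
    intro t
    induction t with | _ a b =>
    by_cases htF : s(a, b) ∈ F
    · exact ⟨0, fun h => absurd htF h⟩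
    have hnot : ¬ ∀ i, hor a b i ∈ I := fun h => htF (hF0 (mem_bothIn.2 h))
    push Not at hnot
    obtain ⟨j, hj⟩ := hnot
    -- `j` is a copy missing from `I`, so keeping the other one preserves whatever `I` contains.
    refine ⟨j + 1, fun _ x w i heq hi => ?_⟩
    rw [show hor x w i = hor a b i from hor_inj.2 ⟨rfl, heq.symm⟩] at hi
    have hij : i ≠ j := by rintro rfl; exact hj hi
    clear hi hj
    revert i j; decide
  choose k hk using hlevel
  -- Both copies are kept over `F`. Over an edge of which `X` lacks a copy, everything in `X` is
  -- harmless and kept. Over any other edge exactly the copy `k` is kept, so that adding its partner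
  -- amounts to adding the edge to `F`.
  let J : Set (Sym2 (V × Fin 2)) := {e | e ∈ X ∧ ((∃ v ∈ R, e = rung v) ∨
    ∃ x w i, e = hor x w i ∧ (s(x, w) ∈ F ∨ (∃ j, hor x w j ∉ X) ∨ i = k s(x, w)))}
  have hJrung : ∀ v, rung v ∈ J ↔ v ∈ R := by
    intro v
    constructor
    · rintro ⟨-, ⟨w, hw, heq⟩ | ⟨x, w, i, heq, -⟩⟩
      · rwa [rung_inj.1 heq]
      · exact absurd heq rung_ne_hor
    · exact fun hv => ⟨hRX hv, Or.inl ⟨v, hv, rfl⟩⟩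
  have hJhor : ∀ x w i, hor x w i ∈ J ↔
      hor x w i ∈ X ∧ (s(x, w) ∈ F ∨ (∃ j, hor x w j ∉ X) ∨ i = k s(x, w)) := by
    intro x w i
    constructor
    · rintro ⟨hXe, ⟨v, -, heq⟩ | ⟨x', w', i', heq, h⟩⟩
      · exact absurd heq.symm rung_ne_hor
      · obtain ⟨rfl, hs⟩ := hor_inj.1 heq
        refine ⟨hXe, ?_⟩
        rw [hs]
        refine h.imp id (Or.imp ?_ id)
        rintro ⟨j, hj⟩
        exact ⟨j, by rwa [show hor x w j = hor x' w' j from hor_inj.2 ⟨rfl, hs⟩]⟩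
    · exact fun h => ⟨h.1, Or.inr ⟨x, w, i, rfl, h.2⟩⟩
  have hJF : ∀ x w, s(x, w) ∈ bothIn J → s(x, w) ∈ F := by
    intro x w h
    by_contra hF
    have h' : ∀ i, i = k s(x, w) := fun i =>
      (((hJhor x w i).1 (mem_bothIn.1 h i)).2.resolve_left hF).resolve_left fun ⟨j, hj⟩ =>
        hj ((hJhor x w j).1 (mem_bothIn.1 h j)).1
    exact absurd ((h' 0).trans (h' 1).symm) (by decide)
  have hFJ : F ⊆ bothIn J := fun t ht x w htx i =>
    (hJhor x w i).2 ⟨hFX ht x w htx i, Or.inl (htx ▸ ht)⟩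
  refine ⟨J, ?_, fun e he => he.1, ?_, ?_⟩
  · intro e he
    rcases edge_cases (hX (hIX he)) with ⟨x, w, i, h, rfl⟩ | ⟨v, rfl⟩
    · refine (hJhor x w i).2 ⟨hIX he, ?_⟩
      by_cases hF : s(x, w) ∈ F
      · exact Or.inl hF
      · exact Or.inr (Or.inr (hk _ hF x w i rfl he))
    · exact (hJrung v).2 (hR0 he)
  · intro C hCJ hC
    obtain ⟨p, q, hpq, hp, hq, rfl⟩ := (isPsiCircuit_iff_ladder hT hfin).1 hC
    obtain ⟨h1, h2, h3⟩ := (ladder_subset_iff hT).1 hCJ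
    have hset : {v | rung v ∈ J} = R := ext hJrung
    refine hpq (hFR p q ?_ ?_ fun x w hxw hF => h1 x w hxw fun h => hF (hJF x w h))
    · rw [← hset, isTerm_rung_iff]; exact ⟨hp, h2⟩
    · rw [← hset, isTerm_rung_iff]; exact ⟨hq, h3⟩
  · rintro e ⟨heX, heJ⟩
    have hset : R = {v | rung v ∈ J} := (ext hJrung).symm
    rcases edge_cases (hX heX) with ⟨x, w, i, h, rfl⟩ | ⟨v, rfl⟩
    · rw [hJhor] at heJ
      push Not at heJ
      obtain ⟨h1, h2, h3⟩ := heJ heX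
      have hbad := hedge s(x, w) (mem_bothIn.2 h2) h1
      rw [NoCirc] at hbad
      push Not at hbad
      obtain ⟨p, q, hp, hq, hc, hne⟩ := hbad
      rw [hset, isTerm_rung_iff] at hp hq
      refine ⟨ladder p q, isPsiCircuit_ladder hT hfin hne hp.1 hq.1, (ladder_subset_iff hT).2
        ⟨hc.mono ?_, fun v hv => Or.inr (hp.2 v hv), fun v hv => Or.inr (hq.2 v hv)⟩⟩
      rintro t (rfl | ht)
      · refine mem_bothIn.2 fun j => ?_
        by_cases hji : j = i
        · exact Or.inl (by rw [hji])
        · refine Or.inr ((hJhor x w j).2 ⟨h2 j, Or.inr (Or.inr ?_)⟩)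
          generalize k s(x, w) = l at h3
          clear * - hji h3
          revert i j l; decide
      · exact fun y z hyz j => Or.inr (hFJ ht y z hyz j)
    · rw [hJrung] at heJ
      obtain ⟨p, hp, hc⟩ := hvert v heX heJ
      have hne : (.inl v : Pt T) ≠ p := by rintro rfl; exact heJ hp
      rw [hset, isTerm_rung_iff] at hp
      refine ⟨ladder (.inl v) p, isPsiCircuit_ladder hT hfin hne trivial hp.1,
        (ladder_subset_iff hT).2 ⟨hc.mono ?_, ?_, fun v hv => Or.inr (hp.2 v hv)⟩⟩
      · exact fun t ht y z hyz j => Or.inr (hFJ ht y z hyz j)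
      · intro w hw
        rw [← Sum.inl.inj hw]; exact Or.inl rfl

theorem isPsiCircuit_minimal_iff (hG : ∀ v, (T.neighborSet v).Finite)
    {C : Set (Sym2 (V × Fin 2))} :
    Minimal (IsPsiCircuit (timesK2 T) Ψ) C ↔ IsPsiCircuit (timesK2 T) Ψ C :=
  ⟨fun h => h.prop, fun h => ⟨h, fun _ h' hsub =>
    (h'.eq_of_subset (finite_neighborSet_timesK2 hG) h hsub).ge⟩⟩

theorem existsUnique_induces (hT : T.IsTree) (hfin : ∀ v, (T.neighborSet v).Finite)
    (Ψ : Set (Ends (timesK2 T))) :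
    ∃! M : Matroid (Sym2 (V × Fin 2)), Induces (timesK2 T) Ψ M := by
  have hG := finite_neighborSet_timesK2 hfin
  obtain ⟨M, hE, hC, hD⟩ := exists_matroid_of_orthogonal (timesK2 T).edgeSet
    (IsPsiCircuit (timesK2 T) Ψ)
    (fun D => D.Nonempty ∧ IsCut (timesK2 T) D ∧ IsPsiBounded (timesK2 T) Ψ D)
    (fun C h => h.1) (fun D h => by
      obtain ⟨-, ⟨W, rfl⟩, -⟩ := h
      exact fun e he => he.1)
    (fun h => by simpa using h.nonempty hG) (fun h => by simpa using h.1)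
    (by
      rintro C D hC ⟨-, ⟨W, rfl⟩, hb⟩ e
      exact hC.inter_cut_ne_singleton hG ((isPsiBounded_iff fun e he => he.1).1 hb) e)
    (by
      intro e he P _ heP
      rcases exists_ladder_or_cut hT Ψ he heP with
        ⟨p, q, hpq, hp, hq, heL, hsub⟩ | ⟨W, heW, hdisj, hav, -⟩
      · exact Or.inl ⟨_, isPsiCircuit_ladder hT hfin hpq hp hq, heL, hsub⟩
      · exact Or.inr ⟨_, ⟨⟨e, heW⟩, isCut_cutOf W, (isPsiBounded_iff fun e he => he.1).2 hav⟩,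
          heW, hdisj⟩)
    (fun I X hIX hX hI => exists_maximal_circuitFree hT hfin hIX hX hI)
  have hM : Induces (timesK2 T) Ψ M :=
    ⟨hE, fun C => (hC C).trans (isPsiCircuit_minimal_iff hfin), hD⟩
  refine ⟨M, hM, fun N hN => ?_⟩
  exact Matroid.ext_isCircuit (hN.1.trans hE.symm) fun C _ =>
    (hN.2.1 C).trans (hM.2.1 C).symm

/-- Paint the complement of a bond at one of its edges `e`. A ladder would meet the bond only in
`e`, so a cut through `e` inside the bond is obtained. By minimality it is the bond, which is
therefore a star or a pair. -/
theorem Induces.meetsInPairs (hT : T.IsTree) (hfin : ∀ v, (T.neighborSet v).Finite)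
    {M : Matroid (Sym2 (V × Fin 2))} (hM : Induces (timesK2 T) Ψ M) : MeetsInPairs M := by
  have hG := finite_neighborSet_timesK2 hfin
  intro C D hC hD
  rw [hM.2.1] at hC
  rw [hM.2.2] at hD
  obtain ⟨⟨e, he⟩, ⟨X, rfl⟩, hb⟩ := hD.prop
  have hDE : cutOf (timesK2 T) X ⊆ (timesK2 T).edgeSet := fun e he => he.1
  have hbX := (isPsiBounded_iff hDE).1 hb
  change e ∈ cutOf (timesK2 T) X at he
  have hmin : ∀ W, e ∈ cutOf (timesK2 T) W →
      Disjoint (cutOf (timesK2 T) W) ((timesK2 T).edgeSet \ cutOf (timesK2 T) X) →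
      (∀ ω ∈ Ψ, AvoidsEnd (timesK2 T) (cutOf (timesK2 T) W) ω) →
      cutOf (timesK2 T) W = cutOf (timesK2 T) X := by
    intro W heW hdisj hav
    have hsub : cutOf (timesK2 T) W ⊆ cutOf (timesK2 T) X := by
      intro f hf
      by_contra hfX
      exact disjoint_left.1 hdisj hf ⟨hf.1, hfX⟩
    exact subset_antisymm hsub (hD.le_of_le ⟨⟨e, heW⟩, isCut_cutOf W,
      (isPsiBounded_iff fun e he => he.1).2 hav⟩ hsub)
  obtain ⟨p, q, hpq, hp, hq, rfl⟩ := (isPsiCircuit_iff_ladder hT hfin).1 hC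
  change (ladder p q ∩ cutOf (timesK2 T) X).encard = 0 ∨
    (ladder p q ∩ cutOf (timesK2 T) X).encard = 2
  rcases exists_ladder_or_cut hT Ψ he.1 (P := (timesK2 T).edgeSet \ cutOf (timesK2 T) X)
    (fun h => h.2 he) with ⟨p', q', hpq', hp', hq', heL, hsub⟩ | ⟨W, heW, hdisj, hav, hshape⟩
  · refine absurd ?_ ((isPsiCircuit_ladder hT hfin hpq' hp' hq').inter_cut_ne_singleton hG hbX e)
    ext f
    constructor
    · rintro ⟨hfL, hfX⟩
      exact (hsub hfL).resolve_right fun h => h.2 hfX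
    · rintro rfl; exact ⟨heL, he⟩
  · have hW := hmin W heW hdisj hav
    rcases hshape with ⟨S, hS⟩ | ⟨x, w, h, hpair⟩
    · rw [← hW]
      exact encard_ladder_inter_star hT hS hav hpq hp hq
    · rw [← hW, hpair]
      exact encard_ladder_inter_pair hT p q h

end Existence

section Rigidity

variable {V : Type u} {T : SimpleGraph V} {Ψ Ψ' : Set (Ends (timesK2 T))}

/-! ### The matroid determines `Ψ` -/

theorem ladder_adj (hT : T.IsTree) {x w : V} (h : T.Adj x w) :
    ladder (.inl x : Pt T) (.inl w) = {rung x, rung w, hor x w 0, hor x w 1} := by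
  ext e
  constructor
  · intro he
    rcases edge_cases (ladder_subset_edgeSet _ _ he) with ⟨y, z, i, hyz, rfl⟩ | ⟨v, rfl⟩
    · have hF : s(y, z) = s(x, w) := by
        by_contra hne
        exact (hor_mem_ladder hT hyz).1 he (Conn.of_mem (F := {s(x, w)}) h rfl y z hyz hne)
      rw [show hor y z i = hor x w i from hor_inj.2 ⟨rfl, hF⟩]
      have : i = 0 ∨ i = 1 := by omega
      rcases this with rfl | rfl <;> simp
    · rcases rung_mem_ladder.1 he with h | h <;> rw [Sum.inl.inj h] <;> simp
  · have hh : ∀ i, hor x w i ∈ ladder (.inl x : Pt T) (.inl w) := fun i =>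
      (hor_mem_ladder hT h).2 fun hiff =>
        notMem_branch hT h (hiff.2 (mem_branch_self x w))
    rintro (rfl | rfl | rfl | rfl)
    · exact rung_mem_ladder.2 (Or.inl rfl)
    · exact rung_mem_ladder.2 (Or.inr rfl)
    · exact hh 0
    · exact hh 1

theorem eq_of_ladder_eq (hT : T.IsTree) {v : V} {q q' : Pt T}
    (h : ladder (.inl v) q = ladder (.inl v) q') : q = q' := by
  by_contra hne
  obtain ⟨x, w, hxw, h1, h2⟩ := exists_separating hT hne
  have h3 := (hor_mem_ladder hT (p := .inl v) (q := q) (i := 0) hxw)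
  have h4 := (hor_mem_ladder hT (p := .inl v) (q := q') (i := 0) hxw)
  rw [h] at h3
  tauto

/-- The two elements lie in the same circuits. -/
def Twins (T : SimpleGraph V) (Ψ : Set (Ends (timesK2 T))) (e f : Sym2 (V × Fin 2)) : Prop :=
  ∀ C, IsPsiCircuit (timesK2 T) Ψ C → (e ∈ C ↔ f ∈ C)

section

variable (hT : T.IsTree) (hfin : ∀ v, (T.neighborSet v).Finite)
include hT hfin

theorem twins_hor {x w : V} (h : T.Adj x w) (i j : Fin 2) :
    Twins T Ψ (hor x w i) (hor x w j) := by
  intro C hC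
  obtain ⟨p, q, -, -, -, rfl⟩ := (isPsiCircuit_iff_ladder hT hfin).1 hC
  rw [hor_mem_ladder hT h, hor_mem_ladder hT h]

theorem isPsiCircuit_ladder_adj {x w : V} (h : T.Adj x w) :
    IsPsiCircuit (timesK2 T) Ψ (ladder (.inl x : Pt T) (.inl w)) :=
  isPsiCircuit_ladder hT hfin (fun heq => h.ne (Sum.inl.inj heq)) trivial trivial

/-- The four-element circuits over the edges of `T` at `v` have little in common. Since `v` has at
least two neighbours, one of these edges can be chosen so that its circuit does not contain a given
`f` other than the rung. -/
theorem eq_of_twins_rung (hdeg : ∀ v a, ∃ w, T.Adj v w ∧ w ≠ a) {v : V} {f : Sym2 (V × Fin 2)}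
    (hf : f ∈ (timesK2 T).edgeSet) (htw : Twins T Ψ (rung v) f) : f = rung v := by
  rcases edge_cases hf with ⟨x, y, i, hxy, rfl⟩ | ⟨u, rfl⟩
  · exfalso
    obtain ⟨w, hvw, hw⟩ : ∃ w, T.Adj v w ∧ s(v, w) ≠ s(x, y) := by
      by_cases hvx : v = x
      · obtain ⟨w, hvw, hw⟩ := hdeg v y
        refine ⟨w, hvw, fun heq => ?_⟩
        rcases Sym2.eq_iff.1 heq with ⟨-, h⟩ | ⟨-, h⟩
        · exact hw h
        · exact hvw.ne (hvx.trans h.symm)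
      · obtain ⟨w, hvw, hw⟩ := hdeg v x
        refine ⟨w, hvw, fun heq => ?_⟩
        rcases Sym2.eq_iff.1 heq with ⟨h, -⟩ | ⟨-, h⟩
        · exact hvx h
        · exact hw h
    have h1 := (htw _ (isPsiCircuit_ladder_adj hT hfin hvw)).1 (rung_mem_ladder.2 (Or.inl rfl))
    rw [ladder_adj hT hvw] at h1
    rcases h1 with h1 | h1 | h1 | h1
    · exact rung_ne_hor h1.symm
    · exact rung_ne_hor h1.symm
    · exact hw (hor_inj.1 h1).2.symm
    · exact hw (hor_inj.1 h1).2.symm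
  · by_contra hne
    obtain ⟨w, hvw, hw⟩ := hdeg v u
    have h1 := (htw _ (isPsiCircuit_ladder_adj hT hfin hvw)).1 (rung_mem_ladder.2 (Or.inl rfl))
    rcases rung_mem_ladder.1 h1 with h1 | h1
    · exact hne (by rw [Sum.inl.inj h1])
    · exact hw (Sum.inl.inj h1)

end

/-! ### Isomorphisms as permutations of the edges -/

/-- The image of an edge set under a permutation of the edges. -/
def edgeImage (φ : (timesK2 T).edgeSet ≃ (timesK2 T).edgeSet) (C : Set (Sym2 (V × Fin 2))) :
    Set (Sym2 (V × Fin 2)) :=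
  {f | ∃ e, e.1 ∈ C ∧ (φ e).1 = f}

theorem mem_edgeImage {φ : (timesK2 T).edgeSet ≃ (timesK2 T).edgeSet}
    {C : Set (Sym2 (V × Fin 2))} {e : (timesK2 T).edgeSet} :
    (φ e).1 ∈ edgeImage φ C ↔ e.1 ∈ C := by
  constructor
  · rintro ⟨e', he', heq⟩
    rwa [← φ.injective (Subtype.ext heq)]
  · exact fun h => ⟨e, h, rfl⟩

/-- The permutation `φ` of the edges maps `Ψ`-circuits to `Ψ'`-circuits. -/
def MapsCircuits (Ψ Ψ' : Set (Ends (timesK2 T)))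
    (φ : (timesK2 T).edgeSet ≃ (timesK2 T).edgeSet) : Prop :=
  ∀ C, IsPsiCircuit (timesK2 T) Ψ C → IsPsiCircuit (timesK2 T) Ψ' (edgeImage φ C)

theorem exists_mapsCircuits {M M' : Matroid (Sym2 (V × Fin 2))} (hM : Induces (timesK2 T) Ψ M)
    (hM' : Induces (timesK2 T) Ψ' M') (hiso : IsIsomorphic M M') :
    ∃ φ, MapsCircuits Ψ Ψ' φ ∧ MapsCircuits Ψ' Ψ φ.symm := by
  have key : ∀ {N N' : Matroid (Sym2 (V × Fin 2))} {Ξ Ξ' : Set (Ends (timesK2 T))},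
      Induces (timesK2 T) Ξ N → Induces (timesK2 T) Ξ' N' →
      ∀ φ : N.E ≃ N'.E, (∀ I : Set N.E, N.Indep (Subtype.val '' I) ↔
        N'.Indep (Subtype.val '' (φ '' I))) → ∀ (h : N.E = (timesK2 T).edgeSet)
        (h' : N'.E = (timesK2 T).edgeSet),
      MapsCircuits Ξ Ξ' ((Equiv.setCongr h.symm).trans (φ.trans (Equiv.setCongr h'))) := by
    intro N N' Ξ Ξ' hN hN' φ hφ h h' C hC
    have hCE : C ⊆ N.E := h ▸ hC.1
    have h1 := (isCircuit_image_iff φ hφ (Subtype.val ⁻¹' C)).1 (by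
      rw [Subtype.image_preimage_coe, inter_eq_right.2 hCE]
      exact (hN.2.1 C).2 hC)
    rw [hN'.2.1] at h1
    convert h1 using 1
    ext f
    constructor
    · rintro ⟨e, he, rfl⟩
      exact ⟨_, ⟨⟨e.1, by rw [h]; exact e.2⟩, he, rfl⟩, rfl⟩
    · rintro ⟨_, ⟨e, he, rfl⟩, rfl⟩
      exact ⟨⟨e.1, by rw [← h]; exact e.2⟩, he, rfl⟩
  obtain ⟨φ, hφ⟩ := hiso
  refine ⟨_, key hM hM' φ hφ hM.1 hM'.1, ?_⟩
  exact key hM' hM φ.symm (fun I => by rw [hφ, Equiv.image_symm_image]) hM'.1 hM.1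

theorem Twins.map {φ : (timesK2 T).edgeSet ≃ (timesK2 T).edgeSet}
    (hφ : MapsCircuits Ψ' Ψ φ.symm) {e f : (timesK2 T).edgeSet} (h : Twins T Ψ e.1 f.1) :
    Twins T Ψ' (φ e).1 (φ f).1 := by
  intro C hC
  have := h _ (hφ C hC)
  have h1 := mem_edgeImage (φ := φ.symm) (C := C) (e := φ e)
  have h2 := mem_edgeImage (φ := φ.symm) (C := C) (e := φ f)
  rw [Equiv.symm_apply_apply] at h1 h2
  rw [← h1, ← h2, this]

/-- The edge of `T × K₂` at `v`, as an element of the edge set. -/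
def rungE (T : SimpleGraph V) (v : V) : (timesK2 T).edgeSet := ⟨rung v, rung_mem_edgeSet v⟩

section

variable (hT : T.IsTree) (hfin : ∀ v, (T.neighborSet v).Finite)
  (hdeg : ∀ v a, ∃ w, T.Adj v w ∧ w ≠ a)
include hT hfin hdeg

/-- If a rung were sent to a copy of an edge of `T`, the other copy would be a twin of the image.
Pulling it back would give a twin of the rung. -/
theorem exists_map_rung {φ : (timesK2 T).edgeSet ≃ (timesK2 T).edgeSet}
    (hφ : MapsCircuits Ψ Ψ' φ) (v : V) : ∃ u, φ (rungE T v) = rungE T u := by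
  rcases edge_cases (φ (rungE T v)).2 with ⟨x, w, i, h, heq⟩ | ⟨u, heq⟩
  · exfalso
    let f : (timesK2 T).edgeSet := ⟨hor x w (i + 1), hor_mem_edgeSet.2 h⟩
    have htw : Twins T Ψ' (φ (rungE T v)).1 f.1 := by
      rw [heq]; exact twins_hor hT hfin h i (i + 1)
    have h1 := Twins.map (φ := φ.symm) (by rwa [Equiv.symm_symm]) htw
    rw [Equiv.symm_apply_apply] at h1
    have h2 := eq_of_twins_rung hT hfin hdeg (φ.symm f).2 h1
    have h3 : f = φ (rungE T v) := by
      rw [← Equiv.symm_apply_eq]; exact Subtype.ext h2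
    have h4 := (hor_inj.1 ((congrArg Subtype.val h3).trans heq)).1
    clear * - h4
    revert i; decide
  · exact ⟨u, Subtype.ext heq⟩

end

/-- The image of the four-element circuit over `xw` is a ladder containing the rungs at `x'` and
`w'`, hence the ladder between them. It has just two elements other than those rungs, whereas a path
of length at least two would supply more. -/
theorem adj_of_map_rung (hT : T.IsTree) (hfin : ∀ v, (T.neighborSet v).Finite)
    {φ : (timesK2 T).edgeSet ≃ (timesK2 T).edgeSet}
    (hφ : MapsCircuits Ψ Ψ' φ) {x w x' w' : V} (h : T.Adj x w)
    (hx : φ (rungE T x) = rungE T x') (hw : φ (rungE T w) = rungE T w') :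
    T.Adj x' w' ∧ edgeImage φ (ladder (.inl x : Pt T) (.inl w)) = ladder (.inl x' : Pt T) (.inl w') := by
  have hne : x' ≠ w' := by
    rintro rfl
    have := congrArg Subtype.val (φ.injective (hx.trans hw.symm))
    exact h.ne (rung_inj.1 this)
  obtain ⟨p, q, -, -, -, hL⟩ := (isPsiCircuit_iff_ladder hT hfin).1
    (hφ _ (isPsiCircuit_ladder_adj hT hfin h))
  have h1 : rung x' ∈ ladder p q := by
    rw [← hL]
    exact ⟨rungE T x, rung_mem_ladder.2 (Or.inl rfl), congrArg Subtype.val hx⟩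
  have h2 : rung w' ∈ ladder p q := by
    rw [← hL]
    exact ⟨rungE T w, rung_mem_ladder.2 (Or.inr rfl), congrArg Subtype.val hw⟩
  have hL' : edgeImage φ (ladder (.inl x : Pt T) (.inl w)) =
      ladder (.inl x' : Pt T) (.inl w') := by
    rw [hL]
    rw [rung_mem_ladder] at h1 h2
    rcases h1 with rfl | rfl <;> rcases h2 with h2 | h2
    · exact absurd (Sum.inl.inj h2) hne
    · rw [h2]
    · rw [h2, ladder_comm hT]
    · exact absurd (Sum.inl.inj h2) hne
  refine ⟨?_, hL'⟩
  have hnex : (.inl w' : Pt T) ≠ .inl x' := fun heq => hne (Sum.inl.inj heq).symm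
  obtain ⟨ha, hb⟩ := next_spec hT hnex
  set y := next (.inl w' : Pt T) x' with hy
  by_contra hnadj
  have hyw : (.inl w' : Pt T) ≠ .inl y := by
    intro heq
    rw [Sum.inl.inj heq] at hnadj
    exact hnadj ha
  obtain ⟨hc, hd⟩ := next_spec hT hyw
  set z := next (.inl w' : Pt T) y with hz
  have hsub := branch_next_subset hT hnex hyw
  rw [← hy, ← hz] at hsub
  have hm1 : ∀ i, hor x' y i ∈ ladder (.inl x' : Pt T) (.inl w') := fun i =>
    (hor_mem_ladder hT ha).2 fun hiff => notMem_branch hT ha (hiff.2 hb)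
  have hm2 : hor y z 0 ∈ ladder (.inl x' : Pt T) (.inl w') :=
    (hor_mem_ladder hT hc).2 fun hiff => hsub.2 (hiff.2 hd)
  have hin : ∀ a b i, hor a b i ∈ ladder (.inl x' : Pt T) (.inl w') →
      hor a b i = (φ ⟨hor x w 0, hor_mem_edgeSet.2 h⟩).1 ∨
      hor a b i = (φ ⟨hor x w 1, hor_mem_edgeSet.2 h⟩).1 := by
    intro a b i hmem
    rw [← hL'] at hmem
    obtain ⟨e, he, heq⟩ := hmem
    rw [ladder_adj hT h] at he
    rcases he with he | he | he | he
    · have : e = rungE T x := Subtype.ext he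
      rw [this, hx] at heq
      exact absurd heq rung_ne_hor
    · have : e = rungE T w := Subtype.ext he
      rw [this, hw] at heq
      exact absurd heq rung_ne_hor
    · left
      rw [← heq]; congr 2; exact Subtype.ext he
    · right
      rw [← heq]; congr 2; exact Subtype.ext he
  have h01 : hor x' y 0 ≠ hor x' y 1 := fun heq => absurd (hor_inj.1 heq).1 (by decide)
  have hyz : ∀ i, hor x' y i ≠ hor y z 0 := by
    intro i heq
    rcases Sym2.eq_iff.1 (hor_inj.1 heq).2 with ⟨h5, -⟩ | ⟨h5, -⟩
    · exact ha.ne h5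
    · exact hsub.2 (by rw [h5]; exact mem_branch_self y z)
  rcases hin _ _ _ (hm1 0) with h5 | h5 <;> rcases hin _ _ _ (hm1 1) with h6 | h6 <;>
    rcases hin _ _ _ hm2 with h7 | h7
  · exact h01 (h5.trans h6.symm)
  · exact h01 (h5.trans h6.symm)
  · exact hyz 0 (h5.trans h7.symm)
  · exact hyz 1 (h6.trans h7.symm)
  · exact hyz 1 (h6.trans h7.symm)
  · exact hyz 0 (h5.trans h7.symm)
  · exact h01 (h5.trans h6.symm)
  · exact h01 (h5.trans h6.symm)

theorem subset_of_mapsCircuits (h1T : IsOneOfEachDegreeTree T)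
    {φ : (timesK2 T).edgeSet ≃ (timesK2 T).edgeSet}
    (hφ : MapsCircuits Ψ Ψ' φ) (hφ' : MapsCircuits Ψ' Ψ φ.symm) : Ψ ⊆ Ψ' := by
  obtain ⟨hT, hloc, huniq⟩ := h1T
  have hfin : ∀ v, (T.neighborSet v).Finite := fun v => (hloc v).1
  have hdeg : ∀ v a, ∃ w, T.Adj v w ∧ w ≠ a := by
    intro v a
    obtain ⟨w, hw, hwa⟩ := exists_ne_of_one_lt_ncard (hloc v).2 a
    exact ⟨w, hw, hwa⟩
  choose σ hσ using fun v => exists_map_rung hT hfin hdeg hφ v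
  choose τ hτ using fun v => exists_map_rung hT hfin hdeg hφ' v
  have hrung : ∀ {a b : V}, rungE T a = rungE T b → a = b := fun h =>
    rung_inj.1 (congrArg Subtype.val h)
  have hστ : ∀ v, σ (τ v) = v := fun v => hrung (by
    rw [← hσ, ← hτ, Equiv.apply_symm_apply])
  have hτσ : ∀ v, τ (σ v) = v := fun v => hrung (by
    rw [← hτ, ← hσ, Equiv.symm_apply_apply])
  have hadj : ∀ {x w}, T.Adj x w → T.Adj (σ x) (σ w) := fun h =>
    (adj_of_map_rung hT hfin hφ h (hσ _) (hσ _)).1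
  have hadj' : ∀ {x w}, T.Adj x w → T.Adj (τ x) (τ w) := fun h =>
    (adj_of_map_rung hT hfin hφ' h (hτ _) (hτ _)).1
  -- `σ` is an automorphism of `T`, so it preserves degrees, and no two vertices have the same
  -- degree.
  have hid : ∀ v, σ v = v := by
    intro v
    have hN : T.neighborSet (σ v) = σ '' T.neighborSet v := by
      ext w
      constructor
      · intro hw
        have := hadj' hw
        rw [hτσ] at this
        exact ⟨τ w, this, hστ w⟩
      · rintro ⟨u, hu, rfl⟩
        exact hadj hu
    have hinj : Function.Injective σ := fun a b hab => by rw [← hτσ a, hab, hτσ]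
    have hcard : (T.neighborSet (σ v)).ncard = (T.neighborSet v).ncard := by
      rw [hN, ncard_image_of_injective _ hinj]
    exact (huniq _ (hloc v).2).unique hcard rfl
  have hhor : ∀ x w i (h : T.Adj x w), ∃ j, (φ ⟨hor x w i, hor_mem_edgeSet.2 h⟩).1 = hor x w j := by
    intro x w i h
    have h1 := (adj_of_map_rung hT hfin hφ h ((hσ x).trans (by rw [hid]))
      ((hσ w).trans (by rw [hid]))).2
    have h2 : (φ ⟨hor x w i, hor_mem_edgeSet.2 h⟩).1 ∈ ladder (.inl x : Pt T) (.inl w) := by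
      rw [← h1]
      refine mem_edgeImage.2 ?_
      rw [ladder_adj hT h]
      have : i = 0 ∨ i = 1 := by omega
      rcases this with rfl | rfl <;> simp
    rw [ladder_adj hT h] at h2
    have hnr : ∀ v, (φ ⟨hor x w i, hor_mem_edgeSet.2 h⟩).1 ≠ rung v := by
      intro v heq
      have : φ ⟨hor x w i, hor_mem_edgeSet.2 h⟩ = φ (rungE T v) := by
        rw [hσ, hid]; exact Subtype.ext heq
      exact rung_ne_hor (congrArg Subtype.val (φ.injective this)).symm
    rcases h2 with h2 | h2 | h2 | h2
    · exact absurd h2 (hnr x)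
    · exact absurd h2 (hnr w)
    · exact ⟨0, h2⟩
    · exact ⟨1, h2⟩
  intro ω hω
  obtain ⟨v⟩ := hT.connected.nonempty
  have hne : (.inl v : Pt T) ≠ .inr ω := by simp
  obtain ⟨p, q, hpq, hp, hq, hL⟩ := (isPsiCircuit_iff_ladder hT hfin).1
    (hφ _ (isPsiCircuit_ladder hT hfin hne trivial hω))
  -- The permutation fixes every rung and at most swaps the two copies of an edge, so it maps a
  -- ladder into itself.
  have hsub : ladder p q ⊆ ladder (.inl v) (.inr ω) := by
    rw [← hL]
    rintro _ ⟨⟨e, hE⟩, he, rfl⟩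
    change e ∈ _ at he
    rcases edge_cases hE with ⟨x, w, i, h, rfl⟩ | ⟨y, rfl⟩
    · obtain ⟨j, hj⟩ := hhor x w i h
      rw [hj]
      rw [hor_mem_ladder hT h] at he ⊢
      exact he
    · have h1 := hσ y
      rw [hid] at h1
      change (φ (rungE T y)).1 ∈ _
      rw [h1]; exact he
  -- Since `ω` is not yet known to be in `Ψ'`, the two ladders are compared in the space with all
  -- ends, where both are circles.
  have htop : ∀ r, IsTerm Set.univ Ψ' r → IsTerm Set.univ (Set.univ : Set (Ends (timesK2 T))) r := by
    rintro (u | η) - <;> trivial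
  have hcirc : ladder p q = ladder (.inl v) (.inr ω) :=
    (isPsiCircuit_ladder hT hfin hpq (htop p hp) (htop q hq)).eq_of_subset
      (finite_neighborSet_timesK2 hfin)
      (isPsiCircuit_ladder (Ψ := Set.univ) hT hfin hne trivial trivial) hsub
  have hv : rung v ∈ ladder p q := by
    rw [hcirc]; exact rung_mem_ladder.2 (Or.inl rfl)
  rcases rung_mem_ladder.1 hv with rfl | rfl
  · rw [eq_of_ladder_eq hT hcirc] at hq; exact hq
  · rw [ladder_comm hT] at hcirc
    rw [eq_of_ladder_eq hT hcirc] at hp; exact hp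

theorem eq_of_isIsomorphic (h1T : IsOneOfEachDegreeTree T) {M M' : Matroid (Sym2 (V × Fin 2))}
    (hM : Induces (timesK2 T) Ψ M) (hM' : Induces (timesK2 T) Ψ' M') (hiso : IsIsomorphic M M') :
    Ψ = Ψ' := by
  obtain ⟨φ, h1, h2⟩ := exists_mapsCircuits hM hM' hiso
  exact subset_antisymm (subset_of_mapsCircuits h1T h1 h2)
    (subset_of_mapsCircuits h1T h2 (by rwa [Equiv.symm_symm]))

end Rigidity

section Cardinality

variable {V : Type u} {T : SimpleGraph V}

/-! ### The number of ends -/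

theorem IsOneOfEachDegreeTree.countable (h : IsOneOfEachDegreeTree T) : Countable V := by
  refine Function.Injective.countable (f := fun v => (T.neighborSet v).ncard) fun a b hab => ?_
  exact (h.2.2 _ (h.2.1 b).2).unique hab rfl

theorem mk_ends_le [Countable V] (G : SimpleGraph (V × Fin 2)) : #(Ends G) ≤ 2 ^ (ℵ₀ : Cardinal.{u}) := by
  have h1 : #(Ends G) ≤ #(Ray G) := mk_le_of_surjective (f := Ray.toEnd) fun ω => ω.exists_ray
  have h2 : #(Ray G) ≤ #(ℕ → V × Fin 2) := mk_le_of_injective (f := Ray.toFun) (by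
    rintro ⟨f, _, _⟩ ⟨g, _, _⟩ h
    simpa using h)
  refine h1.trans (h2.trans ?_)
  rw [mk_arrow, mk_nat, lift_aleph0, lift_uzero]
  refine (power_le_power_right (mk_le_aleph0 (α := V × Fin 2))).trans ?_
  rw [aleph0_power_aleph0, two_power_aleph0]

section Branching

variable (hT : T.IsTree)
include hT

/-- In a tree, a walk that never reverses a step moves into a decreasing sequence of branches. -/
theorem mem_branch_of_nonbacktracking {g : ℕ → V} (hg : ∀ n, T.Adj (g n) (g (n + 1)))
    (hb : ∀ n, g (n + 2) ≠ g n) {m n : ℕ} (hmn : m < n) : g n ∈ branch T (g m) (g (m + 1)) := by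
  have hstep : ∀ n, branch T (g (n + 1)) (g (n + 2)) ⊆ branch T (g n) (g (n + 1)) := by
    intro n
    refine branch_subset hT (hg n) (mem_branch_of_adj (mem_branch_self _ _) (hg (n + 1)) ?_) ?_
    · intro heq
      rcases Sym2.eq_iff.1 heq with ⟨h, -⟩ | ⟨-, h⟩
      · exact (hg n).ne h.symm
      · exact hb n h
    · intro hmem
      exact hb n (branch_cross hT (hg (n + 1)) hmem (hg n) (notMem_branch hT (hg (n + 1)))).1.symm
  have hsub : ∀ n ≥ m, branch T (g n) (g (n + 1)) ⊆ branch T (g m) (g (m + 1)) := by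
    intro n hn
    induction n, hn using Nat.le_induction with
    | base => exact Subset.rfl
    | succ n _ ih => exact (hstep n).trans ih
  obtain ⟨k, rfl⟩ : ∃ k, n = k + 1 := ⟨n - 1, by omega⟩
  exact hsub k (by omega) (mem_branch_self _ _)

/-- The ray in `T × K₂` over a path in `T` without backtracking. -/
def rayOfNonbacktracking {g : ℕ → V} (hg : ∀ n, T.Adj (g n) (g (n + 1)))
    (hb : ∀ n, g (n + 2) ≠ g n) : Ray (timesK2 T) where
  toFun n := (g n, 0)
  injective := by
    have key : ∀ m n, m < n → g m ≠ g n := fun m n hmn heq =>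
      notMem_branch hT (hg m) (heq ▸ mem_branch_of_nonbacktracking hT hg hb hmn)
    intro m n heq
    have heq := congrArg Prod.fst heq
    rcases lt_trichotomy m n with h | h | h
    · exact absurd heq (key m n h)
    · exact h
    · exact absurd heq.symm (key n m h)
  adj n := timesK2_adj_horizontal (hg n)

theorem beyond_rayOfNonbacktracking {g : ℕ → V} (hg : ∀ n, T.Adj (g n) (g (n + 1)))
    (hb : ∀ n, g (n + 2) ≠ g n) (n : ℕ) :
    Beyond T (g n) (g (n + 1)) (.inr (rayOfNonbacktracking hT hg hb).toEnd) :=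
  ⟨_, rfl, n + 1, fun _ hm => mem_branch_of_nonbacktracking hT hg hb hm⟩

/-- A tree in which only one vertex does not branch has at least continuum many ends. -/
theorem exists_injective_ends {z x₀ : V} (hzx : T.Adj z x₀)
    (hbranch : ∀ u v, v ≠ z → ∃ c : Bool → V, c true ≠ c false ∧
      ∀ b, T.Adj v (c b) ∧ c b ≠ u) :
    ∃ f : (ℕ → Bool) → Ends (timesK2 T), Function.Injective f := by
  classical
  have hbranch' : ∀ u v, ∃ c : Bool → V, v ≠ z → c true ≠ c false ∧
      ∀ b, T.Adj v (c b) ∧ c b ≠ u := by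
    intro u v
    by_cases hv : v = z
    · exact ⟨fun _ => v, fun h => absurd hv h⟩
    · obtain ⟨c, hc⟩ := hbranch u v hv
      exact ⟨c, fun _ => hc⟩
  choose c hc using hbranch'
  -- The state is a pair of consecutive vertices. The walk starts at the exceptional vertex `z` and
  -- never returns to it, so every later vertex offers two ways onward and a bit chooses between
  -- them.
  let st : (ℕ → Bool) → ℕ → V × V := fun β n =>
    Nat.rec (z, x₀) (fun n p => (p.2, c p.1 p.2 (β n))) n
  have hst : ∀ β n, st β (n + 1) = ((st β n).2, c (st β n).1 (st β n).2 (β n)) := fun _ _ => rfl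
  let g : (ℕ → Bool) → ℕ → V := fun β n => (st β n).1
  have hg2 : ∀ β n, (st β n).2 = g β (n + 1) := fun β n => by simp only [g, hst]
  have hrec : ∀ β n, g β (n + 2) = c (g β n) (g β (n + 1)) (β n) := by
    intro β n
    rw [← hg2 β (n + 1), hst, hg2]
  have hinv : ∀ β n, T.Adj (g β n) (g β (n + 1)) ∧ z ∉ branch T (g β n) (g β (n + 1)) := by
    intro β n
    induction n with
    | zero => exact ⟨hzx, notMem_branch hT hzx⟩
    | succ n ih =>
      obtain ⟨h1, h2⟩ := ih
      have hne : g β (n + 1) ≠ z := fun h => h2 (h ▸ mem_branch_self _ _)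
      obtain ⟨h3, h4⟩ := (hc (g β n) (g β (n + 1)) hne).2 (β n)
      rw [← hrec] at h3 h4
      refine ⟨h3, fun hz => h2 ?_⟩
      refine branch_subset hT h1 (mem_branch_of_adj (mem_branch_self _ _) h3 ?_) ?_ hz
      · intro heq
        rcases Sym2.eq_iff.1 heq with ⟨h, -⟩ | ⟨-, h⟩
        · exact h1.ne h.symm
        · exact h4 h
      · intro hmem
        exact h4 (branch_cross hT h3 hmem h1 (notMem_branch hT h3)).1.symm
  have hne : ∀ β n, g β (n + 1) ≠ z := fun β n h => (hinv β n).2 (h ▸ mem_branch_self _ _)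
  have hadj : ∀ β n, T.Adj (g β n) (g β (n + 1)) := fun β n => (hinv β n).1
  have hb : ∀ β n, g β (n + 2) ≠ g β n := fun β n => by
    rw [hrec]; exact ((hc _ _ (hne β n)).2 (β n)).2
  refine ⟨fun β => (rayOfNonbacktracking hT (hadj β) (hb β)).toEnd, fun β β' heq => ?_⟩
  by_contra hcon
  have hex : ∃ n, β n ≠ β' n := Function.ne_iff.1 hcon
  have hsame : ∀ n ≤ Nat.find hex, st β n = st β' n := by
    intro n
    induction n with
    | zero => exact fun _ => rfl
    | succ n ih =>
      intro hn
      have := not_not.1 (Nat.find_min hex (m := n) (by omega))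
      rw [hst, hst, ih (by omega), this]
  set N := Nat.find hex
  have hN : β N ≠ β' N := Nat.find_spec hex
  have h0 : g β N = g β' N := congrArg Prod.fst (hsame N le_rfl)
  have h1 : g β (N + 1) = g β' (N + 1) := by
    rw [← hg2, ← hg2]; exact congrArg Prod.snd (hsame N le_rfl)
  -- At the first differing bit the two walks leave a common vertex by different edges. Equal ends
  -- would lie beyond both, contrary to `beyond_unique`.
  have hb1 := beyond_rayOfNonbacktracking hT (hadj β) (hb β) (N + 1)
  have hb2 := beyond_rayOfNonbacktracking hT (hadj β') (hb β') (N + 1)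
  simp only at heq
  rw [← heq, ← h1] at hb2
  have h2 := beyond_unique hT (hadj β (N + 1)) (h1 ▸ hadj β' (N + 1)) hb1 hb2
  rw [show N + 1 + 1 = N + 2 from rfl, hrec, hrec, ← h0, ← h1] at h2
  have hcc := (hc (g β N) (g β (N + 1)) (hne β N)).1
  rcases h3 : β N <;> rcases h4 : β' N <;> rw [h3, h4] at h2 hN
  · exact hN rfl
  · exact hcc h2.symm
  · exact hcc h2
  · exact hN rfl

end Branching

theorem IsOneOfEachDegreeTree.mk_ends (h : IsOneOfEachDegreeTree T) :
    #(Ends (timesK2 T)) = 2 ^ (ℵ₀ : Cardinal.{u}) := by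
  have := h.countable
  refine le_antisymm (mk_ends_le _) ?_
  obtain ⟨hT, hloc, huniq⟩ := h
  obtain ⟨z, hz, hz'⟩ := huniq 2 le_rfl
  obtain ⟨x₀, hx₀⟩ : (T.neighborSet z).Nonempty := by
    rw [nonempty_iff_ne_empty]; intro h0; rw [h0] at hz; simp at hz
  obtain ⟨f, hf⟩ := exists_injective_ends hT hx₀ fun w v hv => by
    have h2 : 2 < (T.neighborSet v).ncard :=
      lt_of_le_of_ne (hloc v).2 fun h => hv (hz' v h.symm)
    have h3 : 1 < (T.neighborSet v \ {w}).ncard := by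
      have := ncard_le_ncard_sdiff_add_ncard (T.neighborSet v) {w}
      rw [ncard_singleton] at this
      omega
    obtain ⟨a, ha, b, hb, hab⟩ := (one_lt_ncard ((hloc v).1.subset sdiff_subset)).1 h3
    refine ⟨fun i => if i then a else b, by simpa using hab, fun i => ?_⟩
    cases i
    · exact ⟨hb.1, hb.2⟩
    · exact ⟨ha.1, ha.2⟩
  have := lift_mk_le_lift_mk_of_injective hf
  simpa using this

theorem IsOneOfEachDegreeTree.mk_set_ends (h : IsOneOfEachDegreeTree T) :
    #(Set (Ends (timesK2 T))) = 2 ^ (2 ^ ℵ₀ : Cardinal.{u}) := by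
  rw [mk_set, h.mk_ends]

end Cardinality

/-! ### A tree with one vertex of each degree -/

section Example

/-- The children of `k` are the numbers from `firstChild k` to `firstChild (k + 1) - 1`. -/
def firstChild : ℕ → ℕ
  | 0 => 1
  | k + 1 => firstChild k + (if k = 0 then 2 else k + 1)

/-- `n` is a child of `k`. -/
def IsChild (k n : ℕ) : Prop := firstChild k ≤ n ∧ n < firstChild (k + 1)

theorem firstChild_strictMono : StrictMono firstChild := by
  refine strictMono_nat_of_lt_succ fun n => ?_
  rw [firstChild]
  split_ifs <;> omega

theorem lt_firstChild (k : ℕ) : k < firstChild k := by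
  induction k with
  | zero => exact Nat.one_pos
  | succ k ih => exact lt_of_le_of_lt ih (firstChild_strictMono (Nat.lt_succ_self k))

theorem IsChild.lt {k n : ℕ} (h : IsChild k n) : k < n := (lt_firstChild k).trans_le h.1

theorem IsChild.unique {k l n : ℕ} (h : IsChild k n) (h' : IsChild l n) : k = l := by
  have h1 := firstChild_strictMono.lt_iff_lt.1 (h.1.trans_lt h'.2)
  have h2 := firstChild_strictMono.lt_iff_lt.1 (h'.1.trans_lt h.2)
  omega

theorem exists_isChild {n : ℕ} (hn : 0 < n) : ∃ k, IsChild k n := by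
  classical
  have hex : ∃ k, n < firstChild (k + 1) := ⟨n, (lt_firstChild n).trans
    (firstChild_strictMono (Nat.lt_succ_self n))⟩
  refine ⟨Nat.find hex, ?_, Nat.find_spec hex⟩
  rcases h : Nat.find hex with _ | k
  · exact hn
  · exact not_lt.1 (Nat.find_min hex (m := k) (by omega))

/-- A tree on `ℕ` in which the vertex `k` has degree `k + 2`. -/
def degreeTree : SimpleGraph ℕ where
  Adj a b := IsChild a b ∨ IsChild b a
  symm := ⟨fun _ _ h => h.symm⟩
  loopless := ⟨fun a h => by rcases h with h | h <;> exact absurd h.lt (lt_irrefl a)⟩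

/-- The root 0 has two children and no parent; any other `k` has `k + 1` children and one parent. -/
theorem degreeTree_ncard (k : ℕ) :
    (degreeTree.neighborSet k).Finite ∧ (degreeTree.neighborSet k).ncard = k + 2 := by
  have hset : degreeTree.neighborSet k = Ico (firstChild k) (firstChild (k + 1)) ∪
      {j | IsChild j k} := rfl
  have hsize : firstChild (k + 1) - firstChild k = if k = 0 then 2 else k + 1 := by
    rw [firstChild, Nat.add_sub_cancel_left]
  have hcard : (Ico (firstChild k) (firstChild (k + 1))).ncard = if k = 0 then 2 else k + 1 := by
    rw [← hsize, ← Finset.coe_Ico, ncard_coe_finset, Nat.card_Ico]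
  rcases Nat.eq_zero_or_pos k with rfl | hk
  · have : {j | IsChild j 0} = ∅ := eq_empty_of_forall_notMem fun j hj =>
      absurd (IsChild.lt hj) (Nat.not_lt_zero j)
    rw [hset, this, union_empty, hcard]
    exact ⟨finite_Ico _ _, rfl⟩
  · obtain ⟨j, hj⟩ := exists_isChild hk
    have : {j | IsChild j k} = {j} := ext fun l => ⟨fun hl => IsChild.unique hl hj, fun hl => hl ▸ hj⟩
    rw [hset, this]
    refine ⟨(finite_Ico _ _).union (finite_singleton j), ?_⟩
    rw [ncard_union_eq ?_ (finite_Ico _ _) (finite_singleton j), hcard, ncard_singleton,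
      if_neg hk.ne']
    rw [disjoint_singleton_right]
    intro hmem
    exact absurd (IsChild.lt (k := k) (n := j) hmem) hj.lt.le.not_gt

theorem degreeTree_isTree : degreeTree.IsTree := by
  classical
  have hpar : ∀ n, ∃ k, (0 < n → IsChild k n) ∧ (n = 0 → k = 0) := by
    intro n
    rcases Nat.eq_zero_or_pos n with rfl | hn
    · exact ⟨0, fun h => absurd h (lt_irrefl 0), fun _ => rfl⟩
    · obtain ⟨k, hk⟩ := exists_isChild hn
      exact ⟨k, fun _ => hk, fun h => absurd h hn.ne'⟩
  choose par hpar hpar0 using hpar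
  have hle : ∀ n, par n ≤ n := fun n => by
    rcases Nat.eq_zero_or_pos n with rfl | hn
    · exact (hpar0 0 rfl).le
    · exact (hpar n hn).lt.le
  have hparc : ∀ {k n}, IsChild k n → par n = k := fun h =>
    (hpar _ (Nat.zero_lt_of_lt h.lt)).unique h
  have hiter : ∀ m n, par^[m] n ≤ n := by
    intro m
    induction m with
    | zero => exact fun n => le_rfl
    | succ m ih => exact fun n => (ih (par n)).trans (hle n)
  refine ⟨?_, ?_⟩
  · have hreach : ∀ n, degreeTree.Reachable n 0 := by
      intro n
      induction n using Nat.strong_induction_on with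
      | _ n ih =>
        rcases Nat.eq_zero_or_pos n with rfl | hn
        · exact SimpleGraph.Reachable.refl _
        · have hc := hpar n hn
          exact (SimpleGraph.Adj.reachable (show degreeTree.Adj n (par n) from Or.inr hc)).trans
            (ih _ hc.lt)
    exact { preconnected := fun a b => (hreach a).trans (hreach b).symm, nonempty := ⟨0⟩ }
  · rw [SimpleGraph.isAcyclic_iff_forall_isBridge]
    have key : ∀ p a, IsChild p a → ¬ (degreeTree.deleteEdges {s(p, a)}).Reachable a p := by
      rintro p a hpa ⟨w⟩
      -- The descendants of `a` are left only by the edge to its parent `p`. And `p` is not among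
      -- them, because taking parents never increases a number.
      let D : Set ℕ := {x | ∃ n, par^[n] x = a}
      have hp : p ∉ D := by
        rintro ⟨n, hn⟩
        have := hiter n p
        rw [hn] at this
        exact absurd hpa.lt this.not_gt
      obtain ⟨d, -, h1, h2⟩ := w.exists_boundary_dart D ⟨0, rfl⟩ hp
      obtain ⟨hadj, hne⟩ := SimpleGraph.deleteEdges_adj.1 d.adj
      obtain ⟨n, hn⟩ := h1
      rcases hadj with hc | hc
      · exact h2 ⟨n + 1, by rw [Function.iterate_succ_apply, hparc hc, hn]⟩
      · rcases n with _ | n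
        · have h3 : d.toProd.1 = a := hn
          have h4 : d.toProd.2 = p := by rw [h3] at hc; exact hc.unique hpa
          rw [h3, h4] at hne
          exact hne Sym2.eq_swap
        · rw [Function.iterate_succ_apply, hparc hc] at hn
          exact h2 ⟨n, hn⟩
    intro e hab
    induction e with | _ a b =>
    rw [SimpleGraph.isBridge_iff]
    rcases hab with h | h
    · exact fun hr => key a b h hr.symm
    · intro hr
      rw [Sym2.eq_swap] at hr
      exact key b a h hr

theorem degreeTree_isOneOfEachDegreeTree : IsOneOfEachDegreeTree degreeTree := by
  refine ⟨degreeTree_isTree, fun v => ⟨(degreeTree_ncard v).1, ?_⟩, fun n hn => ⟨n - 2, ?_, ?_⟩⟩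
  · rw [(degreeTree_ncard v).2]; omega
  · simp only [(degreeTree_ncard _).2]; omega
  · intro v hv
    rw [(degreeTree_ncard v).2] at hv; omega

end Example

/-! ### The number of matroids -/

theorem mk_countableTameClass_le : #CountableTameClass ≤ 2 ^ (2 ^ ℵ₀ : Cardinal.{0}) := by
  have h1 : #CountableTameClass ≤ #(Set ℕ × Set (Set ℕ)) :=
    mk_le_of_injective (f := fun M => (M.1.E, {I | M.1.Indep I})) fun M N h => by
      have hE : M.1.E = N.1.E := congrArg Prod.fst h
      have hI : {I | M.1.Indep I} = {I | N.1.Indep I} := congrArg Prod.snd h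
      exact Subtype.ext (Matroid.ext_indep hE fun I _ => Set.ext_iff.1 hI I)
  refine h1.trans ?_
  rw [mk_prod, lift_id, lift_id, mk_set, mk_set, mk_nat]
  have h2 : (ℵ₀ : Cardinal.{0}) ≤ 2 ^ (2 ^ ℵ₀ : Cardinal.{0}) :=
    (cantor _).le.trans (cantor _).le
  rw [mk_set, mk_nat]
  exact (mul_eq_max_of_aleph0_le_right (by simp [continuum_ne_zero]) h2).le.trans (max_le (cantor _).le le_rfl)

/-- The matroids `M Ψ` of one concrete tree are carried to `ℕ` by an injection of the countable set
of pairs of vertices. Rigidity keeps them pairwise non-isomorphic. -/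
theorem mk_isoSetoid_quotient : #(Quotient isoSetoid) = 2 ^ (2 ^ ℵ₀ : Cardinal.{0}) := by
  refine le_antisymm (mk_quotient_le.trans mk_countableTameClass_le) ?_
  have h1T := degreeTree_isOneOfEachDegreeTree
  have hfin : ∀ v, (degreeTree.neighborSet v).Finite := fun v => (h1T.2.1 v).1
  rw [← h1T.mk_set_ends]
  choose M hM using fun Ψ => (existsUnique_induces h1T.1 hfin Ψ).exists
  obtain ⟨j, hj⟩ := exists_injective_nat (Sym2 (ℕ × Fin 2))
  have hpairs : ∀ Ψ, MeetsInPairs ((M Ψ).map j hj.injOn) := fun Ψ =>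
    ((hM Ψ).meetsInPairs h1T.1 hfin).map hj.injOn
  let f : Set (Ends (timesK2 degreeTree)) → Quotient isoSetoid := fun Ψ =>
    Quotient.mk isoSetoid ⟨(M Ψ).map j hj.injOn, (hpairs Ψ).isTame, (hpairs Ψ).not_hasMK4Minor,
      (hpairs Ψ).not_hasU24Minor⟩
  refine mk_le_of_injective (f := f) fun Ψ Ψ' h => ?_
  have hiso : IsIsomorphic ((M Ψ).map j hj.injOn) ((M Ψ').map j hj.injOn) :=
    Quotient.exact (s := isoSetoid) h
  exact eq_of_isIsomorphic h1T (hM Ψ) (hM Ψ') ((isIsomorphic_map (M Ψ) hj.injOn).trans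
    (hiso.trans (isIsomorphic_map (M Ψ') hj.injOn).symm))

end PsiMatroid

theorem corollary1p6 :
    -- the number of isomorphism classes
    #(Quotient PsiMatroid.isoSetoid) = 2 ^ (2 ^ ℵ₀ : Cardinal.{0}) ∧
    -- the trees that are used exist
    (∃ T : SimpleGraph ℕ, PsiMatroid.IsOneOfEachDegreeTree T) ∧
    -- each of them yields that many pairwise non-isomorphic matroids
    (∀ (V : Type u) (T : SimpleGraph V), PsiMatroid.IsOneOfEachDegreeTree T →
      #(Set (PsiMatroid.Ends (PsiMatroid.timesK2 T))) = 2 ^ (2 ^ ℵ₀ : Cardinal.{u}) ∧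
      (∀ Ψ : Set (PsiMatroid.Ends (PsiMatroid.timesK2 T)),
        ∃! M : Matroid (Sym2 (V × Fin 2)), PsiMatroid.Induces (PsiMatroid.timesK2 T) Ψ M) ∧
      (∀ (Ψ : Set (PsiMatroid.Ends (PsiMatroid.timesK2 T))) (M : Matroid (Sym2 (V × Fin 2))),
        PsiMatroid.Induces (PsiMatroid.timesK2 T) Ψ M →
          M.E.Countable ∧ PsiMatroid.IsTame M ∧
            ¬ PsiMatroid.HasMK4Minor M ∧ ¬ PsiMatroid.HasU24Minor M) ∧
      (∀ (Ψ Ψ' : Set (PsiMatroid.Ends (PsiMatroid.timesK2 T)))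
        (M M' : Matroid (Sym2 (V × Fin 2))),
        PsiMatroid.Induces (PsiMatroid.timesK2 T) Ψ M →
        PsiMatroid.Induces (PsiMatroid.timesK2 T) Ψ' M' →
          PsiMatroid.IsIsomorphic M M' → Ψ = Ψ')) := by
  refine ⟨PsiMatroid.mk_isoSetoid_quotient,
    ⟨_, PsiMatroid.degreeTree_isOneOfEachDegreeTree⟩, fun V T h => ?_⟩
  have hfin : ∀ v, (T.neighborSet v).Finite := fun v => (h.2.1 v).1
  have := h.countable
  refine ⟨h.mk_set_ends, PsiMatroid.existsUnique_induces h.1 hfin, fun Ψ M hM => ?_,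
    fun Ψ Ψ' M M' hM hM' hiso => PsiMatroid.eq_of_isIsomorphic h hM hM' hiso⟩
  have hpairs := hM.meetsInPairs h.1 hfin
  exact ⟨to_countable _, hpairs.isTame, hpairs.not_hasMK4Minor, hpairs.not_hasU24Minor⟩
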